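/- Let $(\Omega,g)$ be a smooth compact connected Riemannian manifold of dimension $d\ge 3$ with connected (non-empty) boundary $\partial\Omega$ and outward unit normal $N$. Let $\lambda$ be the Riemannian volume measure of $\Omega$ and $\sigma$ the Riemannian surface (Hausdorff) measure of $\partial\Omega$. Let $\alpha,\beta\in C(\Omega)$ be such that $\alpha>0$ and $\beta>0$ $\lambda$-a.e. on $\Omega$, $\beta>0$ $\sigma$-a.e. on $\partial\Omega$, and $\beta$ has a weak gradient $\nabla\beta\in L^1_{loc}$ in the interior of $\Omega$. Put $$A=\int_\Omega\alpha\,d\lambda,\qquad B=\int_{\partial\Omega}\beta\,d\sigma,\qquad d\lambda_\alpha=\frac{\alpha}{A}\,d\lambda,\qquad d\sigma_\beta=\frac{\beta}{B}\,d\sigma .$$ Let $H^{1,q}_{\lambda_\alpha}(\Omega)$ be the completion of $C^1(\Omega)$ with respect to the $L^q(\lambda_\alpha)$ norms of $f$ and $\nabla f$, and let $C^{\beta,\alpha}_{p,q}\in[0,\infty]$ be the optimal constant in $$\Big(\int_\Omega |f-\bar f|^p\,\tfrac{\beta}{B}\,d\lambda\Big)^{1/p}\le C^{\beta,\alpha}_{p,q}\Big(\int_\Omega|\nabla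 f|^q\,d\lambda_\alpha\Big)^{1/q}\quad\text{for all } f\in H^{1,q}_{\lambda_\alpha}(\Omega),\qquad \bar f:=\int_\Omega f\,d\lambda_\alpha .$$ Write $|\cdot|_\infty$ for the $L^\infty(\Omega,\lambda)$ norm (possibly $\infty$) and $h^-=\max(-h,0)$. Then for every $\rho\in C^1(\Omega)$ such that $\frac{\partial\rho}{\partial N}=-1$ on $\partial\Omega$ and $\nabla\rho$ is Lipschitz continuous on $\Omega$, every $f\in C^1(\Omega)$ with $\int_\Omega f\,d\lambda_\alpha=0$, and every $p\in\big[2,\frac{2d-2}{d-2}\big]$, $$\Big(\int_{\partial\Omega}|f|^p\,d\sigma_\beta\Big)^{2/p}\le\left(\Big((p|\nabla\rho|_\infty)^2\,\Big|\frac{\beta}{\alpha}\Big|_\infty\frac{A}{B}\,\big(C^{\beta,\alpha}_{2(p-1),2}\big)^{2(p-1)}\Big)^{1/p}+\Big|\Big(\Delta\rho+\nabla\rho\cdot\frac{\nabla\beta}{\beta}\Big)^-\Big|_\infty^{2/p}\big(C^{\beta,\alpha}_{p,2}\big)^2\right)\int_\Omega|\nabla f|^2\,d\lambda_\alpha .$$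 The inequality is in $[0,\infty]$, with $0\cdot\infty=0$; $\Delta\rho$ is the (weak, a.e. defined) Laplacian. -/

import Mathlib

open MeasureTheory Set Filter
open scoped Manifold ContDiff Topology ENNReal InnerProductSpace Bundle

noncomputable section

namespace WeightedManifold

/-- The Euclidean space in which the charts of an `(n + 1)`-dimensional manifold take values. -/
abbrev Coord (n : ℕ) : Type := EuclideanSpace ℝ (Fin (n + 1))

section Definitions

variable {n : ℕ} {M : Type*} [TopologicalSpace M] [ChartedSpace (EuclideanHalfSpace (n + 1)) M]

/-- The tangent vector at the point with coordinates `y` in the chart around `x₀` whose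
components in that chart are `v`. -/
def chartVector (x₀ : M) (y v : Coord n) :
    TangentSpace (𝓡∂ (n + 1)) ((extChartAt (𝓡∂ (n + 1)) x₀).symm y) :=
  mfderivWithin 𝓘(ℝ, Coord n) (𝓡∂ (n + 1)) (extChartAt (𝓡∂ (n + 1)) x₀).symm
    (range (𝓡∂ (n + 1))) y v

/-- The point `(0, z)` of the boundary hyperplane of the half space. -/
def hyperplanePoint (z : EuclideanSpace ℝ (Fin n)) : Coord n :=
  WithLp.toLp 2 (Fin.cons 0 (fun i => z i))

/-- A vector field is Lipschitz (the manifold being compact) when its components in charts are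
locally Lipschitz, up to the boundary. -/
def IsLipschitzField (X : ∀ x : M, TangentSpace (𝓡∂ (n + 1)) x) : Prop :=
  ∀ x₀ : M, LocallyLipschitzOn (extChartAt (𝓡∂ (n + 1)) x₀).target
    (fun y : Coord n =>
      (mfderiv (𝓡∂ (n + 1)) 𝓘(ℝ, Coord n) (extChartAt (𝓡∂ (n + 1)) x₀)
        ((extChartAt (𝓡∂ (n + 1)) x₀).symm y)
        (X ((extChartAt (𝓡∂ (n + 1)) x₀).symm y)) : Coord n))

variable [Bundle.RiemannianBundle (fun x : M => TangentSpace (𝓡∂ (n + 1)) x)]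

instance instCompleteTangent (x : M) : CompleteSpace (TangentSpace (𝓡∂ (n + 1)) x) :=
  haveI : FiniteDimensional ℝ (TangentSpace (𝓡∂ (n + 1)) x) :=
    inferInstanceAs (FiniteDimensional ℝ (Coord n))
  FiniteDimensional.complete ℝ _

/-- The Riemannian gradient. -/
def grad (f : M → ℝ) (x : M) : TangentSpace (𝓡∂ (n + 1)) x :=
  (InnerProductSpace.toDual ℝ (TangentSpace (𝓡∂ (n + 1)) x)).symm
    (mfderiv (𝓡∂ (n + 1)) 𝓘(ℝ, ℝ) f x)

/-- The outward unit normal at a boundary point `x`: the zeroth coordinate of a chart at `x`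
vanishes on the boundary and is positive in the interior, so the normal is minus its normalized
gradient. -/
def outwardNormal (n : ℕ) {M : Type*} [TopologicalSpace M]
    [ChartedSpace (EuclideanHalfSpace (n + 1)) M]
    [Bundle.RiemannianBundle (fun x : M => TangentSpace (𝓡∂ (n + 1)) x)] (x : M) : TangentSpace (𝓡∂ (n + 1)) x :=
  -(‖grad (n := n) (fun y : M => (extChartAt (𝓡∂ (n + 1)) x y : Coord n) 0) x‖⁻¹ •
    grad (n := n) (fun y : M => (extChartAt (𝓡∂ (n + 1)) x y : Coord n) 0) x)

/-- The derivative of `f` in the direction of the outward unit normal. -/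
def normalDeriv (n : ℕ) {M : Type*} [TopologicalSpace M]
    [ChartedSpace (EuclideanHalfSpace (n + 1)) M]
    [Bundle.RiemannianBundle (fun x : M => TangentSpace (𝓡∂ (n + 1)) x)] (f : M → ℝ) (x : M) : ℝ :=
  ⟪grad (n := n) f x, outwardNormal n x⟫_ℝ

/-- The Riemannian volume density `√det (g_ij)` in the chart around `x₀`. -/
def volumeDensity (x₀ : M) (y : Coord n) : ℝ :=
  √(Matrix.of fun i j : Fin (n + 1) =>
    ⟪chartVector x₀ y (EuclideanSpace.single i 1),
      chartVector x₀ y (EuclideanSpace.single j 1)⟫_ℝ).det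

/-- The density of the surface measure of the boundary in the chart around `x₀`: the volume
density of the metric induced on the boundary. -/
def surfaceDensity (x₀ : M) (z : EuclideanSpace ℝ (Fin n)) : ℝ :=
  √(Matrix.of fun i j : Fin n =>
    ⟪chartVector x₀ (hyperplanePoint z) (EuclideanSpace.single i.succ 1),
      chartVector x₀ (hyperplanePoint z) (EuclideanSpace.single j.succ 1)⟫_ℝ).det

variable [MeasurableSpace M]

/-- The Riemannian volume measure on the domain of the chart around `x₀`. -/
def chartVolume (x₀ : M) : Measure M :=
  ((volume.restrict (extChartAt (𝓡∂ (n + 1)) x₀).target).withDensity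
    (fun y => ENNReal.ofReal (volumeDensity x₀ y))).map (extChartAt (𝓡∂ (n + 1)) x₀).symm

/-- The surface measure of the boundary on the domain of the chart around `x₀`. -/
def chartSurface (x₀ : M) : Measure M :=
  ((volume.restrict (hyperplanePoint ⁻¹' (extChartAt (𝓡∂ (n + 1)) x₀).target)).withDensity
    (fun z => ENNReal.ofReal (surfaceDensity x₀ z))).map
      (fun z => (extChartAt (𝓡∂ (n + 1)) x₀).symm (hyperplanePoint z))

/-- The Riemannian volume measure. The measures `chartVolume x₀` agree on overlaps of charts, so
their supremum is the measure that restricts to each of them. -/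
def riemVolume (n : ℕ) (M : Type*) [TopologicalSpace M]
    [ChartedSpace (EuclideanHalfSpace (n + 1)) M]
    [Bundle.RiemannianBundle (fun x : M => TangentSpace (𝓡∂ (n + 1)) x)]
    [MeasurableSpace M] : Measure M :=
  ⨆ x₀ : M, chartVolume (n := n) x₀

/-- The Riemannian surface measure of the boundary (its `n`-dimensional Hausdorff measure, with
the normalization that gives Lebesgue measure in the flat case), as a measure on `M`. -/
def riemSurface (n : ℕ) (M : Type*) [TopologicalSpace M]
    [ChartedSpace (EuclideanHalfSpace (n + 1)) M]
    [Bundle.RiemannianBundle (fun x : M => TangentSpace (𝓡∂ (n + 1)) x)]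
    [MeasurableSpace M] : Measure M :=
  ⨆ x₀ : M, chartSurface (n := n) x₀

/-- `L` is a weak Laplacian of `f` on the interior: it is locally integrable there and
`∫ ⟨∇f, ∇φ⟩ = - ∫ L φ` for all smooth `φ` that are compactly supported in the interior
(`M` being compact). -/
def IsWeakLaplacian (f L : M → ℝ) : Prop :=
  LocallyIntegrableOn L ((𝓡∂ (n + 1)).interior M) (riemVolume n M) ∧
  ∀ φ : M → ℝ, ContMDiff (𝓡∂ (n + 1)) 𝓘(ℝ, ℝ) ∞ φ →
    tsupport φ ⊆ (𝓡∂ (n + 1)).interior M →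
    ∫ x, ⟪grad (n := n) f x, grad φ x⟫_ℝ ∂(riemVolume n M)
      = -∫ x, L x * φ x ∂(riemVolume n M)

open Classical in
/-- The Laplacian of a function with Lipschitz gradient, which exists weakly and is unique almost
everywhere (it is `0` by convention for functions without a weak Laplacian). -/
def laplacian (n : ℕ) {M : Type*} [TopologicalSpace M]
    [ChartedSpace (EuclideanHalfSpace (n + 1)) M]
    [Bundle.RiemannianBundle (fun x : M => TangentSpace (𝓡∂ (n + 1)) x)]
    [MeasurableSpace M] (f : M → ℝ) : M → ℝ :=
  if h : ∃ L, IsWeakLaplacian (n := n) f L then h.choose else 0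


/-- `G` is a weak gradient of `f` on the interior: in every chart the weak derivative of `f` in
the direction `v` is the locally integrable function `⟨G, v⟩`. -/
def IsWeakGradient (f : M → ℝ) (G : ∀ x : M, TangentSpace (𝓡∂ (n + 1)) x) : Prop :=
  ∀ (x₀ : M) (v : Coord n),
    LocallyIntegrableOn
      (fun y : Coord n =>
        ⟪G ((extChartAt (𝓡∂ (n + 1)) x₀).symm y), chartVector x₀ y v⟫_ℝ)
      (interior (extChartAt (𝓡∂ (n + 1)) x₀).target) ∧
    ∀ ψ : Coord n → ℝ, ContDiff ℝ ∞ ψ → HasCompactSupport ψ →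
      tsupport ψ ⊆ interior (extChartAt (𝓡∂ (n + 1)) x₀).target →
      ∫ y, f ((extChartAt (𝓡∂ (n + 1)) x₀).symm y) * fderiv ℝ ψ y v
        = -∫ y, ⟪G ((extChartAt (𝓡∂ (n + 1)) x₀).symm y), chartVector x₀ y v⟫_ℝ * ψ y

/-- `f` is weakly differentiable on the interior, with locally integrable gradient. -/
def WeaklyDifferentiable (n : ℕ) {M : Type*} [TopologicalSpace M]
    [ChartedSpace (EuclideanHalfSpace (n + 1)) M]
    [Bundle.RiemannianBundle (fun x : M => TangentSpace (𝓡∂ (n + 1)) x)] (f : M → ℝ) : Prop :=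
  ∃ G : ∀ x : M, TangentSpace (𝓡∂ (n + 1)) x, IsWeakGradient f G

open Classical in
/-- The weak gradient of a weakly differentiable function; it is unique almost everywhere. -/
def weakGrad (f : M → ℝ) (x : M) : TangentSpace (𝓡∂ (n + 1)) x :=
  if h : WeaklyDifferentiable n f then h.choose x else 0

/-- `A = ∫_Ω α dλ`. -/
def massVol (n : ℕ) {M : Type*} [TopologicalSpace M]
    [ChartedSpace (EuclideanHalfSpace (n + 1)) M]
    [Bundle.RiemannianBundle (fun x : M => TangentSpace (𝓡∂ (n + 1)) x)]
    [MeasurableSpace M] (α : M → ℝ) : ℝ≥0∞ :=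
  ∫⁻ x, ENNReal.ofReal (α x) ∂(riemVolume n M)

/-- `B = ∫_∂Ω β dσ`. -/
def massSurf (n : ℕ) {M : Type*} [TopologicalSpace M]
    [ChartedSpace (EuclideanHalfSpace (n + 1)) M]
    [Bundle.RiemannianBundle (fun x : M => TangentSpace (𝓡∂ (n + 1)) x)]
    [MeasurableSpace M] (β : M → ℝ) : ℝ≥0∞ :=
  ∫⁻ x, ENNReal.ofReal (β x) ∂(riemSurface n M)

/-- The probability measure `dλ_α = (α / A) dλ`. -/
def volAlpha (n : ℕ) {M : Type*} [TopologicalSpace M]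
    [ChartedSpace (EuclideanHalfSpace (n + 1)) M]
    [Bundle.RiemannianBundle (fun x : M => TangentSpace (𝓡∂ (n + 1)) x)]
    [MeasurableSpace M] (α : M → ℝ) : Measure M :=
  (riemVolume n M).withDensity (fun x => ENNReal.ofReal (α x) / massVol n α)

/-- The probability measure `dσ_β = (β / B) dσ` on the boundary. -/
def surfBeta (n : ℕ) {M : Type*} [TopologicalSpace M]
    [ChartedSpace (EuclideanHalfSpace (n + 1)) M]
    [Bundle.RiemannianBundle (fun x : M => TangentSpace (𝓡∂ (n + 1)) x)]
    [MeasurableSpace M] (β : M → ℝ) : Measure M :=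
  (riemSurface n M).withDensity (fun x => ENNReal.ofReal (β x) / massSurf n β)

/-- The measure `(β / B) dλ`; `B` is the mass of `β` on the boundary. -/
def volBeta (n : ℕ) {M : Type*} [TopologicalSpace M]
    [ChartedSpace (EuclideanHalfSpace (n + 1)) M]
    [Bundle.RiemannianBundle (fun x : M => TangentSpace (𝓡∂ (n + 1)) x)]
    [MeasurableSpace M] (β : M → ℝ) : Measure M :=
  (riemVolume n M).withDensity (fun x => ENNReal.ofReal (β x) / massSurf n β)

/-- `f` belongs to `H^{1,q}(M, ν)`, with gradient `F`: the completion of the `C¹` functions, that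
is, `f` and `F` are limits in `L^q(ν)` of `C¹` functions `u k` and of their gradients. -/
def MemSobolev (q : ℝ) (ν : Measure M) (f : M → ℝ)
    (F : ∀ x : M, TangentSpace (𝓡∂ (n + 1)) x) : Prop :=
  MemLp f (ENNReal.ofReal q) ν ∧
  ∃ u : ℕ → M → ℝ,
    (∀ k, ContMDiff (𝓡∂ (n + 1)) 𝓘(ℝ, ℝ) 1 (u k)) ∧
    (∀ k, AEMeasurable (fun x => ‖grad (u k) x - F x‖) ν) ∧
    Tendsto (fun k => ∫⁻ x, ‖u k x - f x‖ₑ ^ q ∂ν) atTop (𝓝 0) ∧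
    Tendsto (fun k => ∫⁻ x, ‖grad (u k) x - F x‖ₑ ^ q ∂ν) atTop (𝓝 0)

/-- The optimal constant `C` in the weighted Sobolev-Poincaré inequality
`(∫ |f - f̄|^p (β / B) dλ)^{1/p} ≤ C (∫ |∇f|^q dλ_α)^{1/q}` for `f ∈ H^{1,q}(M, λ_α)`, where
`f̄ = ∫ f dλ_α` (it is `∞` if there is no finite one). -/
def sobolevPoincareConst (n : ℕ) {M : Type*} [TopologicalSpace M]
    [ChartedSpace (EuclideanHalfSpace (n + 1)) M]
    [Bundle.RiemannianBundle (fun x : M => TangentSpace (𝓡∂ (n + 1)) x)]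
    [MeasurableSpace M] (β α : M → ℝ) (p q : ℝ) : ℝ≥0∞ :=
  sInf {C : ℝ≥0∞ | ∀ (f : M → ℝ) (F : ∀ x : M, TangentSpace (𝓡∂ (n + 1)) x),
    MemSobolev q (volAlpha n α) f F →
    (∫⁻ x, ‖f x - ∫ y, f y ∂(volAlpha n α)‖ₑ ^ p ∂(volBeta n β)) ^ (1 / p)
      ≤ C * (∫⁻ x, ‖F x‖ₑ ^ q ∂(volAlpha n α)) ^ (1 / q)}

end Definitions

end WeightedManifold

end

open WeightedManifold

/-! The engine is the divergence theorem for the field β|f|^p∇ρ. Because ∂ρ/∂N = -1, its flux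
through the boundary is -∫_∂Ω β|f|^p dσ, so this boundary integral equals minus the integral over Ω
of β⟨∇ρ,∇|f|^p⟩ + |f|^p(βΔρ + ⟨∇ρ,∇β⟩). With D the essential supremum of the negative part of Δρ +
⟨∇ρ,∇β/β⟩, the second summand is at least -Dβ|f|^p, and |∇|f|^p| ≤ p|f|^(p-1)|∇f| controls the first
one. This is `integral_trace_le`, put in normalized form in `lintegral_surfBeta_le`.

The rest of the estimate is short. Cauchy–Schwarz with respect to β dλ/B separates |f|^(p-1) from
|∇f| (`lintegral_mul_rpow_le`). The factor with |∇f| is moved to λ_α at the cost of |β/α|_∞ A/B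
(`lintegral_volBeta_le`), and the norms of f of exponents 2(p-1) and p are bounded by the
Sobolev–Poincaré constants (`sobolevPoincare_le`). Both terms are then homogeneous of degree p/2 in
the energy E = ∫|∇f|² dλ_α, and the power 2/p ≤ 1 is subadditive (`rpow_two_div_le_mul`).

The main labour is the divergence theorem at this regularity: β is only continuous with a weak
gradient and ∇ρ is only Lipschitz. A partition of unity reduces it to one chart, where W =
√det(g)·∇ρ is a locally Lipschitz field. Mollification allows the weak gradient of β to be tested
against the Lipschitz functions ζW_k (`integral_mul_lineDeriv_eq_of_weakDeriv`). The test function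
is cut off near the hyperplane y₀ = 0; the derivatives of the cutoffs form an approximate identity
concentrating there (`tendsto_integral_mul_deriv_cutoff`). The limiting boundary weight is W₀, which
is exactly the surface density because ∂ρ/∂N = -1 (`coordField_mul_volumeDensity`).

Two definitions need unfolding before this applies. The measures are suprema of chart measures,
which restrict to the chart measures by change of variables and gluing
(`riemVolume_restrict_source`, `riemSurface_restrict_source`). The Laplacian is a chosen weak
Laplacian, which must be shown to exist and to be (div W)/√det(g) in charts
(`exists_isWeakLaplacian`, `ae_laplacian`). -/

noncomputable section

namespace WeightedManifold

set_option linter.unusedSectionVars false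

/-! ### Gram determinants -/

section LinearAlgebra

variable {V : Type*} [NormedAddCommGroup V] [InnerProductSpace ℝ V]

/-- A vector dual to `e 0` in the span of `e` has squared length the quotient of the Gram
determinants of `e ∘ succ` and of `e`. -/
theorem inner_self_mul_det_gram {n : ℕ} (e : Fin (n + 1) → V) (a : Fin (n + 1) → ℝ)
    (h0 : ⟪∑ k, a k • e k, e 0⟫_ℝ = 1) (hk : ∀ k : Fin n, ⟪∑ k, a k • e k, e k.succ⟫_ℝ = 0) :
    ⟪∑ k, a k • e k, ∑ k, a k • e k⟫_ℝ * (Matrix.gram ℝ e).det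
      = (Matrix.gram ℝ (fun k : Fin n => e k.succ)).det := by
  set G := Matrix.gram ℝ e with hG
  have hGa : G.mulVec a = Pi.single 0 1 := by
    funext i
    have : G.mulVec a i = ⟪∑ k, a k • e k, e i⟫_ℝ := by
      simp [Matrix.mulVec, dotProduct, hG, Matrix.gram_apply, sum_inner, inner_smul_left,
        real_inner_comm, mul_comm]
    rw [this]
    refine Fin.cases ?_ (fun k => ?_) i
    · simpa using h0
    · simpa using hk k
  have haa : ⟪∑ k, a k • e k, ∑ k, a k • e k⟫_ℝ = a 0 := by
    conv_lhs => rw [inner_sum]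
    simp only [inner_smul_right]
    rw [Fin.sum_univ_succ, h0]
    simp [hk]
  -- Cramer's rule for G a = e₀: the zeroth entry gives a 0 · det G as the (0,0) cofactor, and a 0
  -- is the squared length by `haa`.
  have h1 : G.adjugate.mulVec (G.mulVec a) = G.det • a := by
    rw [Matrix.mulVec_mulVec, Matrix.adjugate_mul, Matrix.smul_mulVec, Matrix.one_mulVec]
  have h2 := congrFun h1 0
  rw [hGa] at h2
  simp only [Matrix.mulVec_single_one, Matrix.col_apply, Pi.smul_apply, smul_eq_mul] at h2
  rw [Matrix.adjugate_fin_succ_eq_det_submatrix] at h2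
  rw [haa, mul_comm, ← h2]
  simp only [Fin.val_zero, add_zero, pow_zero, one_mul]
  congr 1

/-- The Gram matrix of v is Jᵀ G J, so its determinant picks up (det J)². This is the transformation
law of both Riemannian densities under changes of charts. -/
theorem sqrt_det_gram_comp {ι : Type*} [Fintype ι] [DecidableEq ι] (e v : ι → V)
    (J : Matrix ι ι ℝ) (h : ∀ i, v i = ∑ k, J k i • e k) :
    √(Matrix.gram ℝ v).det = |J.det| * √(Matrix.gram ℝ e).det := by
  have : Matrix.gram ℝ v = J.transpose * Matrix.gram ℝ e * J := by
    ext i j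
    simp only [Matrix.gram_apply, h, Matrix.mul_apply, Matrix.transpose_apply, sum_inner,
      inner_sum, inner_smul_left, inner_smul_right, Finset.sum_mul]
    refine Finset.sum_congr rfl fun k _ => ?_
    rw [Finset.mul_sum]
    refine Finset.sum_congr rfl fun l _ => ?_
    simp only [conj_trivial]; ring
  rw [this, Matrix.det_mul, Matrix.det_mul, Matrix.det_transpose,
    show J.det * (Matrix.gram ℝ e).det * J.det = J.det ^ 2 * (Matrix.gram ℝ e).det by ring,
    Real.sqrt_mul (sq_nonneg _), Real.sqrt_sq_eq_abs]

end LinearAlgebra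

/-! ### Lipschitz functions, mollification and weak derivatives -/

section Lipschitz

variable {E : Type*} [NormedAddCommGroup E] [NormedSpace ℝ E] [FiniteDimensional ℝ E]

/-- Compactness gives a Lipschitz constant C on the closed 1-neighbourhood of the support. A point
of the support and a point outside that neighbourhood are at distance at least 1, so there the sup
bound B serves as a Lipschitz constant. -/
theorem LocallyLipschitz.exists_lipschitzWith_of_hasCompactSupport {f : E → ℝ}
    (hf : LocallyLipschitz f) (hc : HasCompactSupport f) : ∃ C, LipschitzWith C f := by
  have : ProperSpace E := FiniteDimensional.proper_real E
  have hK : IsCompact (Metric.cthickening 1 (tsupport f)) := hc.isCompact.cthickening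
  obtain ⟨C, hC⟩ := LocallyLipschitzOn.exists_lipschitzOnWith_of_compact (f := f) hK
    hf.locallyLipschitzOn
  obtain ⟨B, hB⟩ := hc.exists_bound_of_continuous hf.continuous
  have hB0 : 0 ≤ B := (norm_nonneg _).trans (hB 0)
  have key : ∀ x y, f x ≠ 0 → dist (f x) (f y) ≤ (C + B) * dist x y := by
    intro x y hx
    have hxs : x ∈ tsupport f := subset_tsupport f hx
    have hxK : x ∈ Metric.cthickening 1 (tsupport f) := Metric.self_subset_cthickening _ hxs
    by_cases hy : y ∈ Metric.cthickening 1 (tsupport f)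
    · exact (hC.dist_le_mul x hxK y hy).trans
        (mul_le_mul_of_nonneg_right (by linarith) dist_nonneg)
    · have hy0 : f y = 0 := by
        by_contra h
        exact hy (Metric.self_subset_cthickening _ (subset_tsupport f h))
      have h1 : 1 ≤ dist x y := by
        by_contra h
        exact hy (Metric.mem_cthickening_of_dist_le y x 1 _ hxs (by rw [dist_comm]; linarith))
      rw [hy0, dist_zero_right]
      nlinarith [hB x, C.2, NNReal.coe_nonneg C]
  refine ⟨C + ⟨B, hB0⟩, LipschitzWith.of_dist_le_mul fun x y => ?_⟩
  by_cases hx : f x = 0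
  · by_cases hy : f y = 0
    · rw [hx, hy, dist_self]; positivity
    · rw [dist_comm, dist_comm x y]; exact key y x hy
  · exact key x y hx

omit [NormedSpace ℝ E] [FiniteDimensional ℝ E] in
theorem LocallyLipschitzOn.mul_real {f g : E → ℝ} {s : Set E} (hf : LocallyLipschitzOn s f)
    (hg : LocallyLipschitzOn s g) : LocallyLipschitzOn s (fun x => f x * g x) := by
  intro x hx
  obtain ⟨C, t, ht, hC⟩ := hf hx
  obtain ⟨D, t', ht', hD⟩ := hg hx
  obtain ⟨K, r, hr, hK⟩ := (contDiff_mul (n := 1) (𝕜 := ℝ) (𝔸 := ℝ)).locallyLipschitz (f x, g x)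
  have hpre : (fun y => (f y, g y)) ⁻¹' r ∈ 𝓝[s] x :=
    ((hf.continuousOn x hx).prodMk (hg.continuousOn x hx)) hr
  exact ⟨K * max C D, t ∩ t' ∩ (fun y => (f y, g y)) ⁻¹' r,
    inter_mem (inter_mem ht ht') hpre,
    hK.comp ((hC.mono fun y hy => hy.1.1).prodMk (hD.mono fun y hy => hy.1.2)) fun y hy => hy.2⟩

/-- A function that is locally Lipschitz on an open set containing its compact support is
Lipschitz. -/
theorem LocallyLipschitzOn.exists_lipschitzWith {f : E → ℝ} {U : Set E} (hU : IsOpen U)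
    (hf : LocallyLipschitzOn U f) (hc : HasCompactSupport f) (hs : tsupport f ⊆ U) :
    ∃ C, LipschitzWith C f := by
  refine LocallyLipschitz.exists_lipschitzWith_of_hasCompactSupport (fun x => ?_) hc
  by_cases hx : x ∈ U
  · obtain ⟨C, t, ht, h⟩ := hf hx
    exact ⟨C, t, by rwa [hU.nhdsWithin_eq hx] at ht, h⟩
  · refine ⟨0, (tsupport f)ᶜ, (isClosed_tsupport f).isOpen_compl.mem_nhds (fun h => hx (hs h)), ?_⟩
    intro y hy z hz
    simp [image_eq_zero_of_notMem_tsupport hy, image_eq_zero_of_notMem_tsupport hz]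

variable [MeasurableSpace E] [BorelSpace E]

/-- Rademacher's theorem near each point of U; second countability turns a locally null exceptional
set into a null one. -/
theorem LocallyLipschitzOn.ae_differentiableAt {F : Type*} [NormedAddCommGroup F] [NormedSpace ℝ F]
    [FiniteDimensional ℝ F] {f : E → F} {U : Set E} (μ : Measure E) [μ.IsAddHaarMeasure]
    (hU : IsOpen U) (hf : LocallyLipschitzOn U f) :
    ∀ᵐ x ∂μ, x ∈ U → DifferentiableAt ℝ f x := by
  rw [ae_iff]
  have : SecondCountableTopology E := by
    have := FiniteDimensional.proper_real E
    infer_instance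
  refine measure_null_of_locally_null _ fun x hx => ?_
  simp only [mem_ofPred_eq, Classical.not_imp] at hx
  obtain ⟨C, t, ht, hC⟩ := hf hx.1
  rw [hU.nhdsWithin_eq hx.1] at ht
  obtain ⟨r, hrt, hro, hxr⟩ := mem_nhds_iff.1 ht
  refine ⟨r ∩ {a | ¬(a ∈ U → DifferentiableAt ℝ f a)},
    inter_mem (mem_nhdsWithin_of_mem_nhds (hro.mem_nhds hxr)) self_mem_nhdsWithin, ?_⟩
  have := (hC.mono hrt).ae_differentiableWithinAt_of_mem (μ := μ)
  rw [ae_iff] at this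
  refine measure_mono_null (fun y hy => ?_) this
  simp only [mem_ofPred_eq, Classical.not_imp]
  refine ⟨hy.1, fun h => ?_⟩
  have h2 := hy.2
  simp only [mem_ofPred_eq, Classical.not_imp] at h2
  exact h2.2 (h.differentiableAt (hro.mem_nhds hy.1))

/-- The integral of a derivative of a compactly supported Lipschitz function vanishes. -/
theorem integral_lineDeriv_eq_zero {h : E → ℝ} {C : NNReal} (μ : Measure E) [μ.IsAddHaarMeasure]
    (hh : LipschitzWith C h) (hc : HasCompactSupport h) (v : E) :
    ∫ x, lineDeriv ℝ h x v ∂μ = 0 := by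
  -- Integration by parts against the constant 1; the direction -v is taken since the formula
  -- reverses it.
  have := (LipschitzWith.const (α := E) (1 : ℝ)).integral_lineDeriv_mul_eq (μ := μ) hh hc (-v)
  have h0 : ∀ x, lineDeriv ℝ (fun _ : E => (1 : ℝ)) x (-v) = 0 := fun x => by simp [lineDeriv]
  simpa [h0] using this.symm

/-- The mollification of a Lipschitz function is Lipschitz with the same constant. -/
theorem lipschitzWith_normed_convolution {h : E → ℝ} {C : NNReal} (μ : Measure E)
    [μ.IsAddHaarMeasure] (hh : LipschitzWith C h) (φ : ContDiffBump (0 : E)) :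
    LipschitzWith C (convolution (φ.normed μ) h (ContinuousLinearMap.lsmul ℝ ℝ) μ) := by
  have hint : ∀ x, Integrable (fun t => φ.normed μ t * h (x - t)) μ := fun x =>
    Continuous.integrable_of_hasCompactSupport
      (φ.continuous_normed.mul (hh.continuous.comp (continuous_const.sub continuous_id)))
      φ.hasCompactSupport_normed.mul_right
  refine LipschitzWith.of_dist_le_mul fun x y => ?_
  simp only [convolution_lsmul, smul_eq_mul, dist_eq_norm]
  rw [← integral_sub (hint x) (hint y)]
  calc ‖∫ t, (φ.normed μ t * h (x - t) - φ.normed μ t * h (y - t)) ∂μ‖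
      ≤ ∫ t, φ.normed μ t * (C * ‖x - y‖) ∂μ := by
        refine norm_integral_le_of_norm_le (φ.integrable_normed.mul_const _)
          (Eventually.of_forall fun t => ?_)
        rw [← mul_sub, norm_mul, Real.norm_of_nonneg (φ.nonneg_normed t)]
        refine mul_le_mul_of_nonneg_left ?_ (φ.nonneg_normed t)
        have := hh.dist_le_mul (x - t) (y - t)
        simpa [dist_eq_norm] using this
    _ = C * ‖x - y‖ := by rw [integral_mul_const, φ.integral_normed, one_mul]

/-- Difference quotients of the mollified function are difference quotients of h integrated against
the kernel. For Lipschitz h the latter converge to the integral of the line derivative, so the two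
limits coincide. -/
theorem fderiv_normed_convolution_apply {h : E → ℝ} {C : NNReal} (μ : Measure E)
    [μ.IsAddHaarMeasure] (hh : LipschitzWith C h)
    (φ : ContDiffBump (0 : E)) (y v : E) :
    fderiv ℝ (convolution (φ.normed μ) h (ContinuousLinearMap.lsmul ℝ ℝ) μ) y v
      = convolution (φ.normed μ) (fun x => lineDeriv ℝ h x v)
          (ContinuousLinearMap.lsmul ℝ ℝ) μ y := by
  set H := convolution (φ.normed μ) h (ContinuousLinearMap.lsmul ℝ ℝ) μ with hH
  have hsm : ContDiff ℝ 1 H :=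
    φ.hasCompactSupport_normed.contDiff_convolution_left _ φ.contDiff_normed
      hh.continuous.locallyIntegrable
  have hint : ∀ x, Integrable (fun t => φ.normed μ t * h (x - t)) μ := fun x =>
    Continuous.integrable_of_hasCompactSupport
      (φ.continuous_normed.mul (hh.continuous.comp (continuous_const.sub continuous_id)))
      φ.hasCompactSupport_normed.mul_right
  have hg : Integrable (fun x => φ.normed μ (y - x)) μ :=
    φ.integrable_normed.comp_sub_left y
  have h1 := hh.integral_inv_smul_sub_mul_tendsto_integral_lineDeriv_mul hg v
  have h2 := ((hsm.differentiable one_ne_zero y).hasFDerivAt.hasLineDerivAt v).tendsto_slope_zero_right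
  have h3 : ∀ t : ℝ, ∫ x, (t⁻¹ • (h (x + t • v) - h x)) * φ.normed μ (y - x) ∂μ
      = t⁻¹ • (H (y + t • v) - H y) := by
    intro t
    rw [hH]
    simp only [convolution_lsmul, smul_eq_mul]
    rw [← integral_sub (hint _) (hint _), ← integral_const_mul,
      ← integral_sub_left_eq_self _ μ y]
    refine integral_congr_ae (Eventually.of_forall fun x => ?_)
    simp only [sub_sub_cancel]
    rw [show y - x + t • v = y + t • v - x by abel]
    ring
  simp only [h3] at h1
  rw [tendsto_nhds_unique h2 h1, convolution_lsmul_swap]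
  simp [mul_comm]

/-- A weak derivative of a continuous function may be tested against Lipschitz functions. -/
theorem integral_mul_lineDeriv_eq_of_weakDeriv {U : Set E} (hU : IsOpen U) {b w : E → ℝ}
    (μ : Measure E) [μ.IsAddHaarMeasure] (hb : ContinuousOn b U)
    (hw : LocallyIntegrableOn w U μ) (v : E)
    (hbw : ∀ ψ : E → ℝ, ContDiff ℝ ∞ ψ → HasCompactSupport ψ → tsupport ψ ⊆ U →
      ∫ y, b y * fderiv ℝ ψ y v ∂μ = -∫ y, w y * ψ y ∂μ)
    {h : E → ℝ} {C : NNReal} (hh : LipschitzWith C h) (hc : HasCompactSupport h)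
    (hs : tsupport h ⊆ U) :
    ∫ y, b y * lineDeriv ℝ h y v ∂μ = -∫ y, w y * h y ∂μ := by
  have : ProperSpace E := FiniteDimensional.proper_real E
  obtain ⟨δ, hδ, hδU⟩ := hc.isCompact.exists_cthickening_subset_open hU hs
  set K := Metric.cthickening δ (tsupport h) with hKdef
  have hK : IsCompact K := hc.isCompact.cthickening
  -- The outer radius δ/(k+1) keeps all mollified supports in K. The inner radius is half of it,
  -- since almost everywhere convergence for a locally integrable function needs a bounded ratio of
  -- radii.
  let φ : ℕ → ContDiffBump (0 : E) := fun k =>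
    ⟨δ / (2 * (k + 1)), δ / (k + 1), by positivity, by
      apply div_lt_div_of_pos_left hδ (by positivity)
      have : (0 : ℝ) < k + 1 := by positivity
      linarith⟩
  have hφ : Tendsto (fun k => (φ k).rOut) atTop (𝓝 0) := by
    change Tendsto (fun k : ℕ => δ / ((k : ℝ) + 1)) atTop (𝓝 0)
    exact tendsto_const_nhds.div_atTop (tendsto_natCast_atTop_atTop.atTop_add tendsto_const_nhds)
  have hφ2 : ∀ᶠ k in atTop, (φ k).rOut ≤ 2 * (φ k).rIn := by
    refine Eventually.of_forall fun k => ?_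
    change δ / ((k : ℝ) + 1) ≤ 2 * (δ / (2 * (k + 1)))
    have : (k : ℝ) + 1 ≠ 0 := by positivity
    field_simp; rfl
  set H : ℕ → E → ℝ := fun k =>
    convolution ((φ k).normed μ) h (ContinuousLinearMap.lsmul ℝ ℝ) μ with hH
  have hHsm : ∀ k, ContDiff ℝ ∞ (H k) := fun k =>
    (φ k).hasCompactSupport_normed.contDiff_convolution_left _ (φ k).contDiff_normed
      hh.continuous.locallyIntegrable
  have hHlip : ∀ k, LipschitzWith C (H k) := fun k =>
    lipschitzWith_normed_convolution μ hh (φ k)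
  have hHsupp : ∀ k, tsupport (H k) ⊆ K := by
    intro k
    refine closure_minimal ?_ hK.isClosed
    refine (support_convolution_subset _).trans ?_
    rw [(φ k).support_normed_eq]
    rintro x ⟨a, ha, c, hc', rfl⟩
    refine Metric.mem_cthickening_of_dist_le _ c δ _ (subset_tsupport _ hc') ?_
    have h1 : ‖a‖ < δ / (k + 1) := by simpa using ha
    have h2 : δ / ((k : ℝ) + 1) ≤ δ := div_le_self hδ.le (by linarith [k.cast_nonneg (α := ℝ)])
    simpa [dist_eq_norm] using (h1.le.trans h2)
  have hHc : ∀ k, HasCompactSupport (H k) := fun k =>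
    HasCompactSupport.of_support_subset_isCompact hK ((subset_tsupport _).trans (hHsupp k))
  have hH0 : ∀ k, ∀ y ∉ K, H k y = 0 := fun k y hy =>
    image_eq_zero_of_notMem_tsupport fun h => hy (hHsupp k h)
  have hHf0 : ∀ k, ∀ y ∉ K, fderiv ℝ (H k) y = 0 := fun k y hy =>
    image_eq_zero_of_notMem_tsupport fun h => hy (hHsupp k (tsupport_fderiv_subset ℝ h))
  have hhK : ∀ y ∉ K, y ∉ tsupport h := fun y hy h =>
    hy (Metric.self_subset_cthickening _ h)
  have hhl0 : ∀ y ∉ K, lineDeriv ℝ h y v = 0 := by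
    intro y hy
    have h1 : h =ᶠ[𝓝 y] fun _ => (0 : ℝ) := notMem_tsupport_iff_eventuallyEq.1 (hhK y hy)
    rw [h1.lineDeriv_eq]
    simp [lineDeriv]
  obtain ⟨B, hB⟩ := hc.exists_bound_of_continuous hh.continuous
  have hHB : ∀ k y, ‖H k y‖ ≤ B := by
    intro k y
    have hint : Integrable (fun t => (φ k).normed μ t * B) μ := (φ k).integrable_normed.mul_const _
    simp only [hH, convolution_lsmul, smul_eq_mul]
    refine (norm_integral_le_of_norm_le hint (Eventually.of_forall fun t => ?_)).trans ?_
    · rw [norm_mul, Real.norm_of_nonneg ((φ k).nonneg_normed t)]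
      exact mul_le_mul_of_nonneg_left (hB _) ((φ k).nonneg_normed t)
    · rw [integral_mul_const, (φ k).integral_normed, one_mul]
  have hbK : IntegrableOn b K μ := (hb.mono hδU).integrableOn_compact hK
  have hwK : IntegrableOn w K μ := hw.integrableOn_compact_subset hδU hK
  have lim1 : Tendsto (fun k => ∫ y in K, b y * fderiv ℝ (H k) y v ∂μ) atTop
      (𝓝 (∫ y in K, b y * lineDeriv ℝ h y v ∂μ)) := by
    refine tendsto_integral_of_dominated_convergence (fun y => ‖b y‖ * (C * ‖v‖)) ?_
      (hbK.norm.mul_const _) ?_ ?_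
    · intro k
      refine hbK.aestronglyMeasurable.mul ?_
      exact (((hHsm k).continuous_fderiv (by simp)).clm_apply continuous_const).aestronglyMeasurable
    · refine fun k => Eventually.of_forall fun y => ?_
      rw [norm_mul]
      refine mul_le_mul_of_nonneg_left ?_ (norm_nonneg _)
      exact (ContinuousLinearMap.le_opNorm _ _).trans
        (mul_le_mul_of_nonneg_right (norm_fderiv_le_of_lipschitz ℝ (hHlip k)) (norm_nonneg _))
    -- The gradients of the mollifications converge only almost everywhere; the common Lipschitz
    -- constant supplies the dominating function.
    · refine ae_restrict_of_ae ?_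
      filter_upwards [ContDiffBump.ae_convolution_tendsto_right_of_locallyIntegrable hφ hφ2
        (hh.locallyIntegrable_lineDeriv (μ := μ) v)] with y hy
      refine Tendsto.const_mul _ (hy.congr fun k => ?_)
      exact (fderiv_normed_convolution_apply μ hh (φ k) y v).symm
  have lim2 : Tendsto (fun k => ∫ y in K, w y * H k y ∂μ) atTop (𝓝 (∫ y in K, w y * h y ∂μ)) := by
    refine tendsto_integral_of_dominated_convergence (fun y => ‖w y‖ * B) ?_
      (hwK.norm.mul_const _) ?_ ?_
    · exact fun k => hwK.aestronglyMeasurable.mul (hHsm k).continuous.aestronglyMeasurable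
    · refine fun k => Eventually.of_forall fun y => ?_
      rw [norm_mul]
      exact mul_le_mul_of_nonneg_left (hHB k y) (norm_nonneg _)
    · refine Eventually.of_forall fun y => Tendsto.const_mul _ ?_
      exact ContDiffBump.convolution_tendsto_right_of_continuous hφ hh.continuous y
  have e1 : ∀ k, ∫ y in K, b y * fderiv ℝ (H k) y v ∂μ = -∫ y in K, w y * H k y ∂μ := by
    intro k
    rw [setIntegral_eq_integral_of_forall_compl_eq_zero fun y hy => by simp [hHf0 k y hy],
      setIntegral_eq_integral_of_forall_compl_eq_zero fun y hy => by simp [hH0 k y hy]]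
    exact hbw _ (hHsm k) (hHc k) ((hHsupp k).trans hδU)
  have e2 := tendsto_nhds_unique lim1 ((lim2.neg).congr fun k => (e1 k).symm)
  rwa [setIntegral_eq_integral_of_forall_compl_eq_zero fun y hy => by simp [hhl0 y hy],
    setIntegral_eq_integral_of_forall_compl_eq_zero fun y hy => by
      simp [image_eq_zero_of_notMem_tsupport (hhK y hy)]] at e2

end Lipschitz

/-! ### Divergence identities in coordinates -/

section Divergence

variable {n : ℕ}

/-- The divergence of a vector field in coordinates, zero where some component is not
differentiable in the sense that its `fderiv` vanishes by convention. -/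
def coordDiv (W : Coord n → Coord n) (y : Coord n) : ℝ :=
  ∑ k, fderiv ℝ (fun y => W y k) y (EuclideanSpace.single k 1)

theorem measurable_coordDiv (W : Coord n → Coord n) : Measurable (coordDiv W) := by
  unfold coordDiv
  exact Finset.measurable_sum _ fun k _ => measurable_fderiv_apply_const ℝ _ _

theorem LocallyLipschitzOn.coord {W : Coord n → Coord n} {U : Set (Coord n)}
    (hW : LocallyLipschitzOn U W) (k : Fin (n + 1)) : LocallyLipschitzOn U fun y => W y k := by
  intro x hx
  obtain ⟨C, t, ht, h⟩ := hW hx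
  refine ⟨C, t, ht, LipschitzOnWith.of_dist_le_mul fun y hy z hz => ?_⟩
  refine le_trans ?_ (h.dist_le_mul y hy z hz)
  rw [dist_eq_norm, dist_eq_norm]
  exact PiLp.norm_apply_le (W y - W z) k

/-- Local Lipschitz constants bound the partial derivatives; the default value 0 at points of
non-differentiability obeys the same bound. -/
theorem coordDiv_locally_bounded {W : Coord n → Coord n} {U : Set (Coord n)} (hU : IsOpen U)
    (hW : LocallyLipschitzOn U W) {x : Coord n} (hx : x ∈ U) :
    ∃ B, ∀ᶠ y in 𝓝 x, ‖coordDiv W y‖ ≤ B := by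
  have : ∀ k : Fin (n + 1), ∃ C : NNReal, ∀ᶠ y in 𝓝 x, ‖fderiv ℝ (fun y => W y k) y‖ ≤ C := by
    intro k
    obtain ⟨C, t, ht, h⟩ := LocallyLipschitzOn.coord hW k hx
    rw [hU.nhdsWithin_eq hx] at ht
    exact ⟨C, (eventually_mem_nhds_iff.2 ht).mono fun y hy =>
      norm_fderiv_le_of_lipschitzOn ℝ hy h⟩
  choose C hC using this
  refine ⟨∑ k, (C k : ℝ), (eventually_all.2 hC).mono fun y hy => ?_⟩
  refine (norm_sum_le _ _).trans (Finset.sum_le_sum fun k _ => ?_)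
  refine (ContinuousLinearMap.le_opNorm _ _).trans ?_
  simpa using hy k

theorem locallyIntegrableOn_coordDiv {W : Coord n → Coord n} {U : Set (Coord n)} (hU : IsOpen U)
    (hW : LocallyLipschitzOn U W) : LocallyIntegrableOn (coordDiv W) U := by
  intro x hx
  obtain ⟨B, hB⟩ := coordDiv_locally_bounded hU hW hx
  refine IntegrableAtFilter.filter_mono nhdsWithin_le_nhds ?_
  exact Measure.FiniteAtFilter.integrableAtFilter (μ := volume)
    ((measurable_coordDiv W).aestronglyMeasurable.stronglyMeasurableAtFilter)
    (volume.finiteAt_nhds x) (isBoundedUnder_of_eventually_le hB)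

theorem fderiv_apply_eq_sum (ζ : Coord n → ℝ) (y v : Coord n) :
    fderiv ℝ ζ y v = ∑ k, v k * fderiv ℝ ζ y (EuclideanSpace.single k 1) := by
  conv_lhs => rw [← (EuclideanSpace.basisFun (Fin (n + 1)) ℝ).sum_repr v]
  simp [map_sum]

theorem contDiff_of_tsupport {E : Type*} [NormedAddCommGroup E] [NormedSpace ℝ E] {f : E → ℝ}
    {m : WithTop ℕ∞} (h : ∀ x ∈ tsupport f, ContDiffAt ℝ m f x) : ContDiff ℝ m f :=
  contMDiff_iff_contDiff.1 (contMDiff_of_tsupport fun x hx => (h x hx).contMDiffAt)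

theorem integrable_mul_of_tsupport_subset {E : Type*} [TopologicalSpace E] [T2Space E]
    [MeasurableSpace E] [OpensMeasurableSpace E] {μ : Measure E} {U : Set E} {g ζ : E → ℝ}
    (hg : LocallyIntegrableOn g U μ) (hζ : Continuous ζ) (hc : HasCompactSupport ζ)
    (hs : tsupport ζ ⊆ U) : Integrable (fun y => ζ y * g y) μ := by
  have hK : IntegrableOn g (tsupport ζ) μ := hg.integrableOn_compact_subset hs hc.isCompact
  have h1 : IntegrableOn (fun y => ζ y * g y) (tsupport ζ) μ :=
    IntegrableOn.continuousOn_mul hζ.continuousOn hK hc.isCompact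
  refine (integrableOn_iff_integrable_of_support_subset fun y hy => ?_).1 h1
  exact subset_tsupport _ (left_ne_zero_of_mul hy)

theorem locallyIntegrableOn_comp_coord {E : Type*} [NormedAddCommGroup E] [NormedSpace ℝ E]
    [FiniteDimensional ℝ E] [MeasurableSpace E] [BorelSpace E] {μ : Measure E}
    {U : Set E} {g h : E → ℝ} (hU : IsOpen U)
    (hg : LocallyIntegrableOn g U μ) (hh : ContinuousOn h U) :
    LocallyIntegrableOn (fun y => h y * g y) U μ := by
  have := FiniteDimensional.proper_real E
  rw [locallyIntegrableOn_iff hU.isLocallyClosed] at hg ⊢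
  exact fun K hKU hK => (hg K hKU hK).continuousOn_mul (hh.mono hKU) hK

/-- Testing the divergence of `b W` with a compactly supported `C¹` function, where `b` is
continuous and weakly differentiable and `W` is locally Lipschitz. -/
theorem integral_mul_fderiv_add_coordDiv {U : Set (Coord n)} (hU : IsOpen U)
    {W : Coord n → Coord n} (hW : LocallyLipschitzOn U W) {b : Coord n → ℝ}
    (hb : ContinuousOn b U) {w : Fin (n + 1) → Coord n → ℝ}
    (hw : ∀ k, LocallyIntegrableOn (w k) U)
    (hbw : ∀ k, ∀ ψ : Coord n → ℝ, ContDiff ℝ ∞ ψ → HasCompactSupport ψ → tsupport ψ ⊆ U →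
      ∫ y, b y * fderiv ℝ ψ y (EuclideanSpace.single k 1) = -∫ y, w k y * ψ y)
    {ζ : Coord n → ℝ} (hζ : ContDiff ℝ 1 ζ) (hc : HasCompactSupport ζ) (hs : tsupport ζ ⊆ U) :
    ∫ y, b y * (fderiv ℝ ζ y (W y) + ζ y * coordDiv W y)
      = -∫ y, ζ y * ∑ k, W y k * w k y := by
  -- The functions ζ W_k are Lipschitz with compact support in U, hence admissible tests for the
  -- k-th weak derivative of b; the identities are summed over k.
  have hlip : ∀ k, ∃ C, LipschitzWith C (fun y => ζ y * W y k) := by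
    intro k
    refine LocallyLipschitzOn.exists_lipschitzWith hU
      (LocallyLipschitzOn.mul_real hζ.locallyLipschitz.locallyLipschitzOn
        (LocallyLipschitzOn.coord hW k)) hc.mul_right ?_
    exact (tsupport_mul_subset_left).trans hs
  choose C hC using hlip
  have hcs : ∀ k, HasCompactSupport (fun y => ζ y * W y k) := fun k => hc.mul_right
  have hss : ∀ k, tsupport (fun y => ζ y * W y k) ⊆ U := fun k =>
    (tsupport_mul_subset_left).trans hs
  have key : ∀ k, ∫ y, b y * lineDeriv ℝ (fun y => ζ y * W y k) y (EuclideanSpace.single k 1)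
      = -∫ y, w k y * (ζ y * W y k) := fun k =>
    integral_mul_lineDeriv_eq_of_weakDeriv hU volume hb (hw k) _ (hbw k) (hC k) (hcs k) (hss k)
  have hl0 : ∀ k, ∀ y ∉ tsupport ζ,
      lineDeriv ℝ (fun y => ζ y * W y k) y (EuclideanSpace.single k 1) = 0 := by
    intro k y hy
    have h1 : (fun y => ζ y * W y k) =ᶠ[𝓝 y] fun _ => (0 : ℝ) := by
      filter_upwards [notMem_tsupport_iff_eventuallyEq.1 hy] with z hz
      simp [hz]
    rw [h1.lineDeriv_eq]
    simp [lineDeriv]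
  have hint1 : ∀ k, Integrable (fun y => b y *
      lineDeriv ℝ (fun y => ζ y * W y k) y (EuclideanSpace.single k 1)) := by
    intro k
    have h1 : IntegrableOn b (tsupport ζ) := (hb.mono hs).integrableOn_compact hc.isCompact
    have h2 : IntegrableOn (fun y => b y *
        lineDeriv ℝ (fun y => ζ y * W y k) y (EuclideanSpace.single k 1)) (tsupport ζ) := by
      refine Integrable.mul_bdd (c := C k * ‖EuclideanSpace.single k (1 : ℝ)‖) h1
        (aestronglyMeasurable_lineDeriv (hC k).continuous _) (Eventually.of_forall fun y => ?_)
      exact norm_lineDeriv_le_of_lipschitz ℝ (hC k)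
    refine (integrableOn_iff_integrable_of_support_subset fun y hy => ?_).1 h2
    by_contra h
    exact hy (by simp [hl0 k y h])
  have hint2 : ∀ k, Integrable (fun y => w k y * (ζ y * W y k)) := by
    intro k
    refine (integrable_mul_of_tsupport_subset (hw k) (hC k).continuous (hcs k) (hss k)).congr
      (Eventually.of_forall fun y => mul_comm _ _)
  have hsum := Finset.sum_congr (rfl : (Finset.univ : Finset (Fin (n + 1))) = _)
    (fun k _ => key k)
  rw [← integral_finsetSum _ (fun k _ => hint1 k), Finset.sum_neg_distrib,
    ← integral_finsetSum _ (fun k _ => hint2 k)] at hsum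
  have hR : (fun y => ∑ k, w k y * (ζ y * W y k)) = fun y => ζ y * ∑ k, W y k * w k y := by
    funext y
    rw [Finset.mul_sum]
    exact Finset.sum_congr rfl fun k _ => by ring
  rw [hR] at hsum
  rw [← hsum]
  -- By Rademacher the product rule for ζ W_k is available almost everywhere in U, and off the
  -- support of ζ both sides vanish.
  refine integral_congr_ae ?_
  filter_upwards [LocallyLipschitzOn.ae_differentiableAt volume hU hW] with y hy
  by_cases hyU : y ∈ tsupport ζ
  · have hWd := hy (hs hyU)
    have hWk : ∀ k, DifferentiableAt ℝ (fun y => W y k) y := fun k =>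
      (EuclideanSpace.proj (𝕜 := ℝ) k).differentiableAt.comp y hWd
    have hζd : DifferentiableAt ℝ ζ y := hζ.differentiable one_ne_zero y
    rw [← Finset.mul_sum]
    congr 1
    rw [fderiv_apply_eq_sum, coordDiv, Finset.mul_sum, ← Finset.sum_add_distrib]
    refine Finset.sum_congr rfl fun k _ => ?_
    rw [DifferentiableAt.lineDeriv_eq_fderiv (hζd.fun_mul (hWk k)), fderiv_fun_mul hζd (hWk k)]
    simp; ring
  · simp only [hl0 _ y hyU, mul_zero, Finset.sum_const_zero]
    rw [image_eq_zero_of_notMem_tsupport hyU,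
      image_eq_zero_of_notMem_tsupport (fun h => hyU (tsupport_fderiv_subset ℝ h))]
    simp

/-- The special case b = 1, whose weak derivatives are 0. -/
theorem integral_fderiv_add_coordDiv {U : Set (Coord n)} (hU : IsOpen U)
    {W : Coord n → Coord n} (hW : LocallyLipschitzOn U W)
    {ζ : Coord n → ℝ} (hζ : ContDiff ℝ 1 ζ) (hc : HasCompactSupport ζ) (hs : tsupport ζ ⊆ U) :
    ∫ y, fderiv ℝ ζ y (W y) = -∫ y, ζ y * coordDiv W y := by
  have h := integral_mul_fderiv_add_coordDiv hU hW (b := fun _ => 1) continuousOn_const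
    (w := fun _ _ => 0) (fun k => locallyIntegrableOn_zero) (fun k ψ hψ hψc _ => by
      obtain ⟨C, hC⟩ := hψ.lipschitzWith_of_hasCompactSupport hψc (by simp)
      have := integral_lineDeriv_eq_zero volume hC hψc (EuclideanSpace.single k 1)
      simp only [(hψ.differentiable (by simp) _).lineDeriv_eq_fderiv] at this
      simpa using this) hζ hc hs
  simp only [one_mul, mul_zero, Finset.sum_const_zero, integral_zero, neg_zero] at h
  have hi1 : Integrable fun y => ζ y * coordDiv W y :=
    integrable_mul_of_tsupport_subset (locallyIntegrableOn_coordDiv hU hW) hζ.continuous hc hs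
  by_cases hi : Integrable fun y => fderiv ℝ ζ y (W y)
  · rw [integral_add hi hi1] at h
    linarith
  · exfalso
    refine hi ?_
    have : ContinuousOn (fun y => fderiv ℝ ζ y (W y)) (tsupport ζ) :=
      ((hζ.continuous_fderiv one_ne_zero).continuousOn).clm_apply (hW.continuousOn.mono hs)
    refine (integrableOn_iff_integrable_of_support_subset fun y hy => ?_).1
      (this.integrableOn_compact hc.isCompact)
    refine tsupport_fderiv_subset ℝ (subset_tsupport _ fun h0 => hy ?_)
    simp [h0]

/-- If the distributional divergence of `b W` is at least `-D b g`, then it can be tested against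
`u θ` with `u` of class `C¹`. -/
theorem integral_mul_fderiv_le {U : Set (Coord n)} (hU : IsOpen U)
    {W : Coord n → Coord n} (hW : LocallyLipschitzOn U W) {b : Coord n → ℝ}
    (hb : ContinuousOn b U) {w : Fin (n + 1) → Coord n → ℝ}
    (hw : ∀ k, LocallyIntegrableOn (w k) U)
    (hbw : ∀ k, ∀ ψ : Coord n → ℝ, ContDiff ℝ ∞ ψ → HasCompactSupport ψ → tsupport ψ ⊆ U →
      ∫ y, b y * fderiv ℝ ψ y (EuclideanSpace.single k 1) = -∫ y, w k y * ψ y)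
    {u g : Coord n → ℝ} (hu : ContDiffOn ℝ 1 u U) (hu0 : ∀ y, 0 ≤ u y) (hg : ContinuousOn g U)
    {D : ℝ} (hD : ∀ᵐ y, y ∈ U → -(D * b y * g y) ≤ b y * coordDiv W y + ∑ k, W y k * w k y)
    {θ : Coord n → ℝ} (hθ : ContDiff ℝ 1 θ) (hθ0 : ∀ y, 0 ≤ θ y) (hc : HasCompactSupport θ)
    (hs : tsupport θ ⊆ U) :
    ∫ y, b y * u y * fderiv ℝ θ y (W y)
      ≤ ∫ y, θ y * (|b y * fderiv ℝ u y (W y)| + D * u y * b y * g y) := by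
  -- The identity is tested with θu. The term where the derivative hits θ is kept on the left; the
  -- term where it hits u is bounded by its absolute value, and the remaining ones by the hypothesis
  -- `hD` multiplied by θu ≥ 0.
  set ζ : Coord n → ℝ := fun y => θ y * u y with hζdef
  have hsζ : tsupport ζ ⊆ tsupport θ := tsupport_mul_subset_left
  have hcζ : HasCompactSupport ζ := hc.mul_right
  have hζ : ContDiff ℝ 1 ζ := by
    refine contDiff_of_tsupport fun y hy => ?_
    exact hθ.contDiffAt.mul (hu.contDiffAt (hU.mem_nhds (hs (hsζ hy))))
  have hmain := integral_mul_fderiv_add_coordDiv hU hW hb hw hbw hζ hcζ (hsζ.trans hs)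
  have hWc := hW.continuousOn
  have hfu : ContinuousOn (fderiv ℝ u) U := hu.continuousOn_fderiv_of_isOpen hU le_rfl
  have hduW : ContinuousOn (fun y => fderiv ℝ u y (W y)) U := hfu.clm_apply hWc
  have hθW : ContinuousOn (fun y => fderiv ℝ θ y (W y)) U :=
    (hθ.continuous_fderiv one_ne_zero).continuousOn.clm_apply hWc
  have hLI : ∀ {h : Coord n → ℝ}, ContinuousOn h U → LocallyIntegrableOn h U := fun hh =>
    hh.locallyIntegrableOn hU.measurableSet
  have hI1 : Integrable fun y => b y * u y * fderiv ℝ θ y (W y) := by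
    refine (integrableOn_iff_integrable_of_support_subset fun y hy => ?_).1
      ((((hb.mul hu.continuousOn).mul hθW).mono hs).integrableOn_compact hc.isCompact)
    refine tsupport_fderiv_subset ℝ (subset_tsupport _ fun h0 => hy ?_)
    simp [h0]
  have hI2 : Integrable fun y => θ y * (b y * fderiv ℝ u y (W y)) :=
    integrable_mul_of_tsupport_subset (hLI (hb.mul hduW)) hθ.continuous hc hs
  have hI3 : Integrable fun y => θ y * (u y * b y * coordDiv W y) :=
    integrable_mul_of_tsupport_subset (locallyIntegrableOn_comp_coord hU
      (locallyIntegrableOn_coordDiv hU hW) (hu.continuousOn.mul hb)) hθ.continuous hc hs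
  have hsumint : LocallyIntegrableOn (fun y => ∑ k, W y k * w k y) U := by
    have : ∀ k, LocallyIntegrableOn (fun y => W y k * w k y) U := fun k =>
      locallyIntegrableOn_comp_coord hU (hw k) (LocallyLipschitzOn.coord hW k).continuousOn
    rw [locallyIntegrableOn_iff hU.isLocallyClosed]
    exact fun K hKU hK => integrable_finsetSum _
      fun k _ => (this k).integrableOn_compact_subset hKU hK
  have hI4 : Integrable fun y => ζ y * ∑ k, W y k * w k y :=
    integrable_mul_of_tsupport_subset hsumint hζ.continuous hcζ (hsζ.trans hs)
  have hI5 : Integrable fun y => θ y * (|b y * fderiv ℝ u y (W y)| + D * u y * b y * g y) :=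
    integrable_mul_of_tsupport_subset (hLI ((hb.mul hduW).abs.add
      (((continuousOn_const.mul hu.continuousOn).mul hb).mul hg))) hθ.continuous hc hs
  have hexp : (fun y => b y * (fderiv ℝ ζ y (W y) + ζ y * coordDiv W y)) = fun y =>
      b y * u y * fderiv ℝ θ y (W y) + (θ y * (b y * fderiv ℝ u y (W y))
        + θ y * (u y * b y * coordDiv W y)) := by
    funext y
    by_cases hy : y ∈ tsupport θ
    · have hud : DifferentiableAt ℝ u y :=
        (hu.contDiffAt (hU.mem_nhds (hs hy))).differentiableAt one_ne_zero
      rw [hζdef, fderiv_fun_mul (hθ.differentiable one_ne_zero y) hud]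
      simp; ring
    · rw [image_eq_zero_of_notMem_tsupport (fun h => hy (tsupport_fderiv_subset ℝ h)),
        image_eq_zero_of_notMem_tsupport (fun h => hy (hsζ (tsupport_fderiv_subset ℝ h))),
        hζdef]
      simp [image_eq_zero_of_notMem_tsupport hy]
  rw [hexp, integral_add hI1 (by exact hI2.add hI3)] at hmain
  have hle : -(∫ y, θ y * (b y * fderiv ℝ u y (W y)) + θ y * (u y * b y * coordDiv W y))
      - ∫ y, ζ y * ∑ k, W y k * w k y
      ≤ ∫ y, θ y * (|b y * fderiv ℝ u y (W y)| + D * u y * b y * g y) := by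
    have hI23 : Integrable fun y =>
        -(θ y * (b y * fderiv ℝ u y (W y)) + θ y * (u y * b y * coordDiv W y)) :=
      (hI2.add hI3).neg
    rw [← integral_neg, ← integral_sub hI23 hI4]
    refine integral_mono_ae (hI23.sub hI4) hI5 ?_
    filter_upwards [hD] with y hy
    by_cases hyU : y ∈ tsupport θ
    · have h1 := mul_le_mul_of_nonneg_left (hy (hs hyU)) (mul_nonneg (hθ0 y) (hu0 y))
      have h2 := mul_le_mul_of_nonneg_left (neg_abs_le (b y * fderiv ℝ u y (W y))) (hθ0 y)
      simp only [hζdef]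
      nlinarith
    · simp [hζdef, image_eq_zero_of_notMem_tsupport hyU]
  linarith

end Divergence

/-! ### The boundary layer in the half space -/

section HalfSpace

variable {n : ℕ}

/-- The point with first coordinate `t` and remaining coordinates `z`. -/
def consPoint (q : ℝ × EuclideanSpace ℝ (Fin n)) : Coord n :=
  WithLp.toLp 2 (Fin.cons q.1 (fun i => q.2 i))

@[simp] theorem consPoint_zero (q : ℝ × EuclideanSpace ℝ (Fin n)) : consPoint q 0 = q.1 := rfl

@[simp] theorem consPoint_succ (q : ℝ × EuclideanSpace ℝ (Fin n)) (i : Fin n) :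
    consPoint q i.succ = q.2 i := rfl

@[simp] theorem hyperplanePoint_zero (z : EuclideanSpace ℝ (Fin n)) :
    hyperplanePoint z 0 = 0 := rfl

@[simp] theorem hyperplanePoint_succ (z : EuclideanSpace ℝ (Fin n)) (i : Fin n) :
    hyperplanePoint z i.succ = z i := rfl

/-- The coordinates of a point other than the first one. -/
def tailPoint (y : Coord n) : EuclideanSpace ℝ (Fin n) := WithLp.toLp 2 fun i => y i.succ

@[simp] theorem tailPoint_apply (y : Coord n) (i : Fin n) : tailPoint y i = y i.succ := rfl

@[simp] theorem tailPoint_consPoint (q : ℝ × EuclideanSpace ℝ (Fin n)) :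
    tailPoint (consPoint q) = q.2 := by ext i; simp

@[simp] theorem tailPoint_hyperplanePoint (z : EuclideanSpace ℝ (Fin n)) :
    tailPoint (hyperplanePoint z) = z := by ext i; simp

theorem hyperplanePoint_tailPoint {y : Coord n} (hy : y 0 = 0) :
    hyperplanePoint (tailPoint y) = y := by
  ext i
  refine Fin.cases ?_ (fun i => ?_) i <;> simp [hy]

theorem contDiff_tailPoint {m : WithTop ℕ∞} : ContDiff ℝ m (tailPoint (n := n)) := by
  rw [contDiff_euclidean]
  intro i
  exact (EuclideanSpace.proj (𝕜 := ℝ) i.succ).contDiff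

theorem contDiff_consPoint {m : WithTop ℕ∞} : ContDiff ℝ m (consPoint (n := n)) := by
  rw [contDiff_euclidean]
  intro i
  refine Fin.cases ?_ (fun i => ?_) i
  · exact contDiff_fst
  · exact (EuclideanSpace.proj (𝕜 := ℝ) i).contDiff.comp contDiff_snd

theorem contDiff_hyperplanePoint {m : WithTop ℕ∞} : ContDiff ℝ m (hyperplanePoint (n := n)) :=
  contDiff_consPoint.comp (contDiff_const.prodMk contDiff_id)

theorem continuous_coord_zero : Continuous fun y : Coord n => y 0 :=
  (EuclideanSpace.proj (𝕜 := ℝ) (0 : Fin (n + 1))).continuous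

theorem measurePreserving_consPoint : MeasurePreserving (consPoint (n := n)) := by
  have h1 : MeasurePreserving (fun q : ℝ × EuclideanSpace ℝ (Fin n) => (q.1, WithLp.ofLp q.2)) :=
    (MeasurePreserving.id volume).prod (PiLp.volume_preserving_ofLp (Fin n))
  have h2 := (volume_preserving_piFinSuccAbove (fun _ : Fin (n + 1) => ℝ) 0).symm
  refine ((PiLp.volume_preserving_toLp (Fin (n + 1))).comp (h2.comp h1)).congr
    (contDiff_consPoint (m := 0)).continuous.measurable (Eventually.of_forall fun q => ?_)
  ext i
  refine Fin.cases ?_ (fun i => ?_) i <;> simp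

theorem measurableEmbedding_consPoint : MeasurableEmbedding (consPoint (n := n)) := by
  have : Function.Injective (consPoint (n := n)) := by
    intro q q' h
    exact Prod.ext (congrArg (fun y : Coord n => y 0) h) (by simpa using congrArg tailPoint h)
  exact (contDiff_consPoint (m := 0)).continuous.measurableEmbedding this

/-- Smooth cutoffs of the half line that vanish near `0` and increase to `1`. -/
def cutoff (k : ℕ) (t : ℝ) : ℝ := Real.smoothTransition (k * t - 1)

theorem contDiff_cutoff (k : ℕ) {m : ℕ∞} : ContDiff ℝ m (cutoff k) :=
  Real.smoothTransition.contDiff.comp ((contDiff_const.mul contDiff_id).sub contDiff_const)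

theorem cutoff_nonneg (k : ℕ) (t : ℝ) : 0 ≤ cutoff k t := Real.smoothTransition.nonneg _

theorem cutoff_le_one (k : ℕ) (t : ℝ) : cutoff k t ≤ 1 := Real.smoothTransition.le_one _

theorem cutoff_eq_zero {k : ℕ} {t : ℝ} (h : k * t ≤ 1) : cutoff k t = 0 :=
  Real.smoothTransition.zero_of_nonpos (by linarith)

theorem deriv_cutoff (k : ℕ) (t : ℝ) :
    deriv (cutoff k) t = k * deriv Real.smoothTransition (k * t - 1) := by
  have h1 : HasDerivAt (fun t : ℝ => k * t - 1) (k : ℝ) t := by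
    simpa using ((hasDerivAt_id t).const_mul (k : ℝ)).sub_const 1
  have h2 : HasDerivAt Real.smoothTransition (deriv Real.smoothTransition (k * t - 1))
      (k * t - 1) :=
    ((Real.smoothTransition.contDiff (n := 1)).differentiable one_ne_zero _).hasDerivAt
  have := (h2.comp t h1).deriv
  rw [mul_comm]
  exact this

theorem tendsto_cutoff {t : ℝ} (ht : 0 < t) : Tendsto (fun k => cutoff k t) atTop (𝓝 1) := by
  refine tendsto_const_nhds.congr' ?_
  have h : Tendsto (fun k : ℕ => (k : ℝ) * t) atTop atTop :=
    tendsto_natCast_atTop_atTop.atTop_mul_const ht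
  filter_upwards [h.eventually_ge_atTop 2] with k hk
  exact (Real.smoothTransition.one_of_one_le (by linarith)).symm

theorem continuous_deriv_smoothTransition : Continuous (deriv Real.smoothTransition) :=
  (Real.smoothTransition.contDiff (n := 1)).continuous_deriv le_rfl

theorem deriv_smoothTransition_eq_zero {t : ℝ} (ht : t ∉ Icc (0 : ℝ) 1) :
    deriv Real.smoothTransition t = 0 := by
  rw [mem_Icc, not_and_or, not_le, not_le] at ht
  rcases ht with h | h
  · have : Real.smoothTransition =ᶠ[𝓝 t] fun _ => 0 := by
      filter_upwards [Iio_mem_nhds h] with s hs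
      exact Real.smoothTransition.zero_of_nonpos (le_of_lt hs)
    rw [this.deriv_eq, deriv_const]
  · have : Real.smoothTransition =ᶠ[𝓝 t] fun _ => 1 := by
      filter_upwards [Ioi_mem_nhds h] with s hs
      exact Real.smoothTransition.one_of_one_le (le_of_lt hs)
    rw [this.deriv_eq, deriv_const]

/-- Unit mass makes the rescaled derivatives of the cutoffs an approximate identity at 0, with no
constant left over. -/
theorem integral_deriv_smoothTransition : ∫ t, deriv Real.smoothTransition t = 1 := by
  have h1 : ∫ t in (0 : ℝ)..1, deriv Real.smoothTransition t = 1 := by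
    rw [intervalIntegral.integral_deriv_eq_sub
      (fun t _ => (Real.smoothTransition.contDiff (n := 1)).differentiable one_ne_zero t)
      (continuous_deriv_smoothTransition.intervalIntegrable _ _)]
    simp
  rw [← h1, intervalIntegral.integral_of_le zero_le_one, ← integral_Icc_eq_integral_Ioc]
  exact (setIntegral_eq_integral_of_forall_compl_eq_zero
    fun t ht => deriv_smoothTransition_eq_zero ht).symm

theorem integrable_deriv_smoothTransition : Integrable (deriv Real.smoothTransition) := by
  refine continuous_deriv_smoothTransition.integrable_of_hasCompactSupport ?_
  exact HasCompactSupport.intro isCompact_Icc fun t ht => deriv_smoothTransition_eq_zero ht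

theorem measurableSet_halfSpace : MeasurableSet {y : Coord n | 0 ≤ y 0} :=
  (isClosed_le continuous_const continuous_coord_zero).measurableSet

/-- The layer formula: weighting by the derivatives of the cutoffs of the first coordinate
converges to integration over the boundary hyperplane. -/
theorem tendsto_integral_mul_deriv_cutoff {F : Coord n → ℝ} {K : Set (Coord n)}
    (hK : IsCompact K) (hF0 : ∀ y ∉ K, F y = 0) (hF : ContinuousOn F {y | 0 ≤ y 0}) :
    Tendsto (fun k : ℕ => ∫ y, F y * deriv (cutoff k) (y 0)) atTop
      (𝓝 (∫ z, F (hyperplanePoint z))) := by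
  -- F is controlled only on the closed half space. Below it the derivatives of the cutoffs vanish,
  -- so F may be replaced by its extension by zero, which is measurable and bounded.
  set G : Coord n → ℝ := indicator {y | 0 ≤ y 0} F with hG
  set m := deriv Real.smoothTransition with hm
  have hGm : Measurable G := by
    classical
    have := hF.measurable_piecewise (g := (0 : Coord n → ℝ)) continuousOn_const measurableSet_halfSpace
    rw [hG, ← piecewise_eq_indicator]
    exact this
  obtain ⟨B, hB⟩ : ∃ B, ∀ y, ‖G y‖ ≤ B := by
    obtain ⟨B, hB⟩ := (hK.inter_right (isClosed_le continuous_const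
      (continuous_coord_zero (n := n)))).exists_bound_of_continuousOn
      (hF.mono inter_subset_right)
    refine ⟨max B 0, fun y => ?_⟩
    by_cases hy : 0 ≤ y 0
    · by_cases hyK : y ∈ K
      · rw [hG, indicator_of_mem (by exact hy)]
        exact (hB y ⟨hyK, hy⟩).trans (le_max_left _ _)
      · rw [hG, indicator_of_mem (by exact hy), hF0 y hyK]; simp
    · rw [hG, indicator_of_notMem (by exact hy)]; simp
  have hB0 : 0 ≤ B := (norm_nonneg _).trans (hB 0)
  have hG0 : ∀ y ∉ K, G y = 0 := fun y hy => by
    rw [hG, indicator_apply]; simp [hF0 y hy]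
  set K' := tailPoint '' K with hK'
  have hK'c : IsCompact K' := hK.image (contDiff_tailPoint (m := 0)).continuous
  have hG0' : ∀ t, ∀ z ∉ K', G (consPoint (t, z)) = 0 := fun t z hz =>
    hG0 _ fun h => hz ⟨_, h, by simp⟩
  have hcm : Measurable (consPoint (n := n)) := measurableEmbedding_consPoint.measurable
  -- the integrals in the new coordinates
  have e1 : ∀ k : ℕ, 0 < k → ∫ y, F y * deriv (cutoff k) (y 0)
      = ∫ z, ∫ s, G (consPoint ((s + 1) / k, z)) * m s := by
    intro k hk
    have hk0 : (0 : ℝ) < k := by exact_mod_cast hk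
    have hFG : ∀ y, F y * deriv (cutoff k) (y 0) = G y * deriv (cutoff k) (y 0) := by
      intro y
      by_cases hy : 0 ≤ y 0
      · rw [hG, indicator_of_mem (by exact hy)]
      · rw [deriv_cutoff, deriv_smoothTransition_eq_zero]
        · simp
        · intro h
          have := h.1
          nlinarith
    simp only [hFG]
    rw [← measurePreserving_consPoint.integral_comp measurableEmbedding_consPoint]
    have hint : Integrable (fun q : ℝ × EuclideanSpace ℝ (Fin n) =>
        G (consPoint q) * deriv (cutoff k) (consPoint q 0)) := by
      have hc : Continuous (deriv (cutoff k)) :=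
        (contDiff_cutoff k (m := 1)).continuous_deriv le_rfl
      have hi : Integrable G := by
        refine (integrableOn_iff_integrable_of_support_subset (s := K)
          (fun y hy => by_contra fun h => hy (hG0 y h))).1 ?_
        exact Measure.integrableOn_of_bounded hK.measure_lt_top.ne hGm.aestronglyMeasurable
          (Eventually.of_forall hB)
      have : Integrable (fun y : Coord n => G y * deriv (cutoff k) (y 0)) := by
        refine (integrableOn_iff_integrable_of_support_subset (s := K)
          (fun y hy => by_contra fun h => hy (by simp [hG0 y h]))).1 ?_
        exact hi.integrableOn.mul_continuousOn
          (hc.comp continuous_coord_zero).continuousOn hK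
      exact (measurePreserving_consPoint.integrable_comp_emb measurableEmbedding_consPoint).2 this
    rw [Measure.volume_eq_prod, integral_prod_symm _ hint]
    refine integral_congr_ae (Eventually.of_forall fun z => ?_)
    simp only [consPoint_zero, deriv_cutoff]
    have h1 := Measure.integral_comp_mul_left
      (fun s : ℝ => G (consPoint ((s - 1 + 1) / k, z)) * m (s - 1)) (k : ℝ)
    rw [integral_sub_right_eq_self (fun s : ℝ => G (consPoint ((s + 1) / k, z)) * m s) (1 : ℝ)] at h1
    rw [abs_of_pos (inv_pos.2 hk0), smul_eq_mul] at h1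
    have h2 : ∫ s, G (consPoint ((s + 1) / k, z)) * m s
        = k * ∫ x : ℝ, G (consPoint ((k * x - 1 + 1) / k, z)) * m (k * x - 1) := by
      rw [h1]; field_simp
    rw [h2, ← integral_const_mul]
    refine integral_congr_ae (Eventually.of_forall fun t => ?_)
    simp only [sub_add_cancel]
    rw [mul_div_cancel_left₀ _ hk0.ne']
    ring
  have hmeas : ∀ k : ℕ, Measurable fun q : EuclideanSpace ℝ (Fin n) × ℝ =>
      G (consPoint ((q.2 + 1) / k, q.1)) * m q.2 := by
    intro k
    refine (hGm.comp (hcm.comp ?_)).mul (continuous_deriv_smoothTransition.measurable.comp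
      measurable_snd)
    exact ((measurable_snd.add_const 1).div_const _).prodMk measurable_fst
  have hbm : ∀ (k : ℕ) z s, ‖G (consPoint ((s + 1) / k, z)) * m s‖ ≤ B * ‖m s‖ := by
    intro k z s
    rw [norm_mul]
    exact mul_le_mul_of_nonneg_right (hB _) (norm_nonneg _)
  have hmi : Integrable m := integrable_deriv_smoothTransition
  have e2 : ∀ z, Tendsto (fun k : ℕ => ∫ s, G (consPoint ((s + 1) / k, z)) * m s) atTop
      (𝓝 (F (hyperplanePoint z))) := by
    intro z
    have : ∫ s, F (hyperplanePoint z) * m s = F (hyperplanePoint z) := by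
      rw [integral_const_mul, integral_deriv_smoothTransition, mul_one]
    rw [← this]
    refine tendsto_integral_of_dominated_convergence (fun s => B * ‖m s‖) ?_
      (hmi.norm.const_mul B) (fun k => Eventually.of_forall fun s => hbm k z s) ?_
    · exact fun k => ((hmeas k).comp (measurable_const.prodMk measurable_id)).aestronglyMeasurable
    · refine Eventually.of_forall fun s => ?_
      -- On the support of m the point ((s + 1)/k, z) tends to the hyperplane from within the half
      -- space, where F is continuous.
      by_cases hs : s ∈ Icc (0 : ℝ) 1
      · refine Tendsto.mul_const _ ?_
        have hpos : ∀ k : ℕ, (0 : ℝ) ≤ (s + 1) / k := fun k =>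
          div_nonneg (by linarith [hs.1]) k.cast_nonneg
        have h0 : Tendsto (fun k : ℕ => consPoint ((s + 1) / k, z)) atTop
            (𝓝[{y | 0 ≤ y 0}] (hyperplanePoint z)) := by
          refine tendsto_nhdsWithin_iff.2 ⟨?_, Eventually.of_forall fun k => hpos k⟩
          refine ((contDiff_consPoint (n := n) (m := 0)).continuous.tendsto (0, z)).comp ?_
          exact (tendsto_const_nhds.div_atTop tendsto_natCast_atTop_atTop).prodMk_nhds
            tendsto_const_nhds
        refine ((hF _ (by simp)).tendsto.comp h0).congr fun k => ?_
        simp only [hG, Function.comp]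
        rw [indicator_of_mem (by exact hpos k)]
      · rw [hm, deriv_smoothTransition_eq_zero hs]; simp
  have e3 : Tendsto (fun k : ℕ => ∫ z, ∫ s, G (consPoint ((s + 1) / k, z)) * m s) atTop
      (𝓝 (∫ z, F (hyperplanePoint z))) := by
    refine tendsto_integral_of_dominated_convergence
      (K'.indicator fun _ => B * ∫ s, ‖m s‖) ?_ ?_ ?_ (Eventually.of_forall e2)
    · exact fun k => ((hmeas k).aestronglyMeasurable (μ := volume.prod volume)).integral_prod_right'
    · exact (integrable_indicator_iff hK'c.measurableSet).2
        (integrableOn_const hK'c.measure_lt_top.ne)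
    · refine fun k => Eventually.of_forall fun z => ?_
      by_cases hz : z ∈ K'
      · rw [indicator_of_mem hz, ← integral_const_mul]
        exact norm_integral_le_of_norm_le (hmi.norm.const_mul B)
          (Eventually.of_forall fun s => hbm k z s)
      · simp [hG0' _ z hz, indicator_of_notMem hz]
  refine e3.congr' ?_
  filter_upwards [eventually_gt_atTop 0] with k hk
  exact (e1 k hk).symm

end HalfSpace

notation "𝔠[" n "]" => extChartAt (𝓡∂ (n + 1))

/-! ### Charts, interior and boundary, coordinate frames -/

section Charts

variable {n : ℕ} {M : Type*} [TopologicalSpace M] [ChartedSpace (EuclideanHalfSpace (n + 1)) M]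

theorem mem_range_iff {y : Coord n} : y ∈ range (𝓡∂ (n + 1)) ↔ 0 ≤ y 0 := by
  rw [range_modelWithCornersEuclideanHalfSpace]; rfl

theorem nonneg_of_mem_target {x₀ : M} {y : Coord n} (hy : y ∈ (𝔠[n] x₀).target) : 0 ≤ y 0 :=
  mem_range_iff.1 (extChartAt_target_subset_range x₀ hy)

theorem exists_isOpen_target_eq (x₀ : M) :
    ∃ O : Set (Coord n), IsOpen O ∧ (𝔠[n] x₀).target = O ∩ {y | 0 ≤ y 0} := by
  refine ⟨(𝓡∂ (n + 1)).symm ⁻¹' (chartAt (EuclideanHalfSpace (n + 1)) x₀).target,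
    (chartAt (EuclideanHalfSpace (n + 1)) x₀).open_target.preimage (𝓡∂ (n + 1)).continuous_symm, ?_⟩
  rw [extChartAt_target, range_modelWithCornersEuclideanHalfSpace]

theorem measurableSet_target (x₀ : M) : MeasurableSet (𝔠[n] x₀).target := by
  obtain ⟨O, hO, h⟩ := exists_isOpen_target_eq (n := n) x₀
  rw [h]
  exact hO.measurableSet.inter measurableSet_halfSpace

theorem interior_target (x₀ : M) :
    interior (𝔠[n] x₀).target = (𝔠[n] x₀).target ∩ {y | 0 < y 0} := by
  obtain ⟨O, hO, h⟩ := exists_isOpen_target_eq (n := n) x₀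
  have h2 : interior {y : Coord n | 0 ≤ y 0} = {y | 0 < y 0} := by
    have := interior_range_modelWithCornersEuclideanHalfSpace (n + 1)
    rwa [range_modelWithCornersEuclideanHalfSpace] at this
  rw [h, interior_inter, hO.interior_eq, h2]
  ext y
  simp only [mem_inter_iff, mem_ofPred_eq]
  constructor
  · rintro ⟨h1, h2⟩; exact ⟨⟨h1, h2.le⟩, h2⟩
  · rintro ⟨⟨h1, _⟩, h2⟩; exact ⟨h1, h2⟩

theorem volume_hyperplane : volume {y : Coord n | y 0 = 0} = 0 := by
  have h : {y : Coord n | y 0 = 0} = (LinearMap.ker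
      (EuclideanSpace.proj (𝕜 := ℝ) (0 : Fin (n + 1))).toLinearMap : Set (Coord n)) := by
    ext y; simp
  rw [h]
  refine Measure.addHaar_submodule _ _ fun htop => ?_
  have : (EuclideanSpace.single 0 1 : Coord n) ∈ LinearMap.ker
      (EuclideanSpace.proj (𝕜 := ℝ) (0 : Fin (n + 1))).toLinearMap := by rw [htop]; trivial
  simp at this

theorem target_ae_eq_interior (x₀ : M) :
    (𝔠[n] x₀).target =ᵐ[volume] interior (𝔠[n] x₀).target := by
  refine Filter.EventuallyLE.antisymm ?_ interior_subset.eventuallyLE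
  rw [ae_le_set]
  refine measure_mono_null (fun y hy => ?_) (volume_hyperplane (n := n))
  rw [interior_target] at hy
  have h1 := nonneg_of_mem_target hy.1
  by_contra h2
  exact hy.2 ⟨hy.1, lt_of_le_of_ne h1 (Ne.symm h2)⟩

/-- Moving slightly in the direction of the zeroth coordinate leads into the interior. This lets
identities between continuous functions pass from the interior to the boundary. -/
theorem target_subset_closure_interior (x₀ : M) :
    (𝔠[n] x₀).target ⊆ closure (interior (𝔠[n] x₀).target) := by
  intro y hy
  obtain ⟨O, hO, h⟩ := exists_isOpen_target_eq (n := n) x₀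
  have hyO : y ∈ O := by rw [h] at hy; exact hy.1
  have hlim : Tendsto (fun k : ℕ => y + (1 / ((k : ℝ) + 1)) • (EuclideanSpace.single 0 1 : Coord n))
      atTop (𝓝 y) := by
    have : Tendsto (fun k : ℕ => y + (1 / ((k : ℝ) + 1)) • (EuclideanSpace.single 0 1 : Coord n))
      atTop (𝓝 (y + (0 : ℝ) • (EuclideanSpace.single 0 1 : Coord n))) :=
      tendsto_const_nhds.add (tendsto_one_div_add_atTop_nhds_zero_nat.smul_const _)
    simpa using this
  refine mem_closure_of_tendsto hlim ?_
  filter_upwards [hlim (hO.mem_nhds hyO)] with k hk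
  rw [interior_target, h]
  have h1 : 0 < (y + (1 / ((k : ℝ) + 1)) • (EuclideanSpace.single 0 1 : Coord n)) 0 := by
    have := nonneg_of_mem_target hy
    have h2 : (0 : ℝ) < ((k : ℝ) + 1)⁻¹ := by positivity
    simp only [one_div, PiLp.add_apply, PiLp.smul_apply, smul_eq_mul, PiLp.single_apply,
      if_true, mul_one]
    exact add_pos_of_nonneg_of_pos this h2
  exact ⟨⟨hk, h1.le⟩, h1⟩

/-- The target is relatively open in the half space, so continuity on it is continuity in the half
space at points of K; off K the function is locally zero. -/
theorem continuousOn_halfSpace_of_target {x₀ : M} {F : Coord n → ℝ} {K : Set (Coord n)}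
    (hK : IsCompact K) (hKT : K ⊆ (𝔠[n] x₀).target) (hF0 : ∀ y ∉ K, F y = 0)
    (hF : ContinuousOn F (𝔠[n] x₀).target) : ContinuousOn F {y | 0 ≤ y 0} := by
  obtain ⟨O, hO, h⟩ := exists_isOpen_target_eq (n := n) x₀
  intro y hy
  by_cases hyK : y ∈ K
  · have h1 := hF y (hKT hyK)
    rw [h, inter_comm] at h1
    have hyO : y ∈ O := (h ▸ hKT hyK).1
    exact (continuousWithinAt_inter (hO.mem_nhds hyO)).1 h1
  · refine ContinuousAt.continuousWithinAt ?_
    have : F =ᶠ[𝓝 y] fun _ => 0 := by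
      filter_upwards [hK.isClosed.isOpen_compl.mem_nhds hyK] with z hz
      exact hF0 z hz
    exact continuousAt_const.congr this.symm

variable [IsManifold (𝓡∂ (n + 1)) ∞ M]

/-- Being an interior point is independent of the chart, so any chart around the point may be used
in place of the preferred one. -/
theorem mem_interior_iff_of_mem_source {x₀ x : M} (hx : x ∈ (𝔠[n] x₀).source) :
    x ∈ (𝓡∂ (n + 1)).interior M ↔ 0 < (𝔠[n] x₀ x : Coord n) 0 := by
  have hx' : x ∈ (chartAt (EuclideanHalfSpace (n + 1)) x₀).source := by
    rwa [extChartAt_source] at hx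
  have := ModelWithCorners.isInteriorPoint_iff_of_mem_atlas (I := 𝓡∂ (n + 1)) (n := (∞ : WithTop ℕ∞))
    (by simp) (chart_mem_atlas (EuclideanHalfSpace (n + 1)) x₀) hx'
  refine this.trans ?_
  change (𝔠[n] x₀ x : Coord n) ∈ interior (𝔠[n] x₀).target ↔ _
  rw [interior_target]
  exact ⟨fun h => h.2, fun h => ⟨(𝔠[n] x₀).map_source hx, h⟩⟩

theorem mem_boundary_iff_of_mem_source {x₀ x : M} (hx : x ∈ (𝔠[n] x₀).source) :
    x ∈ (𝓡∂ (n + 1)).boundary M ↔ (𝔠[n] x₀ x : Coord n) 0 = 0 := by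
  rw [← ModelWithCorners.compl_interior, mem_compl_iff, mem_interior_iff_of_mem_source hx, not_lt]
  have := nonneg_of_mem_target ((𝔠[n] x₀).map_source hx)
  constructor
  · intro h; exact le_antisymm h this
  · intro h; exact h.le

/-- The frame of tangent vectors at `x` associated with the chart around `x₀`. -/
def frame (x₀ x : M) : Coord n →L[ℝ] TangentSpace (𝓡∂ (n + 1)) x :=
  (trivializationAt (Coord n) (TangentSpace (𝓡∂ (n + 1))) x₀).symmL ℝ x

theorem chartVector_eq {x₀ : M} {y : Coord n} (hy : y ∈ (𝔠[n] x₀).target) (v : Coord n) :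
    chartVector x₀ y v = frame x₀ ((𝔠[n] x₀).symm y) v := by
  have hx : (𝔠[n] x₀).symm y ∈ (chartAt (EuclideanHalfSpace (n + 1)) x₀).source := by
    have := (𝔠[n] x₀).map_target hy
    rwa [extChartAt_source] at this
  have h := TangentBundle.symmL_trivializationAt (I := 𝓡∂ (n + 1)) (𝕜 := ℝ) hx
  have h2 : 𝔠[n] x₀ ((𝔠[n] x₀).symm y) = y := (𝔠[n] x₀).right_inv hy
  -- The type of the derivative depends on the base point; comparing values in `Coord n` makes the
  -- substitution of equal points legitimate.
  have key : ∀ y', y' = y → @Eq (Coord n)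
      (mfderivWithin 𝓘(ℝ, Coord n) (𝓡∂ (n + 1)) (𝔠[n] x₀).symm (range (𝓡∂ (n + 1))) y' v)
      (mfderivWithin 𝓘(ℝ, Coord n) (𝓡∂ (n + 1)) (𝔠[n] x₀).symm (range (𝓡∂ (n + 1))) y v) := by
    rintro _ rfl; rfl
  have h3 : @Eq (Coord n) (frame x₀ ((𝔠[n] x₀).symm y) v)
      (mfderivWithin 𝓘(ℝ, Coord n) (𝓡∂ (n + 1)) (𝔠[n] x₀).symm (range (𝓡∂ (n + 1)))
        (𝔠[n] x₀ ((𝔠[n] x₀).symm y)) v) :=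
    DFunLike.congr_fun h v
  exact ((h3.trans (key _ h2))).symm

theorem frame_change {x₀ x₁ x : M} (h₀ : x ∈ (𝔠[n] x₀).source) (h₁ : x ∈ (𝔠[n] x₁).source)
    (v : Coord n) :
    frame x₀ x v = frame x₁ x (tangentCoordChange (𝓡∂ (n + 1)) x₀ x₁ x v) := by
  have e0 : (frame x₀ x : Coord n → Coord n) = tangentCoordChange (𝓡∂ (n + 1)) x₀ x x := by
    funext v
    exact DFunLike.congr_fun (TangentBundle.symmL_trivializationAt_eq_core (I := 𝓡∂ (n + 1)) (𝕜 := ℝ)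
      (by rwa [extChartAt_source] at h₀)) v
  have e1 : (frame x₁ x : Coord n → Coord n) = tangentCoordChange (𝓡∂ (n + 1)) x₁ x x := by
    funext v
    exact DFunLike.congr_fun (TangentBundle.symmL_trivializationAt_eq_core (I := 𝓡∂ (n + 1)) (𝕜 := ℝ)
      (by rwa [extChartAt_source] at h₁)) v
  have := tangentCoordChange_comp (I := 𝓡∂ (n + 1)) (w := x₀) (x := x₁) (y := x) (z := x) (v := v)
    ⟨⟨h₀, h₁⟩, mem_extChartAt_source x⟩
  refine (congrFun e0 v).trans (this.symm.trans ?_)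
  exact (congrFun e1 _).symm

theorem mfderiv_extChartAt_frame {x₀ x : M} (hx : x ∈ (𝔠[n] x₀).source) (v : Coord n) :
    (mfderiv (𝓡∂ (n + 1)) 𝓘(ℝ, Coord n) (𝔠[n] x₀) x (frame x₀ x v) : Coord n) = v := by
  have hx' : x ∈ (chartAt (EuclideanHalfSpace (n + 1)) x₀).source := by
    rwa [extChartAt_source] at hx
  rw [← TangentBundle.continuousLinearMapAt_trivializationAt (I := 𝓡∂ (n + 1)) (𝕜 := ℝ) hx']
  exact Bundle.Trivialization.continuousLinearMapAt_symmL _ (by simpa using hx') v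

theorem frame_mfderiv_extChartAt {x₀ x : M} (hx : x ∈ (𝔠[n] x₀).source)
    (v : TangentSpace (𝓡∂ (n + 1)) x) :
    frame x₀ x (mfderiv (𝓡∂ (n + 1)) 𝓘(ℝ, Coord n) (𝔠[n] x₀) x v : Coord n) = v := by
  have hx' : x ∈ (chartAt (EuclideanHalfSpace (n + 1)) x₀).source := by
    rwa [extChartAt_source] at hx
  rw [← TangentBundle.continuousLinearMapAt_trivializationAt (I := 𝓡∂ (n + 1)) (𝕜 := ℝ) hx']
  exact Bundle.Trivialization.symmL_continuousLinearMapAt _ (by simpa using hx') v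

/-- Read in the trivialization that defines it, the frame field is the constant v. -/
theorem contMDiffOn_frame (x₀ : M) (v : Coord n) :
    ContMDiffOn (𝓡∂ (n + 1)) ((𝓡∂ (n + 1)).prod 𝓘(ℝ, Coord n)) ∞
      (fun x => (⟨x, frame x₀ x v⟩ : TangentBundle (𝓡∂ (n + 1)) M)) (𝔠[n] x₀).source := by
  have hb : (𝔠[n] x₀).source
      = (trivializationAt (Coord n) (TangentSpace (𝓡∂ (n + 1))) x₀).baseSet := by
    rw [extChartAt_source]; simp
  rw [hb]
  refine (Bundle.Trivialization.contMDiffOn_section_baseSet_iff _).2 ?_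
  refine (contMDiffOn_const (c := v)).congr fun x hx => ?_
  have := Bundle.Trivialization.continuousLinearMapAt_symmL (R := ℝ)
    (trivializationAt (Coord n) (TangentSpace (𝓡∂ (n + 1))) x₀) hx v
  rwa [Bundle.Trivialization.continuousLinearMapAt_apply_of_mem (R := ℝ) _ hx] at this

end Charts

/-! ### Changes of charts at boundary points -/

section CoordChange

variable {n : ℕ} {M : Type*} [TopologicalSpace M] [ChartedSpace (EuclideanHalfSpace (n + 1)) M]
  [IsManifold (𝓡∂ (n + 1)) ∞ M]

-- The model takes values in the half space, so this holds even outside the chart's source.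
omit [IsManifold (𝓡∂ (n + 1)) ∞ M] in
theorem extChartAt_zero_nonneg (x₀ x : M) : 0 ≤ (𝔠[n] x₀ x : Coord n) 0 := by
  have : (𝔠[n] x₀ x : Coord n) ∈ range (𝓡∂ (n + 1)) := mem_range_self _
  exact mem_range_iff.1 this

theorem tangentCoordChange_inverse {x₀ x₁ x : M} (h₀ : x ∈ (𝔠[n] x₀).source)
    (h₁ : x ∈ (𝔠[n] x₁).source) (v : Coord n) :
    tangentCoordChange (𝓡∂ (n + 1)) x₁ x₀ x (tangentCoordChange (𝓡∂ (n + 1)) x₀ x₁ x v) = v := by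
  rw [tangentCoordChange_comp ⟨⟨h₀, h₁⟩, h₀⟩, tangentCoordChange_self h₀]

theorem hasFDerivWithinAt_coordChange_zero {x₀ x₁ x : M} (h₀ : x ∈ (𝔠[n] x₀).source)
    (h₁ : x ∈ (𝔠[n] x₁).source) :
    HasFDerivWithinAt (fun y : Coord n => (𝔠[n] x₁ ((𝔠[n] x₀).symm y) : Coord n) 0)
      ((EuclideanSpace.proj (𝕜 := ℝ) (0 : Fin (n + 1))).comp
        (tangentCoordChange (𝓡∂ (n + 1)) x₀ x₁ x)) (range (𝓡∂ (n + 1))) (𝔠[n] x₀ x) :=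
  (EuclideanSpace.proj (𝕜 := ℝ) (0 : Fin (n + 1))).hasFDerivAt.comp_hasFDerivWithinAt _
    (hasFDerivWithinAt_tangentCoordChange ⟨h₀, h₁⟩)

theorem isMinOn_coordChange_zero {x₀ x₁ x : M} (h₀ : x ∈ (𝔠[n] x₀).source)
    (h₁ : x ∈ (𝔠[n] x₁).source) (hb : x ∈ (𝓡∂ (n + 1)).boundary M) :
    IsMinOn (fun y : Coord n => (𝔠[n] x₁ ((𝔠[n] x₀).symm y) : Coord n) 0)
      (range (𝓡∂ (n + 1))) (𝔠[n] x₀ x) := by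
  intro y _
  simp only [mem_ofPred_eq]
  rw [(𝔠[n] x₀).left_inv h₀, (mem_boundary_iff_of_mem_source h₁).1 hb]
  exact extChartAt_zero_nonneg _ _

theorem mem_posTangentConeAt_range {y v : Coord n} (hy : 0 ≤ y 0) (hv : 0 ≤ v 0) :
    v ∈ posTangentConeAt (range (𝓡∂ (n + 1))) y := by
  refine mem_posTangentConeAt_of_segment_subset ?_
  refine (((𝓡∂ (n + 1)).convex_range).segment_subset (mem_range_iff.2 hy) (mem_range_iff.2 ?_))
  simpa using add_nonneg hy hv

/-- At a boundary point the new zeroth coordinate attains its minimum 0 over the half space. When v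
0 = 0 both v and -v are admissible directions, so the derivative along v vanishes. -/
theorem tangentCoordChange_tangential {x₀ x₁ x : M} (h₀ : x ∈ (𝔠[n] x₀).source)
    (h₁ : x ∈ (𝔠[n] x₁).source) (hb : x ∈ (𝓡∂ (n + 1)).boundary M) {v : Coord n} (hv : v 0 = 0) :
    tangentCoordChange (𝓡∂ (n + 1)) x₀ x₁ x v 0 = 0 := by
  have hy := ((mem_boundary_iff_of_mem_source h₀).1 hb).ge
  exact (isMinOn_coordChange_zero h₀ h₁ hb).localize.hasFDerivWithinAt_eq_zero
    (hasFDerivWithinAt_coordChange_zero h₀ h₁)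
    (mem_posTangentConeAt_range hy hv.ge) (mem_posTangentConeAt_range hy (by simp [hv]))

theorem tangentCoordChange_apply_zero {x₀ x₁ x : M} (h₀ : x ∈ (𝔠[n] x₀).source)
    (h₁ : x ∈ (𝔠[n] x₁).source) (hb : x ∈ (𝓡∂ (n + 1)).boundary M) (v : Coord n) :
    tangentCoordChange (𝓡∂ (n + 1)) x₀ x₁ x v 0
      = v 0 * tangentCoordChange (𝓡∂ (n + 1)) x₀ x₁ x (EuclideanSpace.single 0 1) 0 := by
  have h := tangentCoordChange_tangential h₀ h₁ hb
    (v := v - v 0 • EuclideanSpace.single 0 1) (by simp)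
  rw [map_sub, map_smul, PiLp.sub_apply, PiLp.smul_apply, sub_eq_zero, smul_eq_mul] at h
  exact h

/-- The same minimum makes the derivative along the inward direction nonnegative. If it were zero,
every image vector would have zeroth component 0, contradicting invertibility. -/
theorem tangentCoordChange_normal_pos {x₀ x₁ x : M} (h₀ : x ∈ (𝔠[n] x₀).source)
    (h₁ : x ∈ (𝔠[n] x₁).source) (hb : x ∈ (𝓡∂ (n + 1)).boundary M) :
    0 < tangentCoordChange (𝓡∂ (n + 1)) x₀ x₁ x (EuclideanSpace.single 0 1) 0 := by
  have hy := ((mem_boundary_iff_of_mem_source h₀).1 hb).ge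
  have h := (isMinOn_coordChange_zero h₀ h₁ hb).localize.hasFDerivWithinAt_nonneg
    (hasFDerivWithinAt_coordChange_zero h₀ h₁)
    (mem_posTangentConeAt_range (v := EuclideanSpace.single 0 1) hy (by simp))
  refine lt_of_le_of_ne h fun h0 => ?_
  have h2 := tangentCoordChange_inverse h₁ h₀ (EuclideanSpace.single 0 (1 : ℝ))
  have h3 := tangentCoordChange_apply_zero h₀ h₁ hb
    (tangentCoordChange (𝓡∂ (n + 1)) x₁ x₀ x (EuclideanSpace.single 0 1))
  rw [h2] at h3
  have h4 : tangentCoordChange (𝓡∂ (n + 1)) x₀ x₁ x (EuclideanSpace.single 0 1) 0 = 0 := h0.symm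
  rw [h4] at h3
  simp at h3

end CoordChange

theorem det_gram_pos {V : Type*} [NormedAddCommGroup V] [InnerProductSpace ℝ V] {ι : Type*}
    [Fintype ι] [DecidableEq ι] {e : ι → V} (he : LinearIndependent ℝ e) :
    0 < (Matrix.gram ℝ e).det :=
  (Matrix.posDef_gram_of_linearIndependent he).det_pos

/-! ### Riemannian densities in charts -/

section Metric

variable {n : ℕ} {M : Type*} [TopologicalSpace M] [ChartedSpace (EuclideanHalfSpace (n + 1)) M]
  [IsManifold (𝓡∂ (n + 1)) ∞ M]
  [Bundle.RiemannianBundle (fun x : M => TangentSpace (𝓡∂ (n + 1)) x)]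

omit [IsManifold (𝓡∂ (n + 1)) ∞ M] in
theorem inner_grad (f : M → ℝ) (x : M) (v : TangentSpace (𝓡∂ (n + 1)) x) :
    ⟪grad f x, v⟫_ℝ = (mfderiv (𝓡∂ (n + 1)) 𝓘(ℝ, ℝ) f x v : ℝ) := by
  unfold grad
  exact InnerProductSpace.toDual_symm_apply

/-- The coordinate frame of tangent vectors. -/
def coordFrame (x₀ x : M) (i : Fin (n + 1)) : TangentSpace (𝓡∂ (n + 1)) x :=
  frame x₀ x (EuclideanSpace.single i 1)

omit [Bundle.RiemannianBundle (fun x : M => TangentSpace (𝓡∂ (n + 1)) x)] in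
theorem frame_eq_sum (x₀ x : M) (v : Coord n) :
    frame x₀ x v = ∑ k, v k • coordFrame (n := n) x₀ x k := by
  conv_lhs => rw [← (EuclideanSpace.basisFun (Fin (n + 1)) ℝ).sum_repr v]
  simp [coordFrame]

theorem volumeDensity_eq {x₀ : M} {y : Coord n} (hy : y ∈ (𝔠[n] x₀).target) :
    volumeDensity x₀ y = √(Matrix.gram ℝ (coordFrame (n := n) x₀ ((𝔠[n] x₀).symm y))).det := by
  unfold volumeDensity coordFrame
  simp only [chartVector_eq hy]
  rfl

theorem surfaceDensity_eq {x₀ : M} {z : EuclideanSpace ℝ (Fin n)}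
    (hy : hyperplanePoint z ∈ (𝔠[n] x₀).target) :
    surfaceDensity x₀ z = √(Matrix.gram ℝ fun i : Fin n =>
      coordFrame (n := n) x₀ ((𝔠[n] x₀).symm (hyperplanePoint z)) i.succ).det := by
  unfold surfaceDensity coordFrame
  simp only [chartVector_eq hy]
  rfl

omit [Bundle.RiemannianBundle (fun x : M => TangentSpace (𝓡∂ (n + 1)) x)] in
theorem linearIndependent_coordFrame {x₀ x : M} (hx : x ∈ (𝔠[n] x₀).source) :
    LinearIndependent ℝ (coordFrame (n := n) x₀ x) := by
  rw [Fintype.linearIndependent_iff]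
  intro g hg i
  have h1 := frame_eq_sum x₀ x (WithLp.toLp 2 g : Coord n)
  have h2 : frame x₀ x (WithLp.toLp 2 g : Coord n) = 0 := h1.trans hg
  have h3 := mfderiv_extChartAt_frame hx (WithLp.toLp 2 g : Coord n)
  rw [h2, map_zero] at h3
  exact (congrArg (fun v : Coord n => v i) h3).symm

theorem det_gram_coordFrame_pos {x₀ x : M} (hx : x ∈ (𝔠[n] x₀).source) :
    0 < (Matrix.gram ℝ (coordFrame (n := n) x₀ x)).det :=
  det_gram_pos (linearIndependent_coordFrame hx)

theorem volumeDensity_pos {x₀ : M} {y : Coord n} (hy : y ∈ (𝔠[n] x₀).target) :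
    0 < volumeDensity x₀ y := by
  rw [volumeDensity_eq hy]
  exact Real.sqrt_pos.2 (det_gram_coordFrame_pos ((𝔠[n] x₀).map_target hy))

theorem volumeDensity_change {x₀ x₁ x : M} (h₀ : x ∈ (𝔠[n] x₀).source)
    (h₁ : x ∈ (𝔠[n] x₁).source) :
    volumeDensity x₀ (𝔠[n] x₀ x)
      = |(tangentCoordChange (𝓡∂ (n + 1)) x₀ x₁ x).det| * volumeDensity x₁ (𝔠[n] x₁ x) := by
  rw [volumeDensity_eq ((𝔠[n] x₀).map_source h₀), volumeDensity_eq ((𝔠[n] x₁).map_source h₁),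
    (𝔠[n] x₀).left_inv h₀, (𝔠[n] x₁).left_inv h₁]
  set b := (EuclideanSpace.basisFun (Fin (n + 1)) ℝ).toBasis
  have hdet : (tangentCoordChange (𝓡∂ (n + 1)) x₀ x₁ x).det
      = (LinearMap.toMatrix b b (tangentCoordChange (𝓡∂ (n + 1)) x₀ x₁ x).toLinearMap).det :=
    (LinearMap.det_toMatrix b _).symm
  rw [hdet]
  refine sqrt_det_gram_comp _ _ _ fun i => ?_
  change frame x₀ x _ = _
  rw [frame_change h₀ h₁, frame_eq_sum]
  refine Finset.sum_congr rfl fun k _ => ?_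
  rw [LinearMap.toMatrix_apply]
  simp [b]

variable [IsContMDiffRiemannianBundle (𝓡∂ (n + 1)) ∞ (EuclideanSpace ℝ (Fin (n + 1)))
      (fun x : M => TangentSpace (𝓡∂ (n + 1)) x)]

theorem contDiffOn_inner_frame (x₀ : M) (v w : Coord n) :
    ContDiffOn ℝ ∞ (fun y : Coord n => ⟪frame x₀ ((𝔠[n] x₀).symm y) v,
      frame x₀ ((𝔠[n] x₀).symm y) w⟫_ℝ) (𝔠[n] x₀).target := by
  have h1 := ContMDiffOn.inner_bundle (contMDiffOn_frame x₀ v) (contMDiffOn_frame x₀ w)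
  have h2 := h1.comp (contMDiffOn_extChartAt_symm (I := 𝓡∂ (n + 1)) (n := ∞) x₀)
    (fun y hy => (𝔠[n] x₀).map_target hy)
  exact contMDiffOn_iff_contDiffOn.1 h2

theorem contDiffOn_det {ι : Type*} [Fintype ι] [DecidableEq ι] {E : Type*} [NormedAddCommGroup E]
    [NormedSpace ℝ E] {s : Set E} {A : E → Matrix ι ι ℝ} {m : WithTop ℕ∞}
    (hA : ∀ i j, ContDiffOn ℝ m (fun y => A y i j) s) : ContDiffOn ℝ m (fun y => (A y).det) s := by
  simp only [Matrix.det_apply]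
  refine ContDiffOn.sum fun σ _ => ContDiffOn.const_smul _ ?_
  exact contDiffOn_prod fun i _ => hA _ _

theorem contDiffOn_volumeDensity (x₀ : M) :
    ContDiffOn ℝ ∞ (volumeDensity (n := n) x₀) (𝔠[n] x₀).target := by
  have h : ContDiffOn ℝ ∞ (fun y => √(Matrix.gram ℝ (coordFrame (n := n) x₀
      ((𝔠[n] x₀).symm y))).det) (𝔠[n] x₀).target := by
    refine ContDiffOn.sqrt (contDiffOn_det fun i j => ?_)
      fun y hy => (det_gram_coordFrame_pos ((𝔠[n] x₀).map_target hy)).ne'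
    exact contDiffOn_inner_frame x₀ _ _
  exact h.congr fun y hy => volumeDensity_eq hy

theorem continuousOn_surfaceDensity (x₀ : M) :
    ContinuousOn (surfaceDensity (n := n) x₀) (hyperplanePoint ⁻¹' (𝔠[n] x₀).target) := by
  have h : ContinuousOn (fun z => √(Matrix.gram ℝ fun i : Fin n =>
      coordFrame (n := n) x₀ ((𝔠[n] x₀).symm (hyperplanePoint z)) i.succ).det)
      (hyperplanePoint ⁻¹' (𝔠[n] x₀).target) := by
    refine ContinuousOn.sqrt ?_
    refine ((contDiffOn_det (m := 0) (A := fun y : Coord n => Matrix.gram ℝ fun i : Fin n =>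
      coordFrame (n := n) x₀ ((𝔠[n] x₀).symm y) i.succ) (s := (𝔠[n] x₀).target)
      fun i j => ?_).continuousOn).comp
      (contDiff_hyperplanePoint (m := 0)).continuous.continuousOn (fun z hz => hz)
    exact (contDiffOn_inner_frame x₀ _ _).of_le (by simp)
  exact h.congr fun z hz => surfaceDensity_eq hz

end Metric

/-- The coefficients of v are the inverse Gram matrix applied to its pairings with e. For a gradient
these pairings are partial derivatives, which gives a formula for |∇f|² that is visibly continuous.
-/
theorem inner_self_mul_det_gram_eq {V : Type*} [NormedAddCommGroup V] [InnerProductSpace ℝ V]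
    {ι : Type*} [Fintype ι] [DecidableEq ι] (e : ι → V) (a : ι → ℝ) {v : V}
    (hv : v = ∑ k, a k • e k) :
    ⟪v, v⟫_ℝ * (Matrix.gram ℝ e).det
      = (fun k => ⟪v, e k⟫_ℝ) ⬝ᵥ ((Matrix.gram ℝ e).adjugate.mulVec fun k => ⟪v, e k⟫_ℝ) := by
  have hGa : (fun k => ⟪v, e k⟫_ℝ) = (Matrix.gram ℝ e).mulVec a := by
    funext i
    simp [Matrix.mulVec, dotProduct, Matrix.gram_apply, hv, sum_inner, inner_smul_left,
      real_inner_comm, mul_comm]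
  have hvv : ⟪v, v⟫_ℝ = (fun k => ⟪v, e k⟫_ℝ) ⬝ᵥ a := by
    conv_lhs => rw [hv, inner_sum, ← hv]
    simp [dotProduct, inner_smul_right, mul_comm]
  conv_rhs => rw [hGa, Matrix.mulVec_mulVec, Matrix.adjugate_mul, Matrix.smul_mulVec,
    Matrix.one_mulVec, ← hGa]
  rw [dotProduct_smul, ← hvv, smul_eq_mul, mul_comm]

/-! ### The density on the boundary hyperplane -/

section Tangential

variable {n : ℕ}

/-- The projection forgetting the first coordinate, as a continuous linear map. -/
def tailL (n : ℕ) : Coord n →L[ℝ] EuclideanSpace ℝ (Fin n) :=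
  LinearMap.toContinuousLinearMap
    { toFun := tailPoint
      map_add' := fun x y => by ext i; simp
      map_smul' := fun c x => by ext i; simp }

/-- The inclusion of the boundary hyperplane, as a continuous linear map. -/
def hyperplaneL (n : ℕ) : EuclideanSpace ℝ (Fin n) →L[ℝ] Coord n :=
  LinearMap.toContinuousLinearMap
    { toFun := hyperplanePoint
      map_add' := fun x y => by ext i; refine Fin.cases ?_ (fun i => ?_) i <;> simp
      map_smul' := fun c x => by ext i; refine Fin.cases ?_ (fun i => ?_) i <;> simp }

@[simp] theorem tailL_apply (y : Coord n) : tailL n y = tailPoint y := rfl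

@[simp] theorem hyperplaneL_apply (z : EuclideanSpace ℝ (Fin n)) :
    hyperplaneL n z = hyperplanePoint z := rfl

theorem hyperplanePoint_single (i : Fin n) :
    hyperplanePoint (EuclideanSpace.single i (1 : ℝ)) = EuclideanSpace.single i.succ 1 := by
  ext j
  refine Fin.cases ?_ (fun j => ?_) j
  · simp
  · simp

variable {M : Type*} [TopologicalSpace M] [ChartedSpace (EuclideanHalfSpace (n + 1)) M]
  [IsManifold (𝓡∂ (n + 1)) ∞ M]

/-- The derivative of a change of charts along the boundary hyperplane. -/
def boundaryCoordChange (x₀ x₁ x : M) : EuclideanSpace ℝ (Fin n) →L[ℝ] EuclideanSpace ℝ (Fin n) :=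
  (tailL n).comp ((tangentCoordChange (𝓡∂ (n + 1)) x₀ x₁ x).comp (hyperplaneL n))

theorem hasFDerivWithinAt_boundaryCoordChange {x₀ x₁ : M} {z : EuclideanSpace ℝ (Fin n)}
    (h₀ : hyperplanePoint z ∈ (𝔠[n] x₀).target)
    (h₁ : (𝔠[n] x₀).symm (hyperplanePoint z) ∈ (𝔠[n] x₁).source)
    (s : Set (EuclideanSpace ℝ (Fin n))) :
    HasFDerivWithinAt (fun z => tailPoint (𝔠[n] x₁ ((𝔠[n] x₀).symm (hyperplanePoint z))))
      (boundaryCoordChange x₀ x₁ ((𝔠[n] x₀).symm (hyperplanePoint z))) s z := by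
  have h := hasFDerivWithinAt_tangentCoordChange (I := 𝓡∂ (n + 1)) (x := x₀) (y := x₁)
    ⟨(𝔠[n] x₀).map_target h₀, h₁⟩
  rw [(𝔠[n] x₀).right_inv h₀] at h
  have h2 := h.comp z ((hyperplaneL n).hasFDerivAt.hasFDerivWithinAt (s := s))
    (fun w _ => mem_range_iff.2 (by simp))
  exact (tailL n).hasFDerivAt.comp_hasFDerivWithinAt z h2

variable [Bundle.RiemannianBundle (fun x : M => TangentSpace (𝓡∂ (n + 1)) x)]

/-- Changes of charts preserve tangency to the boundary, so a tangential frame vector expands in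
tangential frame vectors only and the Gram law applies with the boundary Jacobian. -/
theorem surfaceDensity_change {x₀ x₁ x : M} (h₀ : x ∈ (𝔠[n] x₀).source)
    (h₁ : x ∈ (𝔠[n] x₁).source) (hb : x ∈ (𝓡∂ (n + 1)).boundary M) :
    surfaceDensity x₀ (tailPoint (𝔠[n] x₀ x))
      = |(boundaryCoordChange (n := n) x₀ x₁ x).det| * surfaceDensity x₁ (tailPoint (𝔠[n] x₁ x)) := by
  have e0 := hyperplanePoint_tailPoint ((mem_boundary_iff_of_mem_source h₀).1 hb)
  have e1 := hyperplanePoint_tailPoint ((mem_boundary_iff_of_mem_source h₁).1 hb)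
  rw [surfaceDensity_eq (by rw [e0]; exact (𝔠[n] x₀).map_source h₀),
    surfaceDensity_eq (by rw [e1]; exact (𝔠[n] x₁).map_source h₁), e0, e1,
    (𝔠[n] x₀).left_inv h₀, (𝔠[n] x₁).left_inv h₁]
  set b := (EuclideanSpace.basisFun (Fin n) ℝ).toBasis
  have hdet : (boundaryCoordChange x₀ x₁ x).det
      = (LinearMap.toMatrix b b (boundaryCoordChange x₀ x₁ x).toLinearMap).det :=
    (LinearMap.det_toMatrix b _).symm
  rw [hdet]
  refine sqrt_det_gram_comp _ _ _ fun i => ?_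
  change frame (n := n) x₀ x (EuclideanSpace.single i.succ 1) = _
  rw [frame_change h₀ h₁, frame_eq_sum, Fin.sum_univ_succ,
    tangentCoordChange_tangential h₀ h₁ hb (by simp), zero_smul, zero_add]
  refine Finset.sum_congr rfl fun k _ => ?_
  rw [LinearMap.toMatrix_apply]
  simp [b, boundaryCoordChange, hyperplanePoint_single]

end Tangential

/-! ### Gradients in coordinates and the normal component of ∇ρ -/

section Gradient

variable {n : ℕ} {M : Type*} [TopologicalSpace M] [ChartedSpace (EuclideanHalfSpace (n + 1)) M]
  [IsManifold (𝓡∂ (n + 1)) ∞ M]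

/-- The components of tangent vectors at `x` in the chart around `x₀`. -/
def chartComponents (x₀ x : M) : TangentSpace (𝓡∂ (n + 1)) x →L[ℝ] Coord n :=
  mfderiv (𝓡∂ (n + 1)) 𝓘(ℝ, Coord n) (𝔠[n] x₀) x

theorem chartComponents_frame {x₀ x : M} (hx : x ∈ (𝔠[n] x₀).source) (v : Coord n) :
    chartComponents x₀ x (frame x₀ x v) = v :=
  mfderiv_extChartAt_frame hx v

theorem frame_chartComponents {x₀ x : M} (hx : x ∈ (𝔠[n] x₀).source)
    (v : TangentSpace (𝓡∂ (n + 1)) x) : frame x₀ x (chartComponents x₀ x v) = v :=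
  frame_mfderiv_extChartAt hx v

theorem chartComponents_change {x₀ x₁ x : M} (h₀ : x ∈ (𝔠[n] x₀).source)
    (h₁ : x ∈ (𝔠[n] x₁).source) (v : TangentSpace (𝓡∂ (n + 1)) x) :
    chartComponents x₁ x v
      = tangentCoordChange (𝓡∂ (n + 1)) x₀ x₁ x (chartComponents x₀ x v) := by
  conv_lhs => rw [← frame_chartComponents h₀ v, frame_change h₀ h₁]
  exact chartComponents_frame h₁ _

/-- The components of a vector field in the chart around `x₀`. -/
def coordField (x₀ : M) (X : ∀ x : M, TangentSpace (𝓡∂ (n + 1)) x) (y : Coord n) : Coord n :=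
  chartComponents x₀ ((𝔠[n] x₀).symm y) (X ((𝔠[n] x₀).symm y))

theorem frame_coordField {x₀ : M} {y : Coord n} (hy : y ∈ (𝔠[n] x₀).target)
    (X : ∀ x : M, TangentSpace (𝓡∂ (n + 1)) x) :
    frame x₀ ((𝔠[n] x₀).symm y) (coordField x₀ X y) = X ((𝔠[n] x₀).symm y) :=
  frame_mfderiv_extChartAt ((𝔠[n] x₀).map_target hy) _

theorem mfderiv_frame {f : M → ℝ} {x₀ : M} {y : Coord n} (hy : y ∈ (𝔠[n] x₀).target)
    (hf : MDifferentiableAt (𝓡∂ (n + 1)) 𝓘(ℝ, ℝ) f ((𝔠[n] x₀).symm y)) (v : Coord n) :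
    (mfderiv (𝓡∂ (n + 1)) 𝓘(ℝ, ℝ) f ((𝔠[n] x₀).symm y) (frame x₀ ((𝔠[n] x₀).symm y) v) : ℝ)
      = fderivWithin ℝ (f ∘ (𝔠[n] x₀).symm) (𝔠[n] x₀).target y v := by
  have hr : y ∈ range (𝓡∂ (n + 1)) := extChartAt_target_subset_range x₀ hy
  have h1 := mfderiv_comp_mfderivWithin (I := 𝓘(ℝ, Coord n)) (I' := 𝓡∂ (n + 1)) (I'' := 𝓘(ℝ, ℝ)) y
    hf (mdifferentiableWithinAt_extChartAt_symm (I := 𝓡∂ (n + 1)) (x := x₀) hy)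
    ((𝓡∂ (n + 1)).uniqueMDiffOn y hr)
  rw [mfderivWithin_eq_fderivWithin] at h1
  have h2 : (𝔠[n] x₀).target =ᶠ[𝓝 y] range (𝓡∂ (n + 1)) := by
    have := extChartAt_target_eventuallyEq' (I := 𝓡∂ (n + 1)) ((𝔠[n] x₀).map_target hy)
    rwa [(𝔠[n] x₀).right_inv hy] at this
  rw [fderivWithin_congr_set h2, h1, ← chartVector_eq hy]
  rfl

theorem contDiffOn_comp_extChartAt_symm {f : M → ℝ} {m : ℕ∞}
    (hf : ContMDiff (𝓡∂ (n + 1)) 𝓘(ℝ, ℝ) m f) (x₀ : M) :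
    ContDiffOn ℝ m (f ∘ (𝔠[n] x₀).symm) (𝔠[n] x₀).target := by
  have : IsManifold (𝓡∂ (n + 1)) m M := IsManifold.of_le (n := ∞) (by exact_mod_cast le_top)
  exact contMDiffOn_iff_contDiffOn.1
    (hf.comp_contMDiffOn (contMDiffOn_extChartAt_symm (I := 𝓡∂ (n + 1)) x₀))

omit [IsManifold (𝓡∂ (n + 1)) ∞ M] in
theorem continuous_of_forall_chart {f : M → ℝ}
    (h : ∀ x₀ : M, ContinuousOn (f ∘ (𝔠[n] x₀).symm) (𝔠[n] x₀).target) : Continuous f := by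
  rw [continuous_iff_continuousAt]
  intro x
  have h1 : ContinuousOn f (𝔠[n] x).source := by
    refine ((h x).comp (continuousOn_extChartAt x) fun z hz => (𝔠[n] x).map_source hz).congr
      fun z hz => ?_
    exact (congrArg f ((𝔠[n] x).left_inv hz)).symm
  exact h1.continuousAt (extChartAt_source_mem_nhds (I := 𝓡∂ (n + 1)) x)

variable [Bundle.RiemannianBundle (fun x : M => TangentSpace (𝓡∂ (n + 1)) x)]

theorem inner_grad_frame {f : M → ℝ} {x₀ : M} {y : Coord n} (hy : y ∈ (𝔠[n] x₀).target)
    (hf : MDifferentiableAt (𝓡∂ (n + 1)) 𝓘(ℝ, ℝ) f ((𝔠[n] x₀).symm y)) (v : Coord n) :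
    ⟪grad f ((𝔠[n] x₀).symm y), frame x₀ ((𝔠[n] x₀).symm y) v⟫_ℝ
      = fderivWithin ℝ (f ∘ (𝔠[n] x₀).symm) (𝔠[n] x₀).target y v := by
  rw [inner_grad, mfderiv_frame hy hf]

theorem inner_eq_fderivWithin {f : M → ℝ} {x₀ : M} {y : Coord n} (hy : y ∈ (𝔠[n] x₀).target)
    (X : ∀ x : M, TangentSpace (𝓡∂ (n + 1)) x)
    (hf : MDifferentiableAt (𝓡∂ (n + 1)) 𝓘(ℝ, ℝ) f ((𝔠[n] x₀).symm y)) :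
    ⟪X ((𝔠[n] x₀).symm y), grad f ((𝔠[n] x₀).symm y)⟫_ℝ
      = fderivWithin ℝ (f ∘ (𝔠[n] x₀).symm) (𝔠[n] x₀).target y (coordField x₀ X y) := by
  rw [real_inner_comm, ← inner_grad_frame hy hf, frame_coordField hy]

/-- The normal component of a field with normal derivative `-1` relates the densities. -/
theorem coordField_mul_volumeDensity {ρ : M → ℝ} {x₀ x : M} (hx : x ∈ (𝔠[n] x₀).source)
    (hb : x ∈ (𝓡∂ (n + 1)).boundary M) (hρ : normalDeriv n ρ x = -1) :
    coordField x₀ (grad ρ) (𝔠[n] x₀ x) 0 * volumeDensity x₀ (𝔠[n] x₀ x)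
      = surfaceDensity x₀ (tailPoint (𝔠[n] x₀ x)) := by
  have e0 := hyperplanePoint_tailPoint ((mem_boundary_iff_of_mem_source hx).1 hb)
  have hT := (𝔠[n] x₀).map_source hx
  rw [volumeDensity_eq hT, surfaceDensity_eq (by rw [e0]; exact hT), e0, coordField,
    (𝔠[n] x₀).left_inv hx]
  -- ν is the gradient of the zeroth coordinate of the chart around x₀, an inward conormal. The
  -- outward normal is defined by the chart centred at x instead; the two gradients differ by the
  -- factor κ > 0, which normalization removes.
  set ν : TangentSpace (𝓡∂ (n + 1)) x := (InnerProductSpace.toDual ℝ _).symm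
    ((EuclideanSpace.proj (𝕜 := ℝ) (0 : Fin (n + 1))).comp (chartComponents x₀ x)) with hν
  have hνv : ∀ v : TangentSpace (𝓡∂ (n + 1)) x, ⟪ν, v⟫_ℝ = chartComponents x₀ x v 0 := fun v => by
    rw [hν, InnerProductSpace.toDual_symm_apply]; rfl
  set κ := tangentCoordChange (𝓡∂ (n + 1)) x₀ x x (EuclideanSpace.single 0 1) 0 with hκ
  have hκ0 : 0 < κ := tangentCoordChange_normal_pos hx (mem_extChartAt_source x) hb
  have hgrad : grad (n := n) (fun y : M => (𝔠[n] x y : Coord n) 0) x = κ • ν := by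
    refine ext_inner_right ℝ fun v => ?_
    rw [inner_grad, real_inner_smul_left, hνv, mul_comm]
    have h1 : mfderiv (𝓡∂ (n + 1)) 𝓘(ℝ, ℝ) (fun y : M => (𝔠[n] x y : Coord n) 0) x v
        = chartComponents x x v 0 := by
      have h2 := mfderiv_comp (I := 𝓡∂ (n + 1)) (I' := 𝓘(ℝ, Coord n)) (I'' := 𝓘(ℝ, ℝ)) x
        (g := fun z : Coord n => z 0) (f := 𝔠[n] x)
        ((EuclideanSpace.proj (𝕜 := ℝ) (0 : Fin (n + 1))).differentiableAt.mdifferentiableAt)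
        (mdifferentiableAt_extChartAt (I := 𝓡∂ (n + 1)) (mem_chart_source _ x))
      have h3 : mfderiv 𝓘(ℝ, Coord n) 𝓘(ℝ, ℝ) (fun z : Coord n => z 0) (𝔠[n] x x)
          = EuclideanSpace.proj (𝕜 := ℝ) (0 : Fin (n + 1)) := by
        rw [mfderiv_eq_fderiv]
        exact (EuclideanSpace.proj (𝕜 := ℝ) (0 : Fin (n + 1))).fderiv
      rw [h3] at h2
      exact DFunLike.congr_fun h2 v
    rw [h1, chartComponents_change hx (mem_extChartAt_source x),
      tangentCoordChange_apply_zero hx (mem_extChartAt_source x) hb]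
  have hnorm : ⟪grad ρ x, ν⟫_ℝ = ‖ν‖ := by
    unfold normalDeriv outwardNormal at hρ
    rw [hgrad, norm_smul, Real.norm_of_nonneg hκ0.le, smul_smul, inner_neg_right,
      real_inner_smul_right, neg_inj, mul_inv, mul_comm κ⁻¹, mul_assoc ‖ν‖⁻¹,
      inv_mul_cancel₀ hκ0.ne', mul_one] at hρ
    have hν0 : ‖ν‖ ≠ 0 := by
      intro h; rw [h] at hρ; simp at hρ
    field_simp at hρ
    exact hρ
  have hframe : frame x₀ x (chartComponents x₀ x ν) = ν := frame_chartComponents hx ν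
  rw [frame_eq_sum] at hframe
  have h0 : ⟪ν, coordFrame x₀ x 0⟫_ℝ = 1 := by
    rw [hνv, coordFrame, chartComponents_frame hx]; simp
  have hk : ∀ k : Fin n, ⟪ν, coordFrame x₀ x k.succ⟫_ℝ = 0 := fun k => by
    rw [hνv, coordFrame, chartComponents_frame hx]; simp
  -- Since ∂ρ/∂N = -1 says ⟨∇ρ,ν⟩ = |ν|, the claim is |ν| times the volume density equals the
  -- surface density, the square root of the Gram identity.
  have hdet := inner_self_mul_det_gram (coordFrame (n := n) x₀ x) (chartComponents x₀ x ν)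
    (by rw [hframe]; exact h0) (fun k => by rw [hframe]; exact hk k)
  rw [hframe] at hdet
  rw [← hνv, real_inner_comm, hnorm, ← hdet, Real.sqrt_mul real_inner_self_nonneg,
    real_inner_self_eq_norm_sq, Real.sqrt_sq (norm_nonneg _)]

omit [IsManifold (𝓡∂ (n + 1)) ∞ M] in
theorem grad_add {f g : M → ℝ} {x : M} (hf : MDifferentiableAt (𝓡∂ (n + 1)) 𝓘(ℝ, ℝ) f x)
    (hg : MDifferentiableAt (𝓡∂ (n + 1)) 𝓘(ℝ, ℝ) g x) :
    grad (n := n) (f + g) x = grad f x + grad g x := by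
  refine ext_inner_right ℝ fun v => ?_
  rw [inner_add_left, inner_grad, inner_grad, inner_grad, mfderiv_add hf hg]
  rfl

omit [IsManifold (𝓡∂ (n + 1)) ∞ M] in
theorem grad_sub {f g : M → ℝ} {x : M} (hf : MDifferentiableAt (𝓡∂ (n + 1)) 𝓘(ℝ, ℝ) f x)
    (hg : MDifferentiableAt (𝓡∂ (n + 1)) 𝓘(ℝ, ℝ) g x) :
    grad (n := n) (f - g) x = grad f x - grad g x := by
  refine ext_inner_right ℝ fun v => ?_
  rw [inner_sub_left, inner_grad, inner_grad, inner_grad, mfderiv_sub hf hg]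
  rfl

variable [IsContMDiffRiemannianBundle (𝓡∂ (n + 1)) ∞ (EuclideanSpace ℝ (Fin (n + 1)))
      (fun x : M => TangentSpace (𝓡∂ (n + 1)) x)]

/-- In a chart |∇f|² = dᵀ adj(G) d / det G, with d the partial derivatives of f and G the Gram
matrix, all continuous up to the boundary. -/
theorem continuous_inner_self_grad {f : M → ℝ} (hf : ContMDiff (𝓡∂ (n + 1)) 𝓘(ℝ, ℝ) 1 f) :
    Continuous fun x => ⟪grad (n := n) f x, grad f x⟫_ℝ := by
  refine continuous_of_forall_chart (n := n) fun x₀ => ?_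
  set G : Coord n → Matrix (Fin (n + 1)) (Fin (n + 1)) ℝ := fun y =>
    Matrix.gram ℝ (coordFrame (n := n) x₀ ((𝔠[n] x₀).symm y)) with hG
  set d : Coord n → Fin (n + 1) → ℝ := fun y k =>
    fderivWithin ℝ (f ∘ (𝔠[n] x₀).symm) (𝔠[n] x₀).target y (EuclideanSpace.single k 1) with hd
  have hGc : ContinuousOn G (𝔠[n] x₀).target :=
    continuousOn_pi.2 fun i => continuousOn_pi.2 fun j =>
      (contDiffOn_inner_frame x₀ _ _).continuousOn
  have hdc : ContinuousOn d (𝔠[n] x₀).target := by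
    refine continuousOn_pi.2 fun k => ?_
    exact ((contDiffOn_comp_extChartAt_symm hf x₀).continuousOn_fderivWithin
      (uniqueDiffOn_extChartAt_target x₀) le_rfl).clm_apply continuousOn_const
  have hc : ContinuousOn (fun y => (d y ⬝ᵥ ((G y).adjugate.mulVec (d y))) / (G y).det)
      (𝔠[n] x₀).target := by
    refine ContinuousOn.div ?_ ?_
      fun y hy => (det_gram_coordFrame_pos ((𝔠[n] x₀).map_target hy)).ne'
    · have : Continuous fun q : Matrix (Fin (n + 1)) (Fin (n + 1)) ℝ × (Fin (n + 1) → ℝ) =>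
          q.2 ⬝ᵥ (q.1.adjugate.mulVec q.2) :=
        continuous_snd.dotProduct (continuous_fst.matrix_adjugate.matrix_mulVec continuous_snd)
      exact this.comp_continuousOn (hGc.prodMk hdc)
    · exact (continuous_id.matrix_det).comp_continuousOn hGc
  refine hc.congr fun y hy => ?_
  have hx := (𝔠[n] x₀).map_target hy
  have hdk : (fun k => ⟪grad f ((𝔠[n] x₀).symm y), coordFrame x₀ ((𝔠[n] x₀).symm y) k⟫_ℝ) = d y :=
    funext fun k => inner_grad_frame hy (hf.mdifferentiable one_ne_zero _) _
  have h := inner_self_mul_det_gram_eq (coordFrame (n := n) x₀ ((𝔠[n] x₀).symm y))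
    (chartComponents x₀ _ (grad f ((𝔠[n] x₀).symm y))) (v := grad f ((𝔠[n] x₀).symm y))
    ((frame_chartComponents hx _).symm.trans (frame_eq_sum _ _ _))
  rw [hdk] at h
  exact (eq_div_iff (det_gram_coordFrame_pos hx).ne').2 h

/-- Polarization of the previous statement. -/
theorem continuous_inner_grad {f g : M → ℝ} (hf : ContMDiff (𝓡∂ (n + 1)) 𝓘(ℝ, ℝ) 1 f)
    (hg : ContMDiff (𝓡∂ (n + 1)) 𝓘(ℝ, ℝ) 1 g) :
    Continuous fun x => ⟪grad (n := n) f x, grad g x⟫_ℝ := by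
  have h1 := continuous_inner_self_grad (hf.add hg)
  have h2 : Continuous fun x => ⟪grad (n := n) (f - g) x, grad (f - g) x⟫_ℝ :=
    continuous_inner_self_grad (hf.sub hg)
  refine ((h1.sub h2).div_const 4).congr fun x => ?_
  simp only [Pi.sub_apply]
  rw [grad_add (hf.mdifferentiable one_ne_zero x) (hg.mdifferentiable one_ne_zero x),
    grad_sub (hf.mdifferentiable one_ne_zero x) (hg.mdifferentiable one_ne_zero x)]
  simp only [inner_add_left, inner_add_right, inner_sub_left, inner_sub_right,
    real_inner_comm (grad f x) (grad g x)]
  ring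

theorem continuous_norm_grad {f : M → ℝ} (hf : ContMDiff (𝓡∂ (n + 1)) 𝓘(ℝ, ℝ) 1 f) :
    Continuous fun x => ‖grad (n := n) f x‖ := by
  refine (continuous_inner_self_grad hf).sqrt.congr fun x => ?_
  rw [real_inner_self_eq_norm_sq, Real.sqrt_sq (norm_nonneg _)]

end Gradient

/-! ### Measures given by a density in a parametrization -/

section Parametrized

variable {E X : Type*} [MeasurableSpace E] [TopologicalSpace E] [OpensMeasurableSpace E]
  {μ : Measure E} [SFinite μ] [TopologicalSpace X] [MeasurableSpace X] [BorelSpace X]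
  {S : Set E} {w : E → ℝ≥0∞} {ψ : E → X}

/-- The measure with density `w` on the set `S` in coordinates, transported by `ψ`. -/
def paramMeasure (μ : Measure E) (S : Set E) (w : E → ℝ≥0∞) (ψ : E → X) : Measure X :=
  ((μ.restrict S).withDensity w).map ψ

theorem aemeasurable_param (hS : MeasurableSet S) (hψ : ContinuousOn ψ S) :
    AEMeasurable ψ ((μ.restrict S).withDensity w) :=
  (hψ.aemeasurable hS).mono_ac (withDensity_absolutelyContinuous _ _)

theorem paramMeasure_apply (hS : MeasurableSet S) (hψ : ContinuousOn ψ S) {A : Set X}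
    (hA : MeasurableSet A) : paramMeasure μ S w ψ A = ∫⁻ y in S ∩ ψ ⁻¹' A, w y ∂μ := by
  rw [paramMeasure, Measure.map_apply_of_aemeasurable (aemeasurable_param hS hψ) hA,
    withDensity_apply', Measure.restrict_restrict' hS, inter_comm]

theorem measurableSet_inter_preimage (hS : MeasurableSet S) (hψ : ContinuousOn ψ S) {A : Set X}
    (hA : MeasurableSet A) : MeasurableSet (S ∩ ψ ⁻¹' A) := by
  have h := (continuousOn_iff_continuous_domRestrict.1 hψ).measurable hA
  have := hS.subtype_image h
  convert this using 1
  ext y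
  simp [and_comm]

theorem integral_paramMeasure {r : E → ℝ} (hS : MeasurableSet S) (hψ : ContinuousOn ψ S)
    (hr : AEMeasurable r (μ.restrict S)) (hr0 : ∀ y ∈ S, 0 ≤ r y) {h : X → ℝ}
    (hh : AEStronglyMeasurable h (paramMeasure μ S (fun y => ENNReal.ofReal (r y)) ψ)) :
    ∫ x, h x ∂(paramMeasure μ S (fun y => ENNReal.ofReal (r y)) ψ)
      = ∫ y in S, r y * h (ψ y) ∂μ := by
  rw [paramMeasure, integral_map (aemeasurable_param hS hψ) hh,
    integral_withDensity_eq_integral_toReal_smul₀ hr.ennreal_ofReal (by simp)]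
  refine setIntegral_congr_fun hS fun y hy => ?_
  simp [ENNReal.toReal_ofReal (hr0 y hy)]

theorem integrable_paramMeasure {r : E → ℝ} (hS : MeasurableSet S) (hψ : ContinuousOn ψ S)
    (hr : AEMeasurable r (μ.restrict S)) (hr0 : ∀ y ∈ S, 0 ≤ r y) {h : X → ℝ}
    (hh : Integrable h (paramMeasure μ S (fun y => ENNReal.ofReal (r y)) ψ)) :
    IntegrableOn (fun y => r y * h (ψ y)) S μ := by
  have h1 := hh.comp_aemeasurable (aemeasurable_param hS hψ)
  rw [integrable_withDensity_iff_integrable_smul₀' hr.ennreal_ofReal (by simp)] at h1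
  refine h1.congr ?_
  filter_upwards [ae_restrict_mem hS] with y hy
  simp [ENNReal.toReal_ofReal (hr0 y hy)]

theorem ae_of_ae_paramMeasure {r : E → ℝ} (hS : MeasurableSet S) (hψ : ContinuousOn ψ S)
    (hr : AEMeasurable r (μ.restrict S)) (hr0 : ∀ y ∈ S, 0 < r y) {P : X → Prop}
    (h : ∀ᵐ x ∂(paramMeasure μ S (fun y => ENNReal.ofReal (r y)) ψ), P x) :
    ∀ᵐ y ∂μ, y ∈ S → P (ψ y) := by
  have h1 := ae_of_ae_map (aemeasurable_param hS hψ) h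
  rw [ae_withDensity_iff' hr.ennreal_ofReal, ae_restrict_iff' hS] at h1
  filter_upwards [h1] with y hy hyS
  exact hy hyS (by simpa using hr0 y hyS)

theorem paramMeasure_lt_top [IsLocallyFiniteMeasure μ] {r : E → ℝ} (hS : MeasurableSet S)
    (hψ : ContinuousOn ψ S) (hr : ContinuousOn r S) {A : Set X} (hA : MeasurableSet A) {K : Set E}
    (hK : IsCompact K) (hKm : MeasurableSet K) (hKS : K ⊆ S) (hAK : S ∩ ψ ⁻¹' A ⊆ K) :
    paramMeasure μ S (fun y => ENNReal.ofReal (r y)) ψ A < ⊤ := by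
  rw [paramMeasure_apply hS hψ hA]
  refine (lintegral_mono_set hAK).trans_lt ?_
  have := ((hr.mono hKS).integrableOn_compact' hK hKm (μ := μ)).lintegral_lt_top
  exact this

end Parametrized

/-! ### Change of variables between parametrizations -/

section Overlap

variable {E X : Type*} [NormedAddCommGroup E] [NormedSpace ℝ E] [FiniteDimensional ℝ E]
  [MeasurableSpace E] [BorelSpace E] {μ : Measure E} [μ.IsAddHaarMeasure]
  [TopologicalSpace X] [MeasurableSpace X] [BorelSpace X]

/-- The transition map τ carries one coordinate preimage of A bijectively onto the other, and the
densities differ by its Jacobian. Differentiability within the set suffices, so chart points on the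
boundary are covered. -/
theorem paramMeasure_eq_of_change {S₀ S₁ : Set E} {r₀ r₁ : E → ℝ} {ψ₀ ψ₁ : E → X}
    (hS₀ : MeasurableSet S₀) (hS₁ : MeasurableSet S₁) (hψ₀ : ContinuousOn ψ₀ S₀)
    (hψ₁ : ContinuousOn ψ₁ S₁) (hi₀ : InjOn ψ₀ S₀) (hi₁ : InjOn ψ₁ S₁) {A : Set X}
    (hA : MeasurableSet A) (hA₁ : S₁ ∩ ψ₁ ⁻¹' A ⊆ ψ₁ ⁻¹' (ψ₀ '' S₀)) (τ : E → E) (τ' : E → E →L[ℝ] E)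
    (hτ : ∀ y ∈ S₀ ∩ ψ₀ ⁻¹' A, τ y ∈ S₁ ∧ ψ₁ (τ y) = ψ₀ y)
    (hτ' : ∀ y ∈ S₀ ∩ ψ₀ ⁻¹' A, HasFDerivWithinAt τ (τ' y) (S₀ ∩ ψ₀ ⁻¹' A) y)
    (hr : ∀ y ∈ S₀ ∩ ψ₀ ⁻¹' A, r₀ y = |(τ' y).det| * r₁ (τ y)) :
    paramMeasure μ S₀ (fun y => ENNReal.ofReal (r₀ y)) ψ₀ A
      = paramMeasure μ S₁ (fun y => ENNReal.ofReal (r₁ y)) ψ₁ A := by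
  rw [paramMeasure_apply hS₀ hψ₀ hA, paramMeasure_apply hS₁ hψ₁ hA]
  have himg : S₁ ∩ ψ₁ ⁻¹' A = τ '' (S₀ ∩ ψ₀ ⁻¹' A) := by
    ext z
    constructor
    · intro hz
      obtain ⟨y, hy, hyz⟩ := hA₁ hz
      have hy' : y ∈ S₀ ∩ ψ₀ ⁻¹' A := ⟨hy, by rw [mem_preimage, hyz]; exact hz.2⟩
      exact ⟨y, hy', hi₁ (hτ y hy').1 hz.1 ((hτ y hy').2.trans hyz)⟩
    · rintro ⟨y, hy, rfl⟩
      exact ⟨(hτ y hy).1, by rw [mem_preimage, (hτ y hy).2]; exact hy.2⟩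
  have hinj : InjOn τ (S₀ ∩ ψ₀ ⁻¹' A) := fun y hy z hz h =>
    hi₀ hy.1 hz.1 (by rw [← (hτ y hy).2, ← (hτ z hz).2, h])
  have hm := measurableSet_inter_preimage hS₀ hψ₀ hA
  rw [himg, lintegral_image_eq_lintegral_abs_det_fderiv_mul μ hm hτ' hinj]
  refine setLIntegral_congr_fun hm fun y hy => ?_
  rw [hr y hy, ENNReal.ofReal_mul (abs_nonneg _)]

end Overlap

/-! ### Gluing compatible measures -/

section Glue

variable {X ι : Type*} [MeasurableSpace X] {μ : ι → Measure X} {U : ι → Set X}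

/-- A compatible countable family of measures is glued by its supremum. -/
theorem iSup_restrict_eq (hU : ∀ i, MeasurableSet (U i)) (hμ : ∀ i, μ i (U i)ᶜ = 0)
    (hc : ∀ i j A, MeasurableSet A → A ⊆ U i → A ⊆ U j → μ i A = μ j A)
    (e : ℕ → ι) (he : ⋃ k, U (e k) = univ) (i : ι) : (⨆ j, μ j).restrict (U i) = μ i := by
  set D : ℕ → Set X := disjointed fun k => U (e k) with hD
  have hDm : ∀ k, MeasurableSet (D k) := fun k => MeasurableSet.disjointed (fun k => hU (e k)) k
  have hDU : ∀ k, D k ⊆ U (e k) := fun k => disjointed_subset _ k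
  have hDd : Pairwise (Function.onFun Disjoint D) := disjoint_disjointed _
  have hDe : ⋃ k, D k = univ := by rw [hD, iUnion_disjointed, he]
  have hsplit : ∀ (m : Measure X) (A : Set X), MeasurableSet A → ∑' k, m (A ∩ D k) = m A := by
    intro m A hA
    rw [← measure_iUnion (fun a b hab => (hDd hab).mono inter_subset_right inter_subset_right)
      (fun k => hA.inter (hDm k)), ← inter_iUnion, hDe, inter_univ]
  -- Patching over a disjoint refinement of the cover gives a measure that agrees with each μ i
  -- inside U i. It bounds every μ i, and each of its pieces lies below the supremum, so it is the
  -- supremum.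
  set ν : Measure X := Measure.sum fun k => (μ (e k)).restrict (D k) with hν
  have hνA : ∀ A, MeasurableSet A → ν A = ∑' k, μ (e k) (A ∩ D k) := fun A hA => by
    rw [hν, Measure.sum_apply _ hA]
    exact tsum_congr fun k => Measure.restrict_apply hA
  have hνi : ∀ (i : ι) (A : Set X), MeasurableSet A → A ⊆ U i → ν A = μ i A := by
    intro i A hA hAi
    rw [hνA A hA, ← hsplit (μ i) A hA]
    exact tsum_congr fun k => hc _ _ _ (hA.inter (hDm k)) (inter_subset_right.trans (hDU k))
      (inter_subset_left.trans hAi)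
  have hμi : ∀ (i : ι) (A : Set X), μ i (A ∩ U i) = μ i A := fun i A =>
    measure_inter_conull (hμ i)
  have hsup : ⨆ j, μ j = ν := by
    refine le_antisymm (iSup_le fun j => Measure.le_iff.2 fun A hA => ?_)
      (Measure.le_iff.2 fun A hA => ?_)
    · rw [← hμi, ← hνi j _ (hA.inter (hU j)) inter_subset_right]
      exact measure_mono inter_subset_left
    · rw [hνA A hA, ← hsplit (⨆ j, μ j) A hA]
      exact ENNReal.tsum_le_tsum fun k => Measure.le_iff'.1 (le_iSup μ (e k)) _
  ext A hA
  rw [Measure.restrict_apply hA, hsup, hνi i _ (hA.inter (hU i)) inter_subset_right, hμi]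

end Glue

/-! ### Riemannian volume and surface measure -/

section Measures

variable {n : ℕ} {M : Type*} [TopologicalSpace M] [ChartedSpace (EuclideanHalfSpace (n + 1)) M]
  [IsManifold (𝓡∂ (n + 1)) ∞ M]
  [Bundle.RiemannianBundle (fun x : M => TangentSpace (𝓡∂ (n + 1)) x)]
  [IsContMDiffRiemannianBundle (𝓡∂ (n + 1)) ∞ (EuclideanSpace ℝ (Fin (n + 1)))
      (fun x : M => TangentSpace (𝓡∂ (n + 1)) x)]
  [MeasurableSpace M] [BorelSpace M]

/-- The parametrization of the boundary in a chart. -/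
def boundaryParam (x₀ : M) (z : EuclideanSpace ℝ (Fin n)) : M := (𝔠[n] x₀).symm (hyperplanePoint z)

/-- The boundary points in the target of a chart. -/
def boundaryTarget (n : ℕ) {M : Type*} [TopologicalSpace M]
    [ChartedSpace (EuclideanHalfSpace (n + 1)) M] (x₀ : M) : Set (EuclideanSpace ℝ (Fin n)) :=
  hyperplanePoint ⁻¹' (𝔠[n] x₀).target

theorem measurableSet_source (x₀ : M) : MeasurableSet (𝔠[n] x₀).source :=
  (isOpen_extChartAt_source x₀).measurableSet

theorem measurableSet_boundaryTarget (x₀ : M) : MeasurableSet (boundaryTarget n x₀) :=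
  (contDiff_hyperplanePoint (m := 0)).continuous.measurable (measurableSet_target x₀)

theorem continuousOn_boundaryParam (x₀ : M) :
    ContinuousOn (boundaryParam (n := n) x₀) (boundaryTarget n x₀) :=
  (continuousOn_extChartAt_symm x₀).comp
    ((contDiff_hyperplanePoint (m := 0)).continuous.continuousOn) fun _ hz => hz

theorem injOn_boundaryParam (x₀ : M) : InjOn (boundaryParam (n := n) x₀) (boundaryTarget n x₀) := by
  intro z hz w hw h
  have := (𝔠[n] x₀).symm.injOn hz hw h
  simpa using congrArg tailPoint this

theorem boundaryParam_mem_boundary {x₀ : M} {z : EuclideanSpace ℝ (Fin n)}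
    (hz : z ∈ boundaryTarget n x₀) : boundaryParam (n := n) x₀ z ∈ (𝓡∂ (n + 1)).boundary M := by
  refine (mem_boundary_iff_of_mem_source ((𝔠[n] x₀).map_target hz)).2 ?_
  rw [(𝔠[n] x₀).right_inv hz]
  simp

theorem chartVolume_eq (x₀ : M) : chartVolume (n := n) x₀
    = paramMeasure volume (𝔠[n] x₀).target (fun y => ENNReal.ofReal (volumeDensity x₀ y))
      (𝔠[n] x₀).symm := rfl

theorem chartSurface_eq (x₀ : M) : chartSurface (n := n) x₀
    = paramMeasure volume (boundaryTarget n x₀) (fun y => ENNReal.ofReal (surfaceDensity x₀ y))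
      (boundaryParam x₀) := rfl

theorem aemeasurable_volumeDensity (x₀ : M) :
    AEMeasurable (volumeDensity (n := n) x₀) (volume.restrict (𝔠[n] x₀).target) :=
  (contDiffOn_volumeDensity x₀).continuousOn.aemeasurable (measurableSet_target x₀)

theorem aemeasurable_surfaceDensity (x₀ : M) :
    AEMeasurable (surfaceDensity (n := n) x₀) (volume.restrict (boundaryTarget n x₀)) :=
  (continuousOn_surfaceDensity x₀).aemeasurable (measurableSet_boundaryTarget x₀)

theorem chartVolume_compl_source (x₀ : M) : chartVolume (n := n) x₀ (𝔠[n] x₀).sourceᶜ = 0 := by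
  rw [chartVolume_eq, paramMeasure_apply (measurableSet_target x₀)
    (continuousOn_extChartAt_symm x₀) (measurableSet_source x₀).compl]
  have : (𝔠[n] x₀).target ∩ (𝔠[n] x₀).symm ⁻¹' (𝔠[n] x₀).sourceᶜ = ∅ := by
    ext y
    simp only [mem_inter_iff, mem_preimage, mem_compl_iff, mem_empty_iff_false, iff_false, not_and,
      not_not]
    exact (𝔠[n] x₀).map_target
  rw [this]; simp

theorem chartSurface_compl_source (x₀ : M) : chartSurface (n := n) x₀ (𝔠[n] x₀).sourceᶜ = 0 := by
  rw [chartSurface_eq, paramMeasure_apply (measurableSet_boundaryTarget x₀)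
    (continuousOn_boundaryParam x₀) (measurableSet_source x₀).compl]
  have : boundaryTarget n x₀ ∩ boundaryParam x₀ ⁻¹' (𝔠[n] x₀).sourceᶜ = ∅ := by
    ext y
    simp only [mem_inter_iff, mem_preimage, mem_compl_iff, mem_empty_iff_false, iff_false, not_and,
      not_not]
    exact fun h => (𝔠[n] x₀).map_target h
  rw [this]; simp

theorem chartVolume_compat (x₀ x₁ : M) {A : Set M} (hA : MeasurableSet A)
    (h₀ : A ⊆ (𝔠[n] x₀).source) (h₁ : A ⊆ (𝔠[n] x₁).source) :
    chartVolume (n := n) x₀ A = chartVolume (n := n) x₁ A := by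
  rw [chartVolume_eq, chartVolume_eq]
  refine paramMeasure_eq_of_change (measurableSet_target x₀) (measurableSet_target x₁)
    (continuousOn_extChartAt_symm x₀) (continuousOn_extChartAt_symm x₁) (𝔠[n] x₀).symm.injOn
    (𝔠[n] x₁).symm.injOn hA ?_ (fun y => 𝔠[n] x₁ ((𝔠[n] x₀).symm y))
    (fun y => tangentCoordChange (𝓡∂ (n + 1)) x₀ x₁ ((𝔠[n] x₀).symm y)) ?_ ?_ ?_
  · intro z hz
    exact ⟨𝔠[n] x₀ ((𝔠[n] x₁).symm z), (𝔠[n] x₀).map_source (h₀ hz.2),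
      (𝔠[n] x₀).left_inv (h₀ hz.2)⟩
  · exact fun y hy => ⟨(𝔠[n] x₁).map_source (h₁ hy.2), (𝔠[n] x₁).left_inv (h₁ hy.2)⟩
  · intro y hy
    have h := hasFDerivWithinAt_tangentCoordChange (I := 𝓡∂ (n + 1)) (x := x₀) (y := x₁)
      ⟨(𝔠[n] x₀).map_target hy.1, h₁ hy.2⟩
    rw [(𝔠[n] x₀).right_inv hy.1] at h
    exact h.mono (inter_subset_left.trans (extChartAt_target_subset_range x₀))
  · intro y hy
    rw [← volumeDensity_change ((𝔠[n] x₀).map_target hy.1) (h₁ hy.2), (𝔠[n] x₀).right_inv hy.1]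

theorem chartSurface_compat (x₀ x₁ : M) {A : Set M} (hA : MeasurableSet A)
    (h₀ : A ⊆ (𝔠[n] x₀).source) (h₁ : A ⊆ (𝔠[n] x₁).source) :
    chartSurface (n := n) x₀ A = chartSurface (n := n) x₁ A := by
  rw [chartSurface_eq, chartSurface_eq]
  have key : ∀ {a b : M} {z : EuclideanSpace ℝ (Fin n)}, z ∈ boundaryTarget n a →
      boundaryParam a z ∈ (𝔠[n] b).source →
      tailPoint (𝔠[n] b (boundaryParam a z)) ∈ boundaryTarget n b ∧
        boundaryParam b (tailPoint (𝔠[n] b (boundaryParam a z))) = boundaryParam a z := by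
    intro a b z hz hb
    have e := hyperplanePoint_tailPoint ((mem_boundary_iff_of_mem_source hb).1
      (boundaryParam_mem_boundary hz))
    constructor
    · rw [boundaryTarget, mem_preimage, e]; exact (𝔠[n] b).map_source hb
    · rw [boundaryParam, e, (𝔠[n] b).left_inv hb]
  refine paramMeasure_eq_of_change (measurableSet_boundaryTarget x₀)
    (measurableSet_boundaryTarget x₁) (continuousOn_boundaryParam x₀)
    (continuousOn_boundaryParam x₁) (injOn_boundaryParam x₀) (injOn_boundaryParam x₁) hA ?_
    (fun z => tailPoint (𝔠[n] x₁ (boundaryParam x₀ z)))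
    (fun z => boundaryCoordChange x₀ x₁ (boundaryParam x₀ z)) ?_ ?_ ?_
  · intro z hz
    exact ⟨_, (key hz.1 (h₀ hz.2)).1, (key hz.1 (h₀ hz.2)).2⟩
  · exact fun y hy => key hy.1 (h₁ hy.2)
  · exact fun y hy => hasFDerivWithinAt_boundaryCoordChange hy.1 (h₁ hy.2) _
  · intro y hy
    have h := surfaceDensity_change ((𝔠[n] x₀).map_target hy.1) (h₁ hy.2)
      (boundaryParam_mem_boundary hy.1)
    rw [(𝔠[n] x₀).right_inv hy.1, tailPoint_hyperplanePoint] at h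
    exact h

variable [CompactSpace M]

theorem exists_seq_source_cover [Nonempty M] :
    ∃ e : ℕ → M, ⋃ k, (𝔠[n] (e k)).source = univ := by
  obtain ⟨t, -, ht⟩ := isCompact_univ.elim_nhds_subcover (fun x : M => (𝔠[n] x).source)
    fun x _ => extChartAt_source_mem_nhds x
  have hne : (t : Set M).Nonempty := by
    obtain ⟨x⟩ := ‹Nonempty M›
    obtain ⟨i, hi, -⟩ := mem_iUnion₂.1 (ht (mem_univ x))
    exact ⟨i, hi⟩
  obtain ⟨e, he⟩ := t.countable_toSet.exists_eq_range hne
  refine ⟨e, eq_univ_of_univ_subset (ht.trans ?_)⟩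
  intro x hx
  obtain ⟨i, hi, hxi⟩ := mem_iUnion₂.1 hx
  have : i ∈ range e := he ▸ hi
  obtain ⟨k, rfl⟩ := this
  exact mem_iUnion.2 ⟨k, hxi⟩

/-- Compactness supplies a countable chart cover, as required for gluing. From here on, integrals of
functions supported in a chart are computed in that chart alone. -/
theorem riemVolume_restrict_source (x₀ : M) :
    (riemVolume n M).restrict (𝔠[n] x₀).source = chartVolume (n := n) x₀ := by
  have : Nonempty M := ⟨x₀⟩
  obtain ⟨e, he⟩ := exists_seq_source_cover (n := n) (M := M)
  exact iSup_restrict_eq (fun i => measurableSet_source i) chartVolume_compl_source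
    (fun i j A hA => chartVolume_compat i j hA) e he x₀

theorem riemSurface_restrict_source (x₀ : M) :
    (riemSurface n M).restrict (𝔠[n] x₀).source = chartSurface (n := n) x₀ := by
  have : Nonempty M := ⟨x₀⟩
  obtain ⟨e, he⟩ := exists_seq_source_cover (n := n) (M := M)
  exact iSup_restrict_eq (fun i => measurableSet_source i) chartSurface_compl_source
    (fun i j A hA => chartSurface_compat i j hA) e he x₀

/-- The volume integral of a function supported in a chart. -/
theorem integral_riemVolume {x₀ : M} {h : M → ℝ}
    (hh : AEStronglyMeasurable h (riemVolume n M))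
    (h0 : ∀ x ∉ (𝔠[n] x₀).source, h x = 0) :
    ∫ x, h x ∂(riemVolume n M)
      = ∫ y in (𝔠[n] x₀).target, volumeDensity x₀ y * h ((𝔠[n] x₀).symm y) := by
  rw [← setIntegral_eq_integral_of_forall_compl_eq_zero h0, riemVolume_restrict_source,
    chartVolume_eq, integral_paramMeasure (measurableSet_target x₀)
    (continuousOn_extChartAt_symm x₀) (aemeasurable_volumeDensity x₀)
    (fun y hy => (volumeDensity_pos hy).le)
    (by rw [← chartVolume_eq, ← riemVolume_restrict_source]; exact hh.restrict)]

theorem integral_riemSurface {x₀ : M} {h : M → ℝ}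
    (hh : AEStronglyMeasurable h (riemSurface n M))
    (h0 : ∀ x ∉ (𝔠[n] x₀).source, h x = 0) :
    ∫ x, h x ∂(riemSurface n M)
      = ∫ z in boundaryTarget n x₀, surfaceDensity x₀ z * h (boundaryParam x₀ z) := by
  rw [← setIntegral_eq_integral_of_forall_compl_eq_zero h0, riemSurface_restrict_source,
    chartSurface_eq, integral_paramMeasure (measurableSet_boundaryTarget x₀)
    (continuousOn_boundaryParam x₀) (aemeasurable_surfaceDensity x₀)
    (fun y _ => Real.sqrt_nonneg _)
    (by rw [← chartSurface_eq, ← riemSurface_restrict_source]; exact hh.restrict)]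

theorem integrableOn_chart_of_integrable {h : M → ℝ} {s : Set M} {x₀ : M}
    (hh : IntegrableOn h s (riemVolume n M)) (hsm : MeasurableSet s) :
    IntegrableOn (fun y => volumeDensity x₀ y * h ((𝔠[n] x₀).symm y))
      ((𝔠[n] x₀).target ∩ (𝔠[n] x₀).symm ⁻¹' s) := by
  have h1 : Integrable (s.indicator h) (chartVolume (n := n) x₀) := by
    rw [← riemVolume_restrict_source]
    exact ((integrable_indicator_iff hsm).2 hh).restrict
  rw [chartVolume_eq] at h1
  have h2 := integrable_paramMeasure (measurableSet_target x₀) (continuousOn_extChartAt_symm x₀)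
    (aemeasurable_volumeDensity x₀) (fun y hy => (volumeDensity_pos hy).le) h1
  refine (h2.mono_set inter_subset_left).congr_fun (fun y hy => ?_)
    (measurableSet_inter_preimage (measurableSet_target x₀) (continuousOn_extChartAt_symm x₀) hsm)
  simp only
  rw [indicator_of_mem (by exact hy.2)]

theorem ae_chart_of_ae_riemVolume {P : M → Prop} (h : ∀ᵐ x ∂(riemVolume n M), P x) (x₀ : M) :
    ∀ᵐ y : Coord n, y ∈ (𝔠[n] x₀).target → P ((𝔠[n] x₀).symm y) := by
  have h1 := ae_restrict_of_ae (s := (𝔠[n] x₀).source) h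
  rw [riemVolume_restrict_source, chartVolume_eq] at h1
  exact ae_of_ae_paramMeasure (measurableSet_target x₀) (continuousOn_extChartAt_symm x₀)
    (aemeasurable_volumeDensity x₀) (fun y hy => volumeDensity_pos hy) h1

/-- A continuous function vanishing almost everywhere vanishes. -/
theorem eq_zero_of_ae_riemVolume {f : M → ℝ} (hf : Continuous f)
    (h : ∀ᵐ x ∂(riemVolume n M), f x = 0) : f = 0 := by
  funext x
  have h1 := ae_chart_of_ae_riemVolume h x
  set T := (𝔠[n] x).target with hT
  have hfc : ContinuousOn (f ∘ (𝔠[n] x).symm) T := hf.comp_continuousOn (continuousOn_extChartAt_symm x)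
  -- Lebesgue measure charges every nonempty open set and the volume density is positive; the
  -- boundary points follow by density of the interior.
  have h2 : EqOn (f ∘ (𝔠[n] x).symm) 0 (interior T) := by
    refine Measure.eqOn_open_of_ae_eq (μ := volume) ?_ isOpen_interior
      (hfc.mono interior_subset) continuousOn_const
    rw [Filter.EventuallyEq, ae_restrict_iff' isOpen_interior.measurableSet]
    filter_upwards [h1] with y hy hyT
    exact hy (interior_subset hyT)
  have h3 : EqOn (f ∘ (𝔠[n] x).symm) 0 T :=
    h2.of_subset_closure hfc continuousOn_const interior_subset
      (target_subset_closure_interior x)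
  have h4 := h3 ((𝔠[n] x).map_source (mem_extChartAt_source x))
  rwa [Function.comp_apply, (𝔠[n] x).left_inv (mem_extChartAt_source x)] at h4

theorem exists_isCompact_mem_nhds_subset_source (x : M) :
    ∃ K ∈ 𝓝 x, IsCompact K ∧ K ⊆ (𝔠[n] x).source := by
  have : LocallyCompactSpace M := Manifold.locallyCompact_of_finiteDimensional (𝓡∂ (n + 1))
  obtain ⟨K, hK, hKs, hKc⟩ := local_compact_nhds (extChartAt_source_mem_nhds (I := 𝓡∂ (n + 1)) x)
  exact ⟨K, hK, hKc, hKs⟩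

/-- Each point has a neighbourhood with compact closure inside a chart, where the continuous density
is integrable; compactness of M finishes. -/
instance isFiniteMeasure_riemVolume : IsFiniteMeasure (riemVolume n M) := by
  refine ⟨isCompact_univ.measure_lt_top_of_nhdsWithin fun x _ => ?_⟩
  rw [nhdsWithin_univ]
  obtain ⟨K, hK, hKc, hKs⟩ := exists_isCompact_mem_nhds_subset_source (n := n) x
  obtain ⟨V, hVK, hVo, hxV⟩ := mem_nhds_iff.1 hK
  refine ⟨V, hVo.mem_nhds hxV, ?_⟩
  have hV : riemVolume n M V = chartVolume (n := n) x V := by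
    rw [← riemVolume_restrict_source, Measure.restrict_apply hVo.measurableSet,
      inter_eq_left.2 (hVK.trans hKs)]
  rw [hV, chartVolume_eq]
  have hc := hKc.image_of_continuousOn ((continuousOn_extChartAt x).mono hKs)
  refine paramMeasure_lt_top (measurableSet_target x) (continuousOn_extChartAt_symm x)
    (contDiffOn_volumeDensity x).continuousOn hVo.measurableSet hc hc.measurableSet ?_ ?_
  · rintro _ ⟨y, hy, rfl⟩
    exact (𝔠[n] x).map_source (hKs hy)
  · exact fun y hy => ⟨_, hVK hy.2, (𝔠[n] x).right_inv hy.1⟩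

instance isFiniteMeasure_riemSurface : IsFiniteMeasure (riemSurface n M) := by
  refine ⟨isCompact_univ.measure_lt_top_of_nhdsWithin fun x _ => ?_⟩
  rw [nhdsWithin_univ]
  obtain ⟨K, hK, hKc, hKs⟩ := exists_isCompact_mem_nhds_subset_source (n := n) x
  obtain ⟨V, hVK, hVo, hxV⟩ := mem_nhds_iff.1 hK
  refine ⟨V, hVo.mem_nhds hxV, ?_⟩
  have hV : riemSurface n M V = chartSurface (n := n) x V := by
    rw [← riemSurface_restrict_source, Measure.restrict_apply hVo.measurableSet,
      inter_eq_left.2 (hVK.trans hKs)]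
  rw [hV, chartSurface_eq]
  have hcl : IsClosed {y : Coord n | y 0 = 0} :=
    isClosed_eq continuous_coord_zero continuous_const
  have hc := ((hKc.image_of_continuousOn ((continuousOn_extChartAt x).mono hKs)).inter_right
    hcl).image (contDiff_tailPoint (m := 0)).continuous
  refine paramMeasure_lt_top (measurableSet_boundaryTarget x) (continuousOn_boundaryParam x)
    (continuousOn_surfaceDensity x) hVo.measurableSet hc hc.measurableSet ?_ ?_
  · rintro _ ⟨_, ⟨⟨y, hy, rfl⟩, h0⟩, rfl⟩
    rw [boundaryTarget, mem_preimage, hyperplanePoint_tailPoint h0]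
    exact (𝔠[n] x).map_source (hKs hy)
  · exact fun z hz => ⟨hyperplanePoint z, ⟨⟨_, hVK hz.2, (𝔠[n] x).right_inv hz.1⟩, by simp⟩, by simp⟩

end Measures

theorem LocallyLipschitzOn.smul_real {E F : Type*} [PseudoEMetricSpace E] [NormedAddCommGroup F]
    [NormedSpace ℝ F] {f : E → ℝ} {g : E → F} {s : Set E} (hf : LocallyLipschitzOn s f)
    (hg : LocallyLipschitzOn s g) : LocallyLipschitzOn s (fun x => f x • g x) := by
  intro x hx
  obtain ⟨C, t, ht, hC⟩ := hf hx
  obtain ⟨D, t', ht', hD⟩ := hg hx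
  obtain ⟨K, r, hr, hK⟩ := (contDiff_smul (n := 1) (𝕜 := ℝ) (F := F)).locallyLipschitz (f x, g x)
  have hpre : (fun y => (f y, g y)) ⁻¹' r ∈ 𝓝[s] x :=
    ((hf.continuousOn x hx).prodMk (hg.continuousOn x hx)) hr
  exact ⟨K * max C D, t ∩ t' ∩ (fun y => (f y, g y)) ⁻¹' r,
    inter_mem (inter_mem ht ht') hpre,
    hK.comp ((hC.mono fun y hy => hy.1.1).prodMk (hD.mono fun y hy => hy.1.2)) fun y hy => hy.2⟩

/-! ### Localization in charts and the weak Laplacian -/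

section Localization

variable {n : ℕ} {M : Type*} [TopologicalSpace M] [T2Space M] [CompactSpace M]
  [ChartedSpace (EuclideanHalfSpace (n + 1)) M] [IsManifold (𝓡∂ (n + 1)) ∞ M]

/-- The coordinate expression of a function supported in a chart. -/
def pullback (x₀ : M) (φ : M → ℝ) : Coord n → ℝ :=
  indicator (𝔠[n] x₀).target (φ ∘ (𝔠[n] x₀).symm)

theorem pullback_of_mem {x₀ : M} (φ : M → ℝ) {y : Coord n} (hy : y ∈ (𝔠[n] x₀).target) :
    pullback x₀ φ y = φ ((𝔠[n] x₀).symm y) := indicator_of_mem hy _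

theorem pullback_of_notMem {x₀ : M} (φ : M → ℝ) {y : Coord n} (hy : y ∉ (𝔠[n] x₀).target) :
    pullback x₀ φ y = 0 := indicator_of_notMem hy _

theorem isCompact_image_tsupport {x₀ : M} {φ : M → ℝ} (hs : tsupport φ ⊆ (𝔠[n] x₀).source) :
    IsCompact (𝔠[n] x₀ '' tsupport φ) :=
  (isClosed_tsupport φ).isCompact.image_of_continuousOn ((continuousOn_extChartAt x₀).mono hs)

theorem image_tsupport_subset_target {x₀ : M} {φ : M → ℝ}
    (hs : tsupport φ ⊆ (𝔠[n] x₀).source) : 𝔠[n] x₀ '' tsupport φ ⊆ (𝔠[n] x₀).target := by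
  rintro _ ⟨x, hx, rfl⟩
  exact (𝔠[n] x₀).map_source (hs hx)

theorem pullback_eq_zero {x₀ : M} {φ : M → ℝ} {y : Coord n} (hy : y ∉ 𝔠[n] x₀ '' tsupport φ) :
    pullback x₀ φ y = 0 := by
  by_cases h : y ∈ (𝔠[n] x₀).target
  · rw [pullback_of_mem φ h]
    by_contra h0
    exact hy ⟨_, subset_tsupport _ h0, (𝔠[n] x₀).right_inv h⟩
  · exact indicator_of_notMem h _

theorem tsupport_pullback_subset {x₀ : M} {φ : M → ℝ} (hs : tsupport φ ⊆ (𝔠[n] x₀).source) :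
    tsupport (pullback (n := n) x₀ φ) ⊆ 𝔠[n] x₀ '' tsupport φ := by
  refine closure_minimal (fun y hy => ?_) (isCompact_image_tsupport hs).isClosed
  by_contra h
  exact hy (pullback_eq_zero h)

theorem hasCompactSupport_pullback {x₀ : M} {φ : M → ℝ} (hs : tsupport φ ⊆ (𝔠[n] x₀).source) :
    HasCompactSupport (pullback (n := n) x₀ φ) :=
  (isCompact_image_tsupport hs).of_isClosed_subset (isClosed_tsupport _)
    (tsupport_pullback_subset hs)

theorem pullback_eventuallyEq {x₀ : M} (φ : M → ℝ) {y : Coord n}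
    (hy : y ∈ interior (𝔠[n] x₀).target) : pullback x₀ φ =ᶠ[𝓝 y] φ ∘ (𝔠[n] x₀).symm := by
  filter_upwards [isOpen_interior.mem_nhds hy] with z hz
  exact pullback_of_mem φ (interior_subset hz)

theorem contDiffAt_pullback {x₀ : M} {φ : M → ℝ} {m : ℕ∞}
    (hφ : ContMDiff (𝓡∂ (n + 1)) 𝓘(ℝ, ℝ) m φ) {y : Coord n}
    (hy : y ∈ interior (𝔠[n] x₀).target) : ContDiffAt ℝ m (pullback x₀ φ) y :=
  ((contDiffOn_comp_extChartAt_symm hφ x₀).contDiffAt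
    (mem_interior_iff_mem_nhds.1 hy)).congr_of_eventuallyEq (pullback_eventuallyEq φ hy)

theorem fderivWithin_eq_fderiv_pullback {x₀ : M} (φ : M → ℝ) {y : Coord n}
    (hy : y ∈ interior (𝔠[n] x₀).target) :
    fderivWithin ℝ (φ ∘ (𝔠[n] x₀).symm) (𝔠[n] x₀).target y = fderiv ℝ (pullback x₀ φ) y := by
  rw [fderivWithin_of_mem_nhds (mem_interior_iff_mem_nhds.1 hy), (pullback_eventuallyEq φ hy).fderiv_eq]

theorem image_tsupport_subset_interior {x₀ : M} {φ : M → ℝ}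
    (hs : tsupport φ ⊆ (𝔠[n] x₀).source) (hi : tsupport φ ⊆ (𝓡∂ (n + 1)).interior M) :
    𝔠[n] x₀ '' tsupport φ ⊆ interior (𝔠[n] x₀).target := by
  rintro _ ⟨x, hx, rfl⟩
  rw [interior_target]
  exact ⟨(𝔠[n] x₀).map_source (hs hx), (mem_interior_iff_of_mem_source (hs hx)).1 (hi hx)⟩

/-- A function on the manifold from a function in coordinates. -/
def pushforward (x₀ : M) (ψ : Coord n → ℝ) : M → ℝ :=
  indicator (𝔠[n] x₀).source (ψ ∘ 𝔠[n] x₀)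

theorem pushforward_symm {x₀ : M} (ψ : Coord n → ℝ) {y : Coord n} (hy : y ∈ (𝔠[n] x₀).target) :
    pushforward x₀ ψ ((𝔠[n] x₀).symm y) = ψ y := by
  rw [pushforward, indicator_of_mem ((𝔠[n] x₀).map_target hy), Function.comp_apply,
    (𝔠[n] x₀).right_inv hy]

theorem tsupport_pushforward_subset {x₀ : M} {ψ : Coord n → ℝ} (hc : HasCompactSupport ψ)
    (hs : tsupport ψ ⊆ (𝔠[n] x₀).target) :
    tsupport (pushforward x₀ ψ) ⊆ (𝔠[n] x₀).symm '' tsupport ψ := by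
  refine closure_minimal (fun x hx => ?_) (hc.isCompact.image_of_continuousOn
    ((continuousOn_extChartAt_symm x₀).mono hs)).isClosed
  have hxs : x ∈ (𝔠[n] x₀).source := by
    by_contra h
    exact hx (indicator_of_notMem h _)
  refine ⟨𝔠[n] x₀ x, subset_tsupport _ fun h => hx ?_, (𝔠[n] x₀).left_inv hxs⟩
  rw [pushforward, indicator_of_mem hxs]; exact h

theorem contMDiff_pushforward {x₀ : M} {ψ : Coord n → ℝ} {m : ℕ∞} (hψ : ContDiff ℝ m ψ)
    (hc : HasCompactSupport ψ) (hs : tsupport ψ ⊆ (𝔠[n] x₀).target) :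
    ContMDiff (𝓡∂ (n + 1)) 𝓘(ℝ, ℝ) m (pushforward x₀ ψ) := by
  have : IsManifold (𝓡∂ (n + 1)) m M := IsManifold.of_le (n := ∞) (by exact_mod_cast le_top)
  refine contMDiff_of_tsupport fun x hx => ?_
  obtain ⟨y, hy, rfl⟩ := tsupport_pushforward_subset hc hs hx
  have hx := (𝔠[n] x₀).map_target (hs hy)
  have h1 : ContMDiffAt (𝓡∂ (n + 1)) 𝓘(ℝ, ℝ) m (ψ ∘ 𝔠[n] x₀) ((𝔠[n] x₀).symm y) :=
    hψ.contMDiff.contMDiffAt.comp _ (contMDiffAt_extChartAt' (by rwa [extChartAt_source] at hx))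
  refine h1.congr_of_eventuallyEq ?_
  filter_upwards [(isOpen_extChartAt_source x₀).mem_nhds hx] with z hz
  exact indicator_of_mem hz _

/-- A finite smooth partition of unity subordinate to the charts. -/
theorem exists_partitionOfUnity (n : ℕ) (M : Type*) [TopologicalSpace M] [T2Space M]
    [CompactSpace M] [ChartedSpace (EuclideanHalfSpace (n + 1)) M] [IsManifold (𝓡∂ (n + 1)) ∞ M] :
    ∃ (t : Finset M) (χ : t → M → ℝ), (∀ i, ContMDiff (𝓡∂ (n + 1)) 𝓘(ℝ, ℝ) ∞ (χ i)) ∧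
      (∀ i x, 0 ≤ χ i x) ∧ (∀ i : t, tsupport (χ i) ⊆ (𝔠[n] (i : M)).source) ∧
      ∀ x, ∑ i, χ i x = 1 := by
  obtain ⟨t, -, ht⟩ := isCompact_univ.elim_nhds_subcover (fun x : M => (𝔠[n] x).source)
    fun x _ => extChartAt_source_mem_nhds x
  obtain ⟨f, hf⟩ := SmoothPartitionOfUnity.exists_isSubordinate (𝓡∂ (n + 1)) (M := M)
    (s := univ) isClosed_univ (fun i : t => (𝔠[n] (i : M)).source)
    (fun i => isOpen_extChartAt_source _) (by
      intro x hx
      obtain ⟨i, hi, hxi⟩ := mem_iUnion₂.1 (ht hx)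
      exact mem_iUnion.2 ⟨⟨i, hi⟩, hxi⟩)
  refine ⟨t, fun i => f i, fun i => (f i).contMDiff, fun i x => f.nonneg i x, hf, fun x => ?_⟩
  rw [← finsum_eq_sum_of_fintype]
  exact f.sum_eq_one (mem_univ x)

variable [Bundle.RiemannianBundle (fun x : M => TangentSpace (𝓡∂ (n + 1)) x)]

theorem grad_zero_of_notMem_tsupport {φ : M → ℝ} {x : M} (hx : x ∉ tsupport φ) :
    grad (n := n) φ x = 0 := by
  have h : φ =ᶠ[𝓝 x] fun _ => 0 := notMem_tsupport_iff_eventuallyEq.1 hx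
  refine ext_inner_right ℝ fun v => ?_
  rw [inner_grad, h.mfderiv_eq, mfderiv_const, inner_zero_left]
  rfl

theorem grad_sum {ι : Type*} (s : Finset ι) {φ : ι → M → ℝ} {x : M}
    (h : ∀ i ∈ s, MDifferentiableAt (𝓡∂ (n + 1)) 𝓘(ℝ, ℝ) (φ i) x) :
    grad (n := n) (fun x => ∑ i ∈ s, φ i x) x = ∑ i ∈ s, grad (φ i) x := by
  have key : ∀ s : Finset ι, (∀ i ∈ s, MDifferentiableAt (𝓡∂ (n + 1)) 𝓘(ℝ, ℝ) (φ i) x) →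
      MDifferentiableAt (𝓡∂ (n + 1)) 𝓘(ℝ, ℝ) (fun x => ∑ i ∈ s, φ i x) x ∧
      grad (n := n) (fun x => ∑ i ∈ s, φ i x) x = ∑ i ∈ s, grad (φ i) x := by
    classical
    intro s
    induction s using Finset.induction_on with
    | empty =>
      intro _
      refine ⟨by simpa using mdifferentiableAt_const, ?_⟩
      simp only [Finset.sum_empty]
      refine grad_zero_of_notMem_tsupport ?_
      simp [tsupport, Function.support_fun_zero]
    | insert a s ha ih =>
      intro h
      obtain ⟨h1, h2⟩ := ih fun i hi => h i (Finset.mem_insert_of_mem hi)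
      have e : (fun x => ∑ i ∈ insert a s, φ i x) = φ a + fun x => ∑ i ∈ s, φ i x := by
        funext x; simp [Finset.sum_insert ha]
      rw [e, Finset.sum_insert ha, ← h2]
      exact ⟨(h a (Finset.mem_insert_self _ _)).add h1,
        grad_add (h a (Finset.mem_insert_self _ _)) h1⟩
  exact (key s h).2

/-- The components of a vector field multiplied by the volume density. -/
def densityField (x₀ : M) (X : ∀ x : M, TangentSpace (𝓡∂ (n + 1)) x) (y : Coord n) : Coord n :=
  volumeDensity x₀ y • coordField x₀ X y

variable [IsContMDiffRiemannianBundle (𝓡∂ (n + 1)) ∞ (EuclideanSpace ℝ (Fin (n + 1)))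
      (fun x : M => TangentSpace (𝓡∂ (n + 1)) x)]
variable {X : ∀ x : M, TangentSpace (𝓡∂ (n + 1)) x}

theorem locallyLipschitzOn_densityField (hX : IsLipschitzField X) (x₀ : M) :
    LocallyLipschitzOn (interior (𝔠[n] x₀).target) (densityField x₀ X) := by
  refine LocallyLipschitzOn.smul_real (fun y hy => ?_) ((hX x₀).mono interior_subset)
  obtain ⟨K, t, ht, h⟩ := (((contDiffOn_volumeDensity x₀).contDiffAt
    (mem_interior_iff_mem_nhds.1 hy)).of_le (m := 1) (by exact_mod_cast le_top)).exists_lipschitzOnWith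
  exact ⟨K, t, mem_nhdsWithin_of_mem_nhds ht, h⟩

theorem continuousOn_densityField (hX : IsLipschitzField X) (x₀ : M) :
    ContinuousOn (densityField x₀ X) (𝔠[n] x₀).target :=
  (contDiffOn_volumeDensity x₀).continuousOn.smul (hX x₀).continuousOn

/-- Pairing with a gradient is applying the differential, so the metric survives in coordinates only
through the density absorbed in the field. -/
theorem volumeDensity_mul_inner_grad {x₀ : M} {φ : M → ℝ}
    (hφ : ContMDiff (𝓡∂ (n + 1)) 𝓘(ℝ, ℝ) 1 φ) {y : Coord n}
    (hy : y ∈ interior (𝔠[n] x₀).target) :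
    volumeDensity x₀ y * ⟪X ((𝔠[n] x₀).symm y), grad φ ((𝔠[n] x₀).symm y)⟫_ℝ
      = fderiv ℝ (pullback x₀ φ) y (densityField x₀ X y) := by
  rw [inner_eq_fderivWithin (interior_subset hy) X (hφ.mdifferentiable one_ne_zero _),
    fderivWithin_eq_fderiv_pullback φ hy, densityField, map_smul, smul_eq_mul]

variable [MeasurableSpace M] [BorelSpace M]

theorem integral_riemVolume_interior {x₀ : M} {h : M → ℝ}
    (hh : AEStronglyMeasurable h (riemVolume n M)) (h0 : ∀ x ∉ (𝔠[n] x₀).source, h x = 0) :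
    ∫ x, h x ∂(riemVolume n M)
      = ∫ y in interior (𝔠[n] x₀).target, volumeDensity x₀ y * h ((𝔠[n] x₀).symm y) := by
  rw [integral_riemVolume hh h0, setIntegral_congr_set (target_ae_eq_interior x₀)]

/-- Green's formula for test functions supported in the interior of a chart. -/
theorem integral_inner_grad_of_tsupport_subset {ρ φ : M → ℝ}
    (hρ : ContMDiff (𝓡∂ (n + 1)) 𝓘(ℝ, ℝ) 1 ρ) (hX : IsLipschitzField (n := n) (grad ρ))
    (hφ : ContMDiff (𝓡∂ (n + 1)) 𝓘(ℝ, ℝ) 1 φ) {x₀ : M} (hs : tsupport φ ⊆ (𝔠[n] x₀).source)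
    (hi : tsupport φ ⊆ (𝓡∂ (n + 1)).interior M) :
    ∫ x, ⟪grad (n := n) ρ x, grad φ x⟫_ℝ ∂(riemVolume n M)
      = -∫ y in interior (𝔠[n] x₀).target,
          φ ((𝔠[n] x₀).symm y) * coordDiv (densityField x₀ (grad ρ)) y := by
  rw [integral_riemVolume_interior (continuous_inner_grad hρ hφ).aestronglyMeasurable (x₀ := x₀)
    fun x hx => by rw [grad_zero_of_notMem_tsupport fun h => hx (hs h), inner_zero_right]]
  rw [setIntegral_congr_fun isOpen_interior.measurableSet
    (fun y hy => volumeDensity_mul_inner_grad hφ hy)]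
  have hsub := (tsupport_pullback_subset hs).trans (image_tsupport_subset_interior hs hi)
  have hζ : ContDiff ℝ 1 (pullback (n := n) x₀ φ) :=
    contDiff_of_tsupport fun y hy => contDiffAt_pullback (m := 1) hφ (hsub hy)
  have h1 := integral_fderiv_add_coordDiv isOpen_interior (locallyLipschitzOn_densityField hX x₀)
    hζ (hasCompactSupport_pullback hs) hsub
  rw [setIntegral_eq_integral_of_forall_compl_eq_zero, h1]
  · congr 1
    rw [← setIntegral_eq_integral_of_forall_compl_eq_zero (s := interior (𝔠[n] x₀).target)]
    · refine setIntegral_congr_fun isOpen_interior.measurableSet fun y hy => ?_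
      rw [pullback_of_mem φ (interior_subset hy)]
    · intro y hy
      rw [image_eq_zero_of_notMem_tsupport fun h => hy (hsub h), zero_mul]
  · intro y hy
    rw [fderiv_of_notMem_tsupport (𝕜 := ℝ) fun h => hy (hsub h)]
    rfl

/-- Coordinate test functions extend by zero to test functions on M, so both sides have the same
integrals against them; the fundamental lemma of the calculus of variations gives equality almost
everywhere. -/
theorem IsWeakLaplacian.coordDiv_ae {ρ L : M → ℝ} (hρ : ContMDiff (𝓡∂ (n + 1)) 𝓘(ℝ, ℝ) 1 ρ)
    (hX : IsLipschitzField (n := n) (grad ρ)) (hL : IsWeakLaplacian (n := n) ρ L) (x₀ : M) :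
    ∀ᵐ y : Coord n, y ∈ interior (𝔠[n] x₀).target →
      volumeDensity x₀ y * L ((𝔠[n] x₀).symm y) = coordDiv (densityField x₀ (grad ρ)) y := by
  set U := interior (𝔠[n] x₀).target with hU
  have hint : LocallyIntegrableOn
      (fun y : Coord n => volumeDensity x₀ y * L ((𝔠[n] x₀).symm y)) U := by
    intro y hy
    have hyT := interior_subset hy
    have hx : (𝔠[n] x₀).symm y ∈ (𝓡∂ (n + 1)).interior M := by
      rw [mem_interior_iff_of_mem_source ((𝔠[n] x₀).map_target hyT), (𝔠[n] x₀).right_inv hyT]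
      rw [hU, interior_target] at hy
      exact hy.2
    obtain ⟨s, hs, hLs⟩ := hL.1 _ hx
    rw [((𝓡∂ (n + 1)).isOpen_interior (M := M) (n := ∞) (by simp)).nhdsWithin_eq hx] at hs
    obtain ⟨s', hs's, hs'o, hxs'⟩ := mem_nhds_iff.1 hs
    have h1 := integrableOn_chart_of_integrable (x₀ := x₀) (hLs.mono_set hs's) hs'o.measurableSet
    refine ⟨_, ?_, h1⟩
    have hc := (continuousOn_extChartAt_symm x₀).continuousAt (mem_interior_iff_mem_nhds.1 hy)
    exact mem_nhdsWithin_of_mem_nhds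
      (inter_mem (mem_interior_iff_mem_nhds.1 hy) (hc (hs'o.mem_nhds hxs')))
  have hcd := locallyIntegrableOn_coordDiv isOpen_interior (locallyLipschitzOn_densityField hX x₀)
  have := isOpen_interior.ae_eq_zero_of_integral_contDiff_smul_eq_zero (hint.sub hcd) ?_
  · filter_upwards [this] with y hy hyU
    exact sub_eq_zero.1 (hy hyU)
  intro ψ hψ hc hs
  have hsT := hs.trans interior_subset
  have hsup := tsupport_pushforward_subset hc hsT
  have hps : tsupport (pushforward x₀ ψ) ⊆ (𝔠[n] x₀).source := by
    intro x hx
    obtain ⟨y, hy, rfl⟩ := hsup hx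
    exact (𝔠[n] x₀).map_target (hsT hy)
  have hpi : tsupport (pushforward x₀ ψ) ⊆ (𝓡∂ (n + 1)).interior M := by
    intro x hx
    obtain ⟨y, hy, rfl⟩ := hsup hx
    rw [mem_interior_iff_of_mem_source ((𝔠[n] x₀).map_target (hsT hy)),
      (𝔠[n] x₀).right_inv (hsT hy)]
    have := hs hy
    rw [interior_target] at this
    exact this.2
  have hφ : ContMDiff (𝓡∂ (n + 1)) 𝓘(ℝ, ℝ) ∞ (pushforward x₀ ψ) := contMDiff_pushforward hψ hc hsT
  have h1 := hL.2 _ hφ hpi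
  rw [integral_inner_grad_of_tsupport_subset hρ hX (hφ.of_le (by exact_mod_cast le_top)) hps hpi,
    neg_inj] at h1
  have hLφ : Integrable (fun x => pushforward x₀ ψ x * L x) (riemVolume n M) :=
    integrable_mul_of_tsupport_subset hL.1 hφ.continuous
      ((isClosed_tsupport _).isCompact) hpi
  rw [integral_riemVolume_interior (x₀ := x₀) (h := fun x => L x * pushforward x₀ ψ x)
    (by simpa only [mul_comm] using hLφ.aestronglyMeasurable)
    (fun x hx => by rw [pushforward, indicator_of_notMem hx, mul_zero])] at h1
  have hz : ∀ g : Coord n → ℝ, ∫ y, ψ y * g y = ∫ y in U, ψ y * g y := fun g =>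
    (setIntegral_eq_integral_of_forall_compl_eq_zero fun y hy => by
      rw [image_eq_zero_of_notMem_tsupport fun h => hy (hs h), zero_mul]).symm
  have e1 : ∫ y in U, ψ y * coordDiv (densityField x₀ (grad ρ)) y
      = ∫ y in U, ψ y * (volumeDensity x₀ y * L ((𝔠[n] x₀).symm y)) := by
    refine Eq.trans (setIntegral_congr_fun isOpen_interior.measurableSet fun y hy => ?_)
      (h1.trans (setIntegral_congr_fun isOpen_interior.measurableSet fun y hy => ?_))
    · rw [pushforward_symm ψ (interior_subset hy)]
    · rw [pushforward_symm ψ (interior_subset hy)]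
      ring
  simp only [Pi.sub_apply, smul_eq_mul, mul_sub]
  rw [integral_sub (integrable_mul_of_tsupport_subset hint hψ.continuous hc hs)
    (integrable_mul_of_tsupport_subset hcd hψ.continuous hc hs), hz, hz, e1, sub_self]

theorem integrable_of_continuous {h : M → ℝ} (hh : Continuous h) :
    Integrable h (riemVolume n M) :=
  hh.integrable_of_hasCompactSupport (HasCompactSupport.of_compactSpace h)

/-- This rules out the default value of `laplacian`. The chart expressions l_i = (div W)/√det(g) are
averaged with a partition of unity. Splitting a test function as the sum of the χ_i φ uses each l_i
in its own chart, so no agreement on overlaps has to be checked. -/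
theorem exists_isWeakLaplacian {ρ : M → ℝ} (hρ : ContMDiff (𝓡∂ (n + 1)) 𝓘(ℝ, ℝ) 1 ρ)
    (hX : IsLipschitzField (n := n) (grad ρ)) : ∃ L, IsWeakLaplacian (n := n) ρ L := by
  obtain ⟨t, χ, hχ, hχ0, hχs, hχ1⟩ := exists_partitionOfUnity n M
  set l : t → M → ℝ := fun i => pushforward (n := n) (i : M)
    (fun y => coordDiv (densityField (i : M) (grad ρ)) y / volumeDensity (i : M) y) with hl
  have hvc : ∀ x₀ : M, ContinuousOn (fun x => volumeDensity x₀ (𝔠[n] x₀ x)) (𝔠[n] x₀).source :=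
    fun x₀ => (contDiffOn_volumeDensity x₀).continuousOn.comp (continuousOn_extChartAt x₀)
      fun z hz => (𝔠[n] x₀).map_source hz
  have hlm : ∀ i, Measurable (l i) := by
    classical
    intro i
    have hm := measurableSet_source (n := n) (i : M)
    have h1 := (continuousOn_extChartAt (I := 𝓡∂ (n + 1)) (i : M)).measurable_piecewise
      (g := fun _ => 0) continuousOn_const hm
    have h2 := (hvc i).measurable_piecewise (g := fun _ => 0) continuousOn_const hm
    have h3 := (((measurable_coordDiv (densityField (i : M) (grad ρ))).comp h1).div h2).indicator hm
    convert h3 using 1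
    funext x
    by_cases hx : x ∈ (𝔠[n] (i : M)).source
    · simp only [hl, pushforward, indicator_of_mem hx, Pi.div_apply, Function.comp_apply,
        piecewise_eq_of_mem _ _ _ hx]
    · simp only [hl, pushforward, indicator_of_notMem hx]
  have hloc : ∀ i, LocallyIntegrableOn (fun x => χ i x * l i x) ((𝓡∂ (n + 1)).interior M)
      (riemVolume n M) := by
    intro i x hx
    refine IntegrableAtFilter.filter_mono nhdsWithin_le_nhds ?_
    have hm : StronglyMeasurableAtFilter (fun x => χ i x * l i x) (𝓝 x) (riemVolume n M) :=
      ((hχ i).continuous.measurable.mul (hlm i)).aestronglyMeasurable.stronglyMeasurableAtFilter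
    -- Near an interior point of the chart domain the integrand is bounded, by the local Lipschitz
    -- bound on the divergence; away from the chart χ_i vanishes locally.
    by_cases hxs : x ∈ (𝔠[n] (i : M)).source
    · have hU : 𝔠[n] (i : M) x ∈ interior (𝔠[n] (i : M)).target := by
        rw [interior_target]
        exact ⟨(𝔠[n] (i : M)).map_source hxs, (mem_interior_iff_of_mem_source hxs).1 hx⟩
      obtain ⟨B, hB⟩ := coordDiv_locally_bounded isOpen_interior
        (locallyLipschitzOn_densityField hX (i : M)) hU
      have hnhds := (isOpen_extChartAt_source (I := 𝓡∂ (n + 1)) (i : M)).mem_nhds hxs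
      have hB' := ((continuousOn_extChartAt (I := 𝓡∂ (n + 1)) (i : M)).continuousAt
        hnhds).eventually hB
      have hq : ContinuousAt (fun x => |χ i x| * |volumeDensity (i : M) (𝔠[n] (i : M) x)|⁻¹) x :=
        (hχ i).continuous.continuousAt.abs.mul (((hvc i).continuousAt hnhds).abs.inv₀
          (abs_ne_zero.2 (volumeDensity_pos ((𝔠[n] (i : M)).map_source hxs)).ne'))
      have hq' := hq.eventually_lt continuousAt_const (lt_add_one _)
      refine Measure.FiniteAtFilter.integrableAtFilter hm ((riemVolume n M).finiteAt_nhds x)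
        (isBoundedUnder_of_eventually_le (a := (|χ i x| *
          |volumeDensity (i : M) (𝔠[n] (i : M) x)|⁻¹ + 1) * B) ?_)
      filter_upwards [hB', hq', hnhds] with z hz hz' hzs
      simp only [hl, pushforward, indicator_of_mem hzs, Function.comp_apply, Real.norm_eq_abs,
        abs_mul, abs_inv, div_eq_mul_inv]
      rw [mul_comm |coordDiv _ _|, ← mul_assoc]
      exact mul_le_mul hz'.le hz (abs_nonneg _) (by positivity)
    · have h0 := notMem_tsupport_iff_eventuallyEq.1 fun h => hxs (hχs i h)
      refine Measure.FiniteAtFilter.integrableAtFilter hm ((riemVolume n M).finiteAt_nhds x)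
        (isBoundedUnder_of_eventually_le (a := 0) ?_)
      filter_upwards [h0] with z hz
      simp [hz]
  refine ⟨fun x => ∑ i, χ i x * l i x, ?_, ?_⟩
  · intro x hx
    have : ∀ s : Finset t, IntegrableAtFilter (fun x => ∑ i ∈ s, χ i x * l i x)
        (𝓝[(𝓡∂ (n + 1)).interior M] x) (riemVolume n M) := by
      classical
      intro s
      induction s using Finset.induction_on with
      | empty => simpa using (locallyIntegrableOn_zero (μ := riemVolume n M) x hx)
      | insert a s ha ih =>
        simp only [Finset.sum_insert ha]
        exact (hloc a x hx).add ih
    exact this _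
  intro φ hφ hφi
  have hφχ : ∀ i, ContMDiff (𝓡∂ (n + 1)) 𝓘(ℝ, ℝ) 1 (fun x => χ i x * φ x) := fun i =>
    ((hχ i).mul hφ).of_le (by exact_mod_cast le_top)
  have hs : ∀ i, tsupport (fun x => χ i x * φ x) ⊆ (𝔠[n] (i : M)).source := fun i =>
    (tsupport_mul_subset_left).trans (hχs i)
  have hi : ∀ i, tsupport (fun x => χ i x * φ x) ⊆ (𝓡∂ (n + 1)).interior M := fun i =>
    (tsupport_mul_subset_right).trans hφi
  have hsum : φ = fun x => ∑ i, χ i x * φ x := by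
    funext x; rw [← Finset.sum_mul, hχ1, one_mul]
  have hint : ∀ i, Integrable (fun x => φ x * (χ i x * l i x)) (riemVolume n M) := fun i =>
    integrable_mul_of_tsupport_subset (hloc i) hφ.continuous (isClosed_tsupport _).isCompact hφi
  have e1 : ∀ x, ⟪grad (n := n) ρ x, grad φ x⟫_ℝ
      = ∑ i, ⟪grad (n := n) ρ x, grad (fun x => χ i x * φ x) x⟫_ℝ := fun x => by
    conv_lhs => rw [hsum]
    rw [grad_sum _ fun i _ => (hφχ i).mdifferentiable one_ne_zero x, inner_sum]
  have e2 : ∀ x, (∑ i, χ i x * l i x) * φ x = ∑ i, φ x * (χ i x * l i x) := fun x => by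
    rw [mul_comm, Finset.mul_sum]
  simp only [e1, e2]
  rw [integral_finsetSum _ fun i _ => integrable_of_continuous (continuous_inner_grad hρ (hφχ i)),
    integral_finsetSum _ fun i _ => hint i, ← Finset.sum_neg_distrib]
  refine Finset.sum_congr rfl fun i _ => ?_
  rw [integral_inner_grad_of_tsupport_subset hρ hX (hφχ i) (hs i) (hi i),
    integral_riemVolume_interior (x₀ := (i : M)) (hint i).aestronglyMeasurable fun x hx => by
      simp only [hl, pushforward, indicator_of_notMem hx, mul_zero]]
  congr 1
  refine setIntegral_congr_fun isOpen_interior.measurableSet fun y hy => ?_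
  have hv := (volumeDensity_pos (interior_subset hy)).ne'
  simp only [hl]
  rw [pushforward_symm _ (interior_subset hy)]
  field_simp

theorem ae_laplacian {ρ : M → ℝ} (hρ : ContMDiff (𝓡∂ (n + 1)) 𝓘(ℝ, ℝ) 1 ρ)
    (hX : IsLipschitzField (n := n) (grad ρ)) (x₀ : M) :
    ∀ᵐ y : Coord n, y ∈ interior (𝔠[n] x₀).target →
      volumeDensity x₀ y * laplacian n ρ ((𝔠[n] x₀).symm y)
        = coordDiv (densityField x₀ (grad ρ)) y := by
  have h := exists_isWeakLaplacian hρ hX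
  have h1 : laplacian n ρ = h.choose := by rw [laplacian, dif_pos h]
  rw [h1]
  exact IsWeakLaplacian.coordDiv_ae hρ hX h.choose_spec x₀

end Localization

/-! ### The divergence theorem with boundary term -/

section Trace

variable {n : ℕ} {M : Type*} [TopologicalSpace M] [T2Space M] [CompactSpace M]
  [ChartedSpace (EuclideanHalfSpace (n + 1)) M] [IsManifold (𝓡∂ (n + 1)) ∞ M]
  [Bundle.RiemannianBundle (fun x : M => TangentSpace (𝓡∂ (n + 1)) x)]
  [IsContMDiffRiemannianBundle (𝓡∂ (n + 1)) ∞ (EuclideanSpace ℝ (Fin (n + 1)))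
      (fun x : M => TangentSpace (𝓡∂ (n + 1)) x)]
  [MeasurableSpace M] [BorelSpace M]

theorem integrableOn_volumeDensity_mul {h : M → ℝ} (hh : Continuous h) (x₀ : M) :
    IntegrableOn (fun y => volumeDensity x₀ y * h ((𝔠[n] x₀).symm y))
      (interior (𝔠[n] x₀).target) := by
  have h1 := integrableOn_chart_of_integrable (x₀ := x₀)
    (integrable_of_continuous (n := n) hh).integrableOn MeasurableSet.univ
  exact h1.mono_set fun y hy => ⟨interior_subset hy, mem_univ _⟩

theorem integrableOn_cutoff_mul {h : M → ℝ} (hh : Continuous h) (x₀ : M) (k : ℕ) :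
    IntegrableOn (fun y => cutoff k (y 0) * (volumeDensity x₀ y * h ((𝔠[n] x₀).symm y)))
      (interior (𝔠[n] x₀).target) := by
  refine Integrable.bdd_mul (c := 1) (integrableOn_volumeDensity_mul hh x₀) ?_ ?_
  · exact ((contDiff_cutoff k (m := 0)).continuous.comp
      continuous_coord_zero).aestronglyMeasurable
  · refine Eventually.of_forall fun y => ?_
    rw [Real.norm_of_nonneg (cutoff_nonneg _ _)]
    exact cutoff_le_one _ _

theorem tendsto_integral_cutoff_mul {h : M → ℝ} (hh : Continuous h) (x₀ : M) :
    Tendsto (fun k : ℕ => ∫ y in interior (𝔠[n] x₀).target,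
        cutoff k (y 0) * (volumeDensity x₀ y * h ((𝔠[n] x₀).symm y))) atTop
      (𝓝 (∫ y in interior (𝔠[n] x₀).target, volumeDensity x₀ y * h ((𝔠[n] x₀).symm y))) := by
  refine tendsto_integral_of_dominated_convergence
    (fun y => ‖volumeDensity x₀ y * h ((𝔠[n] x₀).symm y)‖)
    (fun k => (integrableOn_cutoff_mul hh x₀ k).aestronglyMeasurable)
    (integrableOn_volumeDensity_mul hh x₀).norm (fun k => Eventually.of_forall fun y => ?_) ?_
  · rw [norm_mul, Real.norm_of_nonneg (cutoff_nonneg _ _)]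
    exact mul_le_of_le_one_left (norm_nonneg _) (cutoff_le_one _ _)
  · filter_upwards [ae_restrict_mem isOpen_interior.measurableSet] with y hy
    rw [interior_target] at hy
    simpa using (tendsto_cutoff hy.2).mul_const (volumeDensity x₀ y * h ((𝔠[n] x₀).symm y))

theorem continuousOn_pullback {h : M → ℝ} (hh : Continuous h) (x₀ : M) :
    ContinuousOn (pullback (n := n) x₀ h) (𝔠[n] x₀).target :=
  (hh.comp_continuousOn (continuousOn_extChartAt_symm x₀)).congr fun _ hy => pullback_of_mem h hy

theorem continuousOn_pullback_mul_densityField {ρ h : M → ℝ}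
    (hX : IsLipschitzField (n := n) (grad ρ)) (hh : Continuous h) (x₀ : M) :
    ContinuousOn (fun y => pullback x₀ h y * densityField x₀ (grad ρ) y 0) (𝔠[n] x₀).target :=
  (continuousOn_pullback hh x₀).mul
    (continuous_coord_zero.comp_continuousOn (continuousOn_densityField hX x₀))

theorem integrable_boundaryLayer {ρ h : M → ℝ} (hX : IsLipschitzField (n := n) (grad ρ))
    (hh : Continuous h) {x₀ : M} (hs : tsupport h ⊆ (𝔠[n] x₀).source) (k : ℕ) :
    Integrable fun y : Coord n =>
      pullback x₀ h y * densityField x₀ (grad ρ) y 0 * deriv (cutoff k) (y 0) := by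
  have hK := isCompact_image_tsupport (n := n) hs
  have h1 := ((continuousOn_pullback_mul_densityField hX hh x₀).mul
    (((contDiff_cutoff k (m := 1)).continuous_deriv le_rfl).comp
      continuous_coord_zero).continuousOn).mono (image_tsupport_subset_target hs)
  refine (integrableOn_iff_integrable_of_support_subset fun y hy => ?_).1
    (h1.integrableOn_compact hK)
  by_contra hyK
  exact hy (by simp [pullback_eq_zero hyK])

/-- The boundary layer of the cutoff converges to the boundary integral. -/
theorem tendsto_integral_boundaryLayer {ρ h : M → ℝ} (hX : IsLipschitzField (n := n) (grad ρ))
    (hρ : ∀ x ∈ (𝓡∂ (n + 1)).boundary M, normalDeriv n ρ x = -1)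
    (hh : Continuous h) {x₀ : M} (hs : tsupport h ⊆ (𝔠[n] x₀).source) :
    Tendsto (fun k : ℕ => ∫ y : Coord n,
        pullback x₀ h y * densityField x₀ (grad ρ) y 0 * deriv (cutoff k) (y 0)) atTop
      (𝓝 (∫ x, h x ∂(riemSurface n M))) := by
  have h0 : ∀ y ∉ 𝔠[n] x₀ '' tsupport h,
      pullback x₀ h y * densityField x₀ (grad ρ) y 0 = 0 := fun y hy => by
    rw [pullback_eq_zero hy, zero_mul]
  have h1 := tendsto_integral_mul_deriv_cutoff (isCompact_image_tsupport hs) h0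
    (continuousOn_halfSpace_of_target (isCompact_image_tsupport hs)
      (image_tsupport_subset_target hs) h0 (continuousOn_pullback_mul_densityField hX hh x₀))
  convert h1 using 2
  rw [integral_riemSurface (n := n) hh.aestronglyMeasurable (x₀ := x₀) fun x hx =>
    image_eq_zero_of_notMem_tsupport fun h => hx (hs h)]
  rw [← setIntegral_eq_integral_of_forall_compl_eq_zero (s := boundaryTarget n x₀)
    (f := fun z => pullback x₀ h (hyperplanePoint z) *
      densityField x₀ (grad (n := n) ρ) (hyperplanePoint z) 0)]
  · refine setIntegral_congr_fun (measurableSet_boundaryTarget x₀) fun z hz => ?_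
    have h2 := coordField_mul_volumeDensity ((𝔠[n] x₀).map_target hz)
      (boundaryParam_mem_boundary hz) (hρ _ (boundaryParam_mem_boundary hz))
    rw [(𝔠[n] x₀).right_inv hz, tailPoint_hyperplanePoint] at h2
    rw [pullback_of_mem h hz, ← h2, densityField, PiLp.smul_apply, smul_eq_mul, boundaryParam]
    ring
  · intro z hz
    rw [pullback_of_notMem h hz, zero_mul]

theorem inner_weakGrad_eq_sum {ρ β : M → ℝ} {x₀ : M} {y : Coord n} (hy : y ∈ (𝔠[n] x₀).target) :
    ∑ k, densityField x₀ (grad ρ) y k *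
        ⟪weakGrad (n := n) β ((𝔠[n] x₀).symm y), chartVector x₀ y (EuclideanSpace.single k 1)⟫_ℝ
      = volumeDensity x₀ y
        * ⟪grad (n := n) ρ ((𝔠[n] x₀).symm y), weakGrad (n := n) β ((𝔠[n] x₀).symm y)⟫_ℝ := by
  rw [real_inner_comm, ← frame_coordField hy (grad ρ), frame_eq_sum, inner_sum, Finset.mul_sum]
  refine Finset.sum_congr rfl fun k _ => ?_
  rw [chartVector_eq hy, inner_smul_right, densityField, PiLp.smul_apply, smul_eq_mul, mul_assoc]
  rfl

/-- The localized trace inequality. -/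
theorem integral_trace_le_of_tsupport_subset {ρ β F χ : M → ℝ} {D : ℝ}
    (hρ : ContMDiff (𝓡∂ (n + 1)) 𝓘(ℝ, ℝ) 1 ρ) (hX : IsLipschitzField (n := n) (grad ρ))
    (hρn : ∀ x ∈ (𝓡∂ (n + 1)).boundary M, normalDeriv n ρ x = -1)
    (hβ : Continuous β) (hβd : WeaklyDifferentiable n β)
    (hD : ∀ᵐ x ∂(riemVolume n M), -(D * β x) ≤ β x * laplacian n ρ x
      + ⟪grad (n := n) ρ x, weakGrad (n := n) β x⟫_ℝ)
    (hF : ContMDiff (𝓡∂ (n + 1)) 𝓘(ℝ, ℝ) 1 F) (hF0 : ∀ x, 0 ≤ F x)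
    (hχ : ContMDiff (𝓡∂ (n + 1)) 𝓘(ℝ, ℝ) 1 χ) (hχ0 : ∀ x, 0 ≤ χ x) {x₀ : M}
    (hs : tsupport χ ⊆ (𝔠[n] x₀).source) :
    ∫ x, β x * F x * ⟪grad (n := n) ρ x, grad χ x⟫_ℝ ∂(riemVolume n M)
        + ∫ x, χ x * (β x * F x) ∂(riemSurface n M)
      ≤ ∫ x, χ x * (|β x * ⟪grad (n := n) ρ x, grad F x⟫_ℝ| + D * F x * β x)
          ∂(riemVolume n M) := by
  set U := interior (𝔠[n] x₀).target with hU
  set W := densityField x₀ (grad (n := n) ρ) with hW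
  have hUm : MeasurableSet U := isOpen_interior.measurableSet
  have hh1 : Continuous fun x => β x * F x * ⟪grad (n := n) ρ x, grad χ x⟫_ℝ :=
    (hβ.mul hF.continuous).mul (continuous_inner_grad hρ hχ)
  have hh2 : Continuous fun x => χ x * (|β x * ⟪grad (n := n) ρ x, grad F x⟫_ℝ| + D * F x * β x) :=
    hχ.continuous.mul ((hβ.mul (continuous_inner_grad hρ hF)).abs.add
      ((continuous_const.mul hF.continuous).mul hβ))
  have hh3 : Continuous fun x => χ x * (β x * F x) := hχ.continuous.mul (hβ.mul hF.continuous)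
  have hs3 : tsupport (fun x => χ x * (β x * F x)) ⊆ (𝔠[n] x₀).source :=
    tsupport_mul_subset_left.trans hs
  -- The cutoff forces k·y₀ ≥ 1 on the support, hence compact support in the open interior, where
  -- weak derivatives may be tested.
  set θ : ℕ → Coord n → ℝ := fun k y => pullback x₀ χ y * cutoff k (y 0) with hθ
  have hsθ : ∀ k, tsupport (θ k) ⊆ 𝔠[n] x₀ '' tsupport χ ∩ {y | 1 ≤ (k : ℝ) * y 0} := by
    intro k
    refine closure_minimal (fun y hy => ⟨?_, ?_⟩) ((isCompact_image_tsupport hs).isClosed.inter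
      (isClosed_le continuous_const (continuous_const.mul continuous_coord_zero)))
    · by_contra h
      exact hy (by simp only [hθ]; rw [pullback_eq_zero h, zero_mul])
    · by_contra h
      exact hy (by simp only [hθ]; rw [cutoff_eq_zero (le_of_not_ge h), mul_zero])
  have hsU : ∀ k, tsupport (θ k) ⊆ U := by
    intro k y hy
    have h1 := hsθ k hy
    rw [hU, interior_target]
    refine ⟨image_tsupport_subset_target hs h1.1, ?_⟩
    have h2 := nonneg_of_mem_target (image_tsupport_subset_target hs h1.1)
    refine lt_of_le_of_ne h2 fun h0 => ?_
    have h3 : (1 : ℝ) ≤ k * y 0 := h1.2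
    rw [← h0, mul_zero] at h3
    linarith
  have hcθ : ∀ k, HasCompactSupport (θ k) := fun k =>
    (isCompact_image_tsupport hs).of_isClosed_subset (isClosed_tsupport _)
      ((hsθ k).trans inter_subset_left)
  have hcut : ∀ k : ℕ, ContDiff ℝ 1 fun y : Coord n => cutoff k (y 0) := fun k =>
    (contDiff_cutoff k (m := 1)).comp (EuclideanSpace.proj (𝕜 := ℝ) (0 : Fin (n + 1))).contDiff
  have hdθ : ∀ k, ContDiff ℝ 1 (θ k) := fun k => contDiff_of_tsupport fun y hy =>
    (contDiffAt_pullback (m := 1) hχ (hsU k hy)).mul (hcut k).contDiffAt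
  have hpos : ∀ (φ : M → ℝ), (∀ x, 0 ≤ φ x) → ∀ y, 0 ≤ pullback (n := n) x₀ φ y := fun φ h y =>
    indicator_nonneg (fun _ _ => h _) y
  have hWG : IsWeakGradient (n := n) β (weakGrad β) := by
    have : weakGrad (n := n) β = hβd.choose := by
      funext x; rw [weakGrad, dif_pos hβd]
    rw [this]; exact hβd.choose_spec
  have hbound : ∀ᵐ y : Coord n, y ∈ U →
      -(D * (β ∘ (𝔠[n] x₀).symm) y * volumeDensity x₀ y)
        ≤ (β ∘ (𝔠[n] x₀).symm) y * coordDiv W y + ∑ k, W y k *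
          ⟪weakGrad (n := n) β ((𝔠[n] x₀).symm y),
            chartVector x₀ y (EuclideanSpace.single k 1)⟫_ℝ := by
    filter_upwards [ae_chart_of_ae_riemVolume hD x₀, ae_laplacian hρ hX x₀] with y h1 h2 hy
    have hyT := interior_subset hy
    rw [hW, inner_weakGrad_eq_sum hyT, ← h2 hy, Function.comp_apply]
    have h3 := mul_le_mul_of_nonneg_left (h1 hyT) (volumeDensity_pos hyT).le
    linarith
  have hle : ∀ k, _ ≤ _ := fun k => integral_mul_fderiv_le isOpen_interior
    (locallyLipschitzOn_densityField hX x₀)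
    ((hβ.comp_continuousOn (continuousOn_extChartAt_symm x₀)).mono interior_subset)
    (fun k => (hWG x₀ (EuclideanSpace.single k 1)).1)
    (fun k => (hWG x₀ (EuclideanSpace.single k 1)).2)
    (u := pullback x₀ F) (fun y hy => (contDiffAt_pullback (m := 1) hF hy).contDiffWithinAt)
    (hpos F hF0) ((contDiffOn_volumeDensity x₀).continuousOn.mono interior_subset) hbound
    (hdθ k) (fun y => mul_nonneg (hpos χ hχ0 y) (cutoff_nonneg _ _)) (hcθ k) (hsU k)
  have hJ : ∀ k, ∫ y, θ k y * (|(β ∘ (𝔠[n] x₀).symm) y * fderiv ℝ (pullback x₀ F) y (W y)|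
        + D * pullback x₀ F y * (β ∘ (𝔠[n] x₀).symm) y * volumeDensity x₀ y)
      = ∫ y in U, cutoff k (y 0) * (volumeDensity x₀ y *
        (fun x => χ x * (|β x * ⟪grad (n := n) ρ x, grad F x⟫_ℝ| + D * F x * β x))
          ((𝔠[n] x₀).symm y)) := by
    intro k
    rw [← setIntegral_eq_integral_of_forall_compl_eq_zero (s := U) fun y hy => by
      rw [image_eq_zero_of_notMem_tsupport fun h => hy (hsU k h), zero_mul]]
    refine setIntegral_congr_fun hUm fun y hy => ?_
    have hyT := interior_subset hy
    simp only [hθ, Function.comp_apply]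
    rw [hW, ← volumeDensity_mul_inner_grad hF hy, pullback_of_mem _ hyT, pullback_of_mem _ hyT,
      mul_left_comm (β _), abs_mul (volumeDensity x₀ y), abs_of_pos (volumeDensity_pos hyT)]
    ring
  -- The product rule for θ_k splits this integral: the derivative of χ gives the volume term, and
  -- the derivative of the cutoff, weighted by W₀, gives the layer that converges to the boundary
  -- integral.
  have hI : ∀ k, ∫ y, (β ∘ (𝔠[n] x₀).symm) y * pullback x₀ F y * fderiv ℝ (θ k) y (W y)
      = (∫ y in U, cutoff k (y 0) * (volumeDensity x₀ y *
        (fun x => β x * F x * ⟪grad (n := n) ρ x, grad χ x⟫_ℝ) ((𝔠[n] x₀).symm y)))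
        + ∫ y, pullback x₀ (fun x => χ x * (β x * F x)) y * W y 0 * deriv (cutoff k) (y 0) := by
    intro k
    rw [← integral_indicator hUm, ← integral_add
      ((integrable_indicator_iff hUm).2 (integrableOn_cutoff_mul hh1 x₀ k))
      (integrable_boundaryLayer hX hh3 hs3 k)]
    refine integral_congr_ae (Eventually.of_forall fun y => ?_)
    simp only
    by_cases hy : y ∈ U
    · have hyT := interior_subset hy
      have h1 : HasFDerivAt (fun y : Coord n => cutoff k (y 0))
          (deriv (cutoff k) (y 0) • EuclideanSpace.proj (𝕜 := ℝ) (0 : Fin (n + 1))) y :=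
        ((contDiff_cutoff k (m := 1)).differentiable one_ne_zero
          (y 0)).hasDerivAt.comp_hasFDerivAt (f := fun y : Coord n => y 0) y
            (EuclideanSpace.proj (𝕜 := ℝ) (0 : Fin (n + 1))).hasFDerivAt
      have h2 := ((contDiffAt_pullback (m := 1) hχ hy).differentiableAt one_ne_zero).hasFDerivAt.mul
        h1
      have h3 := volumeDensity_mul_inner_grad (X := grad ρ) hχ hy
      have h4 : fderiv ℝ (θ k) y = _ := h2.fderiv
      rw [h4, indicator_of_mem hy]
      simp only [_root_.add_apply, _root_.smul_apply, smul_eq_mul,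
        Function.comp_apply, PiLp.proj_apply]
      rw [hW, ← h3, pullback_of_mem _ hyT, pullback_of_mem _ hyT, pullback_of_mem _ hyT]
      ring
    · rw [indicator_of_notMem hy, zero_add,
        fderiv_of_notMem_tsupport (𝕜 := ℝ) fun h => hy (hsU k h)]
      simp only [_root_.zero_apply, mul_zero]
      by_cases hyT : y ∈ (𝔠[n] x₀).target
      · have hy0 : y 0 = 0 := by
          by_contra h0
          refine hy ?_
          rw [hU, interior_target]
          exact ⟨hyT, lt_of_le_of_ne (nonneg_of_mem_target hyT) (Ne.symm h0)⟩
        rw [hy0, deriv_cutoff, deriv_smoothTransition_eq_zero (by norm_num)]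
        simp
      · rw [pullback_of_notMem _ hyT]; simp
  have e1 := integral_riemVolume_interior hh1.aestronglyMeasurable (x₀ := x₀) fun x hx => by
    rw [grad_zero_of_notMem_tsupport fun h => hx (hs h), inner_zero_right, mul_zero]
  have e2 := integral_riemVolume_interior hh2.aestronglyMeasurable (x₀ := x₀) fun x hx => by
    rw [image_eq_zero_of_notMem_tsupport fun h => hx (hs h), zero_mul]
  rw [e1, e2]
  refine le_of_tendsto_of_tendsto' ((tendsto_integral_cutoff_mul hh1 x₀).add
    (tendsto_integral_boundaryLayer hX hρn hh3 hs3)) (tendsto_integral_cutoff_mul hh2 x₀)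
    fun k => ?_
  rw [← hJ k, ← hI k]
  exact hle k

/-- The trace inequality obtained from the divergence theorem for `β F ∇ρ`. -/
theorem integral_trace_le {ρ β F : M → ℝ} {D : ℝ}
    (hρ : ContMDiff (𝓡∂ (n + 1)) 𝓘(ℝ, ℝ) 1 ρ) (hX : IsLipschitzField (n := n) (grad ρ))
    (hρn : ∀ x ∈ (𝓡∂ (n + 1)).boundary M, normalDeriv n ρ x = -1)
    (hβ : Continuous β) (hβd : WeaklyDifferentiable n β)
    (hD : ∀ᵐ x ∂(riemVolume n M), -(D * β x) ≤ β x * laplacian n ρ x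
      + ⟪grad (n := n) ρ x, weakGrad (n := n) β x⟫_ℝ)
    (hF : ContMDiff (𝓡∂ (n + 1)) 𝓘(ℝ, ℝ) 1 F) (hF0 : ∀ x, 0 ≤ F x) :
    ∫ x, β x * F x ∂(riemSurface n M)
      ≤ ∫ x, |β x * ⟪grad (n := n) ρ x, grad F x⟫_ℝ| + D * F x * β x ∂(riemVolume n M) := by
  obtain ⟨t, χ, hχ, hχ0, hχs, hχ1⟩ := exists_partitionOfUnity n M
  have hχ' : ∀ i, ContMDiff (𝓡∂ (n + 1)) 𝓘(ℝ, ℝ) 1 (χ i) := fun i =>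
    (hχ i).of_le (by exact_mod_cast le_top)
  have hloc := Finset.sum_le_sum fun i (_ : i ∈ Finset.univ) =>
    integral_trace_le_of_tsupport_subset hρ hX hρn hβ hβd hD hF hF0 (hχ' i) (hχ0 i) (hχs i)
  have i1 : ∀ i ∈ Finset.univ, Integrable (fun x => β x * F x *
      ⟪grad (n := n) ρ x, grad (χ i) x⟫_ℝ) (riemVolume n M) := fun i _ =>
    integrable_of_continuous ((hβ.mul hF.continuous).mul (continuous_inner_grad hρ (hχ' i)))
  have i2 : ∀ i ∈ Finset.univ, Integrable (fun x => χ i x * (β x * F x)) (riemSurface n M) :=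
    fun i _ => ((hχ i).continuous.mul (hβ.mul hF.continuous)).integrable_of_hasCompactSupport
      (HasCompactSupport.of_compactSpace _)
  have i3 : ∀ i ∈ Finset.univ, Integrable (fun x => χ i x *
      (|β x * ⟪grad (n := n) ρ x, grad F x⟫_ℝ| + D * F x * β x)) (riemVolume n M) := fun i _ =>
    integrable_of_continuous ((hχ i).continuous.mul ((hβ.mul (continuous_inner_grad hρ hF)).abs.add
      ((continuous_const.mul hF.continuous).mul hβ)))
  rw [Finset.sum_add_distrib, ← integral_finsetSum _ i1, ← integral_finsetSum _ i2,
    ← integral_finsetSum _ i3] at hloc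
  simp only [← Finset.sum_mul, hχ1, one_mul, ← Finset.mul_sum, ← inner_sum] at hloc
  -- Summing the localized inequalities, the error terms with ∇χ_i cancel because the χ_i add up to
  -- 1.
  have h0 : ∀ x, ∑ i, grad (n := n) (χ i) x = 0 := fun x => by
    rw [← grad_sum _ fun i _ => (hχ' i).mdifferentiable one_ne_zero x]
    simp only [hχ1]
    refine ext_inner_right ℝ fun v => ?_
    rw [inner_grad, mfderiv_const, inner_zero_left]
    rfl
  simpa only [h0, inner_zero_right, mul_zero, integral_zero, zero_add] using hloc

end Trace

/-- Raising a bound for a `p`-th power to the power `2 / p`. -/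
theorem rpow_two_div_le_mul {p : ℝ} (hp : 2 ≤ p) {S R c C₁ C₂ D E N₁ N₂ : ℝ≥0∞}
    (hN₁ : N₁ ≤ C₁ * E ^ (1 / 2 : ℝ)) (hN₂ : N₂ ≤ C₂ * E ^ (1 / 2 : ℝ))
    (hS : S ≤ R * (N₁ ^ (p - 1) * (c * E) ^ (1 / 2 : ℝ)) + D * N₂ ^ p) :
    S ^ (2 / p) ≤ ((R ^ (2 : ℝ) * c * C₁ ^ (2 * (p - 1))) ^ (1 / p)
      + D ^ (2 / p) * C₂ ^ (2 : ℝ)) * E := by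
  have hp0 : 0 < p := by linarith
  have h2p : 0 ≤ 2 / p := by positivity
  -- The powers of E combine as (p - 1)/2 + 1/2 = p/2, the same degree as in the other term.
  have e1 : (N₁ ^ (p - 1) * (c * E) ^ (1 / 2 : ℝ)) ≤ c ^ (1 / 2 : ℝ) * C₁ ^ (p - 1) * E ^ (p / 2) := by
    calc N₁ ^ (p - 1) * (c * E) ^ (1 / 2 : ℝ)
        ≤ (C₁ * E ^ (1 / 2 : ℝ)) ^ (p - 1) * (c * E) ^ (1 / 2 : ℝ) := by
          gcongr; linarith
      _ = c ^ (1 / 2 : ℝ) * C₁ ^ (p - 1) * (E ^ ((1 / 2 : ℝ) * (p - 1)) * E ^ (1 / 2 : ℝ)) := by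
          rw [ENNReal.mul_rpow_of_nonneg _ _ (by linarith), ENNReal.mul_rpow_of_nonneg _ _ (by norm_num),
            ← ENNReal.rpow_mul]
          ring
      _ = c ^ (1 / 2 : ℝ) * C₁ ^ (p - 1) * E ^ (p / 2) := by
          rw [← ENNReal.rpow_add_of_nonneg _ _ (by nlinarith) (by norm_num)]
          congr 2; ring
  have e2 : N₂ ^ p ≤ C₂ ^ p * E ^ (p / 2) := by
    calc N₂ ^ p ≤ (C₂ * E ^ (1 / 2 : ℝ)) ^ p := by gcongr
      _ = C₂ ^ p * E ^ (p / 2) := by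
          rw [ENNReal.mul_rpow_of_nonneg _ _ hp0.le, ← ENNReal.rpow_mul]
          congr 2; ring
  calc S ^ (2 / p)
      ≤ (R * (c ^ (1 / 2 : ℝ) * C₁ ^ (p - 1) * E ^ (p / 2)) + D * (C₂ ^ p * E ^ (p / 2))) ^ (2 / p) := by
        refine ENNReal.rpow_le_rpow (hS.trans ?_) h2p
        gcongr
    -- Subadditivity of the power 2/p, which is where p ≥ 2 enters.
    _ ≤ (R * (c ^ (1 / 2 : ℝ) * C₁ ^ (p - 1) * E ^ (p / 2))) ^ (2 / p)
        + (D * (C₂ ^ p * E ^ (p / 2))) ^ (2 / p) :=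
        ENNReal.rpow_add_le_add_rpow _ _ h2p ((div_le_one hp0).2 hp)
    _ = ((R ^ (2 : ℝ) * c * C₁ ^ (2 * (p - 1))) ^ (1 / p)
      + D ^ (2 / p) * C₂ ^ (2 : ℝ)) * E := by
        have q1 : (0 : ℝ) ≤ 1 / p := by positivity
        simp only [ENNReal.mul_rpow_of_nonneg _ _ h2p, ENNReal.mul_rpow_of_nonneg _ _ q1,
          ← ENNReal.rpow_mul]
        have a1 : p / 2 * (2 / p) = 1 := by field_simp
        have a2 : p * (2 / p) = 2 := by field_simp
        have a3 : (1 / 2 : ℝ) * (2 / p) = 1 / p := by field_simp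
        have a4 : (2 : ℝ) * (1 / p) = 2 / p := by field_simp
        have a5 : (p - 1) * (2 / p) = 2 * (p - 1) * (1 / p) := by field_simp
        rw [a1, a2, a3, a4, a5, ENNReal.rpow_one]
        ring

/-! ### From the trace inequality to the weighted estimate -/

section Final

variable {n : ℕ} {M : Type*} [TopologicalSpace M] [T2Space M] [CompactSpace M]
  [ChartedSpace (EuclideanHalfSpace (n + 1)) M] [IsManifold (𝓡∂ (n + 1)) ∞ M]
  [Bundle.RiemannianBundle (fun x : M => TangentSpace (𝓡∂ (n + 1)) x)]
  [IsContMDiffRiemannianBundle (𝓡∂ (n + 1)) ∞ (EuclideanSpace ℝ (Fin (n + 1)))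
      (fun x : M => TangentSpace (𝓡∂ (n + 1)) x)]

theorem hasFDerivWithinAt_of_grad_eq_zero {f : M → ℝ} (hf : ContMDiff (𝓡∂ (n + 1)) 𝓘(ℝ, ℝ) 1 f)
    (h : ∀ x, grad (n := n) f x = 0) {x₀ : M} {y : Coord n} (hy : y ∈ (𝔠[n] x₀).target) :
    HasFDerivWithinAt (f ∘ (𝔠[n] x₀).symm) (0 : Coord n →L[ℝ] ℝ) (𝔠[n] x₀).target y := by
  have h1 := ((contDiffOn_comp_extChartAt_symm (m := 1) hf x₀).differentiableOn
    one_ne_zero y hy).hasFDerivWithinAt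
  have h0 : fderivWithin ℝ (f ∘ (𝔠[n] x₀).symm) (𝔠[n] x₀).target y = 0 := by
    refine ContinuousLinearMap.ext fun v => ?_
    rw [← inner_grad_frame hy (hf.mdifferentiable one_ne_zero _), h, inner_zero_left]
    rfl
  rwa [h0] at h1

/-- In a chart, the mean value inequality with constant 0 on the convex intersection of a ball with
the half space, which also covers boundary points. -/
theorem isLocallyConstant_of_grad_eq_zero {f : M → ℝ} (hf : ContMDiff (𝓡∂ (n + 1)) 𝓘(ℝ, ℝ) 1 f)
    (h : ∀ x, grad (n := n) f x = 0) : IsLocallyConstant f := by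
  rw [IsLocallyConstant.iff_eventually_eq]
  intro x
  obtain ⟨O, hO, hT⟩ := exists_isOpen_target_eq (n := n) x
  have hx := (𝔠[n] x).map_source (mem_extChartAt_source x)
  obtain ⟨r, hr, hball⟩ := Metric.isOpen_iff.1 hO (𝔠[n] x x) (by rw [hT] at hx; exact hx.1)
  have hsub : Metric.ball (𝔠[n] x x) r ∩ range (𝓡∂ (n + 1)) ⊆ (𝔠[n] x).target := by
    rw [hT]
    exact fun y hy => ⟨hball hy.1, mem_range_iff.1 hy.2⟩
  have hconv : Convex ℝ (Metric.ball (𝔠[n] x x) r ∩ range (𝓡∂ (n + 1))) :=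
    (convex_ball _ _).inter (𝓡∂ (n + 1)).convex_range
  have hnhds := (continuousAt_extChartAt (I := 𝓡∂ (n + 1)) x).preimage_mem_nhds
    (Metric.ball_mem_nhds _ hr)
  filter_upwards [hnhds, extChartAt_source_mem_nhds (I := 𝓡∂ (n + 1)) x] with z hz hzs
  have h1 := hconv.norm_image_sub_le_of_norm_hasFDerivWithin_le (C := 0)
    (f := f ∘ (𝔠[n] x).symm) (f' := fun _ => 0)
    (fun y hy => (hasFDerivWithinAt_of_grad_eq_zero hf h (hsub hy)).mono hsub) (by simp)
    (x := 𝔠[n] x x) (y := 𝔠[n] x z) ⟨Metric.mem_ball_self hr, mem_range_self _⟩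
    ⟨hz, mem_range_self _⟩
  simp only [Function.comp_apply] at h1
  rw [(𝔠[n] x).left_inv hzs, (𝔠[n] x).left_inv (mem_extChartAt_source x), zero_mul] at h1
  exact sub_eq_zero.1 (norm_le_zero_iff.1 h1)

theorem contMDiff_norm_rpow {f : M → ℝ} (hf : ContMDiff (𝓡∂ (n + 1)) 𝓘(ℝ, ℝ) 1 f) {p : ℝ}
    (hp : 1 < p) : ContMDiff (𝓡∂ (n + 1)) 𝓘(ℝ, ℝ) 1 fun x => ‖f x‖ ^ p :=
  (contDiff_norm_rpow hp).contMDiff.comp hf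

theorem inner_grad_norm_rpow {f : M → ℝ} (hf : ContMDiff (𝓡∂ (n + 1)) 𝓘(ℝ, ℝ) 1 f) {p : ℝ}
    (hp : 1 < p) (x : M) (v : TangentSpace (𝓡∂ (n + 1)) x) :
    ⟪v, grad (n := n) (fun x => ‖f x‖ ^ p) x⟫_ℝ
      = p * ‖f x‖ ^ (p - 2) * f x * ⟪v, grad (n := n) f x⟫_ℝ := by
  rw [real_inner_comm, inner_grad, real_inner_comm, inner_grad]
  have h1 := (hasFDerivAt_norm_rpow (f x) hp).hasMFDerivAt.comp x
    (hf.mdifferentiable one_ne_zero x).hasMFDerivAt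
  have h2 : mfderiv (𝓡∂ (n + 1)) 𝓘(ℝ, ℝ) (fun x => ‖f x‖ ^ p) x = _ := h1.mfderiv
  rw [h2]
  have key : ∀ d : ℝ, p * ‖f x‖ ^ (p - 2) * (d * f x) = p * ‖f x‖ ^ (p - 2) * f x * d :=
    fun d => by ring
  exact key _

theorem abs_inner_grad_norm_rpow_le {f : M → ℝ} (hf : ContMDiff (𝓡∂ (n + 1)) 𝓘(ℝ, ℝ) 1 f) {p : ℝ}
    (hp : 1 < p) (x : M) (v : TangentSpace (𝓡∂ (n + 1)) x) :
    |⟪v, grad (n := n) (fun x => ‖f x‖ ^ p) x⟫_ℝ|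
      ≤ p * ‖v‖ * (‖f x‖ ^ (p - 1) * ‖grad (n := n) f x‖) := by
  have h1 : ‖f x‖ ^ (p - 2) * |f x| = ‖f x‖ ^ (p - 1) := by
    -- At a zero of f both sides vanish, the right one because p - 1 ≠ 0; this also covers p = 2,
    -- where the first factor is 0^0 = 1.
    rcases eq_or_ne (f x) 0 with h0 | h0
    · rw [h0]; simp [Real.zero_rpow (sub_ne_zero.2 hp.ne')]
    · have : 0 < ‖f x‖ := norm_pos_iff.2 h0
      rw [← Real.norm_eq_abs, ← Real.rpow_add_one this.ne']
      congr 1; ring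
  rw [inner_grad_norm_rpow hf hp, abs_mul, abs_mul, abs_mul, abs_of_pos (by linarith : 0 < p),
    abs_of_nonneg (by positivity : 0 ≤ ‖f x‖ ^ (p - 2)), mul_assoc p, h1]
  calc p * ‖f x‖ ^ (p - 1) * |⟪v, grad (n := n) f x⟫_ℝ|
      ≤ p * ‖f x‖ ^ (p - 1) * (‖v‖ * ‖grad (n := n) f x‖) := by
        gcongr; exact abs_real_inner_le_norm _ _
    _ = _ := by ring

variable [MeasurableSpace M] [BorelSpace M]

theorem measurable_enorm_grad {f : M → ℝ} (hf : ContMDiff (𝓡∂ (n + 1)) 𝓘(ℝ, ℝ) 1 f) :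
    Measurable fun x => ‖grad (n := n) f x‖ₑ := by
  simp only [← ofReal_norm]
  exact (continuous_norm_grad hf).measurable.ennreal_ofReal

theorem lintegral_ofReal_lt_top {μ : Measure M} [IsFiniteMeasure μ] {h : M → ℝ}
    (hh : Continuous h) : ∫⁻ x, ENNReal.ofReal (h x) ∂μ < ⊤ :=
  (hh.integrable_of_hasCompactSupport (HasCompactSupport.of_compactSpace h)).lintegral_lt_top

/-- The continuous function min(β, 0) vanishes almost everywhere, hence everywhere. The sign is
needed at boundary points too, where the volume measure gives no direct information. -/
theorem nonneg_of_ae_riemVolume {β : M → ℝ} (hβ : Continuous β)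
    (h : ∀ᵐ x ∂(riemVolume n M), 0 < β x) (x : M) : 0 ≤ β x := by
  have h1 := eq_zero_of_ae_riemVolume (n := n) (hβ.min continuous_const : Continuous fun x => min (β x) 0)
    (h.mono fun x hx => min_eq_right hx.le)
  exact min_eq_right_iff.1 (congrFun h1 x)

theorem massVol_ne_top {α : M → ℝ} (hα : Continuous α) : massVol n α ≠ ⊤ :=
  (lintegral_ofReal_lt_top hα).ne

theorem massSurf_ne_top {β : M → ℝ} (hβ : Continuous β) : massSurf n β ≠ ⊤ :=
  (lintegral_ofReal_lt_top hβ).ne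

theorem massVol_ne_zero [Nonempty M] {α : M → ℝ} (hα : Continuous α)
    (h : ∀ᵐ x ∂(riemVolume n M), 0 < α x) : massVol n α ≠ 0 := by
  intro h0
  rw [massVol, lintegral_eq_zero_iff hα.measurable.ennreal_ofReal] at h0
  have h1 : (fun _ : M => (1 : ℝ)) = 0 := by
    refine eq_zero_of_ae_riemVolume (n := n) continuous_const ?_
    filter_upwards [h, h0] with x hx hx0
    exact absurd (ENNReal.ofReal_eq_zero.1 hx0) (not_le.2 hx)
  obtain ⟨x⟩ := ‹Nonempty M›
  exact one_ne_zero (congrFun h1 x)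

theorem isProbabilityMeasure_volAlpha [Nonempty M] {α : M → ℝ} (hα : Continuous α)
    (h : ∀ᵐ x ∂(riemVolume n M), 0 < α x) : IsProbabilityMeasure (volAlpha n α) := by
  refine ⟨?_⟩
  rw [volAlpha, withDensity_apply _ MeasurableSet.univ, Measure.restrict_univ]
  simp only [div_eq_mul_inv]
  rw [lintegral_mul_const _ hα.measurable.ennreal_ofReal]
  exact ENNReal.mul_inv_cancel (massVol_ne_zero hα h) (massVol_ne_top hα)

theorem ae_riemVolume_of_ae_volAlpha {α : M → ℝ} (hα : Continuous α)
    (h : ∀ᵐ x ∂(riemVolume n M), 0 < α x) {P : M → Prop} (hP : ∀ᵐ x ∂(volAlpha n α), P x) :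
    ∀ᵐ x ∂(riemVolume n M), P x := by
  rw [volAlpha, ae_withDensity_iff (hα.measurable.ennreal_ofReal.div_const _)] at hP
  filter_upwards [h, hP] with x hx hPx
  refine hPx (ENNReal.div_ne_zero.2 ⟨?_, massVol_ne_top hα⟩)
  simpa using hx

theorem memSobolev_grad {ν : Measure M} [IsFiniteMeasure ν] {f : M → ℝ}
    (hf : ContMDiff (𝓡∂ (n + 1)) 𝓘(ℝ, ℝ) 1 f) : MemSobolev (n := n) 2 ν f (grad f) := by
  refine ⟨hf.continuous.memLp_of_hasCompactSupport (HasCompactSupport.of_compactSpace _),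
    fun _ => f, fun _ => hf, fun _ => ?_, ?_, ?_⟩
  · simp
  · simp
  · simp

theorem lintegral_grad_lt_top {ν : Measure M} [IsFiniteMeasure ν] {f : M → ℝ}
    (hf : ContMDiff (𝓡∂ (n + 1)) 𝓘(ℝ, ℝ) 1 f) :
    ∫⁻ x, ‖grad (n := n) f x‖ₑ ^ (2 : ℝ) ∂ν < ⊤ := by
  have h := lintegral_ofReal_lt_top (μ := ν) ((continuous_norm_grad hf).pow 2)
  convert h using 3 with x
  rw [Pi.pow_apply, ENNReal.ofReal_pow (norm_nonneg _), ofReal_norm]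
  norm_cast

/-- The Sobolev-Poincaré inequality with the optimal constant, for a `C¹` function of mean zero. -/
theorem sobolevPoincare_le {α β f : M → ℝ} [IsFiniteMeasure (volAlpha n α)]
    (hf : ContMDiff (𝓡∂ (n + 1)) 𝓘(ℝ, ℝ) 1 f) (hm : ∫ x, f x ∂(volAlpha n α) = 0)
    (hE : ∫⁻ x, ‖grad (n := n) f x‖ₑ ^ (2 : ℝ) ∂(volAlpha n α) ≠ 0) (q : ℝ) :
    (∫⁻ x, ‖f x‖ₑ ^ q ∂(volBeta n β)) ^ (1 / q) ≤ sobolevPoincareConst n β α q 2 *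
      (∫⁻ x, ‖grad (n := n) f x‖ₑ ^ (2 : ℝ) ∂(volAlpha n α)) ^ (1 / 2 : ℝ) := by
  have hE' := (lintegral_grad_lt_top (ν := volAlpha n α) hf).ne
  have h0 : (∫⁻ x, ‖grad (n := n) f x‖ₑ ^ (2 : ℝ) ∂(volAlpha n α)) ^ (1 / 2 : ℝ) ≠ 0 :=
    fun h => hE ((ENNReal.rpow_eq_zero_iff_of_pos (by norm_num)).1 h)
  have h1 : (∫⁻ x, ‖grad (n := n) f x‖ₑ ^ (2 : ℝ) ∂(volAlpha n α)) ^ (1 / 2 : ℝ) ≠ ⊤ :=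
    ENNReal.rpow_ne_top_of_nonneg (by norm_num) hE'
  -- Since the energy factor is neither 0 nor ∞, the inequality reads as a lower bound for the
  -- infimum and can be checked on each admissible constant.
  rw [← ENNReal.div_le_iff h0 h1]
  refine le_sInf fun C hC => ?_
  rw [ENNReal.div_le_iff h0 h1]
  simpa [hm] using hC f (grad f) (memSobolev_grad hf)

theorem lintegral_withDensity_div {μ : Measure M} {w h : M → ℝ≥0∞} (hw : Measurable w)
    (hh : Measurable h) (c : ℝ≥0∞) :
    ∫⁻ x, h x ∂(μ.withDensity fun x => w x / c) = (∫⁻ x, w x * h x ∂μ) * c⁻¹ := by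
  have hm : Measurable fun x => w x * h x := hw.mul hh
  rw [lintegral_withDensity_eq_lintegral_mul _ (hw.div_const c) hh, ← lintegral_mul_const _ hm]
  refine lintegral_congr fun x => ?_
  rw [Pi.mul_apply, div_eq_mul_inv]
  ring

/-- The trace inequality in terms of the weighted measures. -/
theorem lintegral_surfBeta_le {ρ β f : M → ℝ} {D : ℝ≥0∞} (hD' : D ≠ ⊤)
    (hρ : ContMDiff (𝓡∂ (n + 1)) 𝓘(ℝ, ℝ) 1 ρ) (hX : IsLipschitzField (n := n) (grad ρ))
    (hρn : ∀ x ∈ (𝓡∂ (n + 1)).boundary M, normalDeriv n ρ x = -1)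
    (hβ : Continuous β) (hβ0 : ∀ x, 0 ≤ β x) (hβd : WeaklyDifferentiable n β)
    (hD : ∀ᵐ x ∂(riemVolume n M), -(D.toReal * β x) ≤ β x * laplacian n ρ x
      + ⟪grad (n := n) ρ x, weakGrad (n := n) β x⟫_ℝ)
    (hf : ContMDiff (𝓡∂ (n + 1)) 𝓘(ℝ, ℝ) 1 f) {p : ℝ} (hp : 1 < p) :
    ∫⁻ x, ‖f x‖ₑ ^ p ∂(surfBeta n β)
      ≤ ENNReal.ofReal p * essSup (fun x => ‖grad (n := n) ρ x‖ₑ) (riemVolume n M)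
          * ∫⁻ x, ‖f x‖ₑ ^ (p - 1) * ‖grad (n := n) f x‖ₑ ∂(volBeta n β)
        + D * ∫⁻ x, ‖f x‖ₑ ^ p ∂(volBeta n β) := by
  have hp0 : 0 < p := by linarith
  set R := essSup (fun x => ‖grad (n := n) ρ x‖ₑ) (riemVolume n M) with hR
  set F : M → ℝ := fun x => ‖f x‖ ^ p with hF
  have hFC := contMDiff_norm_rpow hf hp
  have hF0 : ∀ x, 0 ≤ F x := fun x => by positivity
  have hfm : ∀ q : ℝ, Measurable fun x => ‖f x‖ₑ ^ q := fun q =>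
    hf.continuous.measurable.enorm.pow_const q
  have hgm := measurable_enorm_grad (n := n) hf
  have hFe : ∀ x, ENNReal.ofReal (F x) = ‖f x‖ₑ ^ p := fun x => by
    rw [hF, ← ENNReal.ofReal_rpow_of_nonneg (norm_nonneg _) hp0.le, ofReal_norm]
  have hmain := integral_trace_le hρ hX hρn hβ hβd hD hFC hF0
  have hi : Integrable (fun x => |β x * ⟪grad (n := n) ρ x, grad F x⟫_ℝ| + D.toReal * F x * β x)
      (riemVolume n M) := integrable_of_continuous ((hβ.mul (continuous_inner_grad hρ hFC)).abs.add
        ((continuous_const.mul hFC.continuous).mul hβ))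
  have h1 : ∫⁻ x, ENNReal.ofReal (β x) * ‖f x‖ₑ ^ p ∂(riemSurface n M)
      ≤ ∫⁻ x, ENNReal.ofReal (β x) * (ENNReal.ofReal p * R * (‖f x‖ₑ ^ (p - 1)
        * ‖grad (n := n) f x‖ₑ) + D * ‖f x‖ₑ ^ p) ∂(riemVolume n M) := by
    calc ∫⁻ x, ENNReal.ofReal (β x) * ‖f x‖ₑ ^ p ∂(riemSurface n M)
        = ENNReal.ofReal (∫ x, β x * F x ∂(riemSurface n M)) := by
          have hi' : Integrable (fun x => β x * F x) (riemSurface n M) :=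
            (hβ.mul hFC.continuous).integrable_of_hasCompactSupport
              (HasCompactSupport.of_compactSpace _)
          rw [ofReal_integral_eq_lintegral_ofReal hi'
            (Eventually.of_forall fun x => mul_nonneg (hβ0 x) (hF0 x))]
          refine lintegral_congr fun x => ?_
          rw [ENNReal.ofReal_mul (hβ0 x), hFe]
      _ ≤ ENNReal.ofReal (∫ x, |β x * ⟪grad (n := n) ρ x, grad F x⟫_ℝ| + D.toReal * F x * β x
            ∂(riemVolume n M)) := ENNReal.ofReal_le_ofReal hmain
      _ = ∫⁻ x, ENNReal.ofReal (|β x * ⟪grad (n := n) ρ x, grad F x⟫_ℝ| + D.toReal * F x * β x)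
            ∂(riemVolume n M) := by
          refine ofReal_integral_eq_lintegral_ofReal hi (Eventually.of_forall fun x => ?_)
          exact add_nonneg (abs_nonneg _)
            (mul_nonneg (mul_nonneg ENNReal.toReal_nonneg (hF0 x)) (hβ0 x))
      _ ≤ _ := by
          refine lintegral_mono_ae ?_
          -- Pointwise almost everywhere, |∇ρ| ≤ R and |⟨∇ρ,∇|f|^p⟩| ≤ p|∇ρ||f|^(p-1)|∇f|.
          filter_upwards [ENNReal.ae_le_essSup (μ := riemVolume n M)
            fun x => ‖grad (n := n) ρ x‖ₑ] with x hx
          rw [ENNReal.ofReal_add (abs_nonneg _)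
            (mul_nonneg (mul_nonneg ENNReal.toReal_nonneg (hF0 x)) (hβ0 x)), abs_mul,
            abs_of_nonneg (hβ0 x), ENNReal.ofReal_mul (hβ0 x),
            ENNReal.ofReal_mul (mul_nonneg ENNReal.toReal_nonneg (hF0 x)),
            ENNReal.ofReal_mul ENNReal.toReal_nonneg, ENNReal.ofReal_toReal hD', hFe, mul_add,
            mul_comm (D * _)]
          gcongr
          refine (ENNReal.ofReal_le_ofReal (abs_inner_grad_norm_rpow_le hf hp x _)).trans ?_
          rw [ENNReal.ofReal_mul (by positivity), ENNReal.ofReal_mul hp0.le,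
            ENNReal.ofReal_mul (by positivity), ofReal_norm, ofReal_norm,
            ← ENNReal.ofReal_rpow_of_nonneg (norm_nonneg _) (by linarith), ofReal_norm]
          gcongr
  have h2 : ∫⁻ x, ‖f x‖ₑ ^ p ∂(surfBeta n β)
      = (∫⁻ x, ENNReal.ofReal (β x) * ‖f x‖ₑ ^ p ∂(riemSurface n M)) * (massSurf n β)⁻¹ :=
    lintegral_withDensity_div hβ.measurable.ennreal_ofReal (hfm p) _
  have hm1 : Measurable fun x => ‖f x‖ₑ ^ (p - 1) * ‖grad (n := n) f x‖ₑ := (hfm _).mul hgm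
  have hm2 : Measurable fun x => ENNReal.ofReal p * R * (‖f x‖ₑ ^ (p - 1)
        * ‖grad (n := n) f x‖ₑ) + D * ‖f x‖ₑ ^ p := (hm1.const_mul _).add ((hfm p).const_mul D)
  have h3 : (∫⁻ x, ENNReal.ofReal (β x) * (ENNReal.ofReal p * R * (‖f x‖ₑ ^ (p - 1)
        * ‖grad (n := n) f x‖ₑ) + D * ‖f x‖ₑ ^ p) ∂(riemVolume n M)) * (massSurf n β)⁻¹
      = ENNReal.ofReal p * R * ∫⁻ x, ‖f x‖ₑ ^ (p - 1) * ‖grad (n := n) f x‖ₑ ∂(volBeta n β)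
        + D * ∫⁻ x, ‖f x‖ₑ ^ p ∂(volBeta n β) := by
    rw [← lintegral_const_mul _ hm1, ← lintegral_const_mul _ (hfm p),
      ← lintegral_add_left (hm1.const_mul _)]
    exact (lintegral_withDensity_div hβ.measurable.ennreal_ofReal hm2 _).symm
  rw [h2, ← h3]
  gcongr

/-- Comparison of the two weighted volume measures. -/
theorem lintegral_volBeta_le {α β : M → ℝ} [Nonempty M] (hα : Continuous α) (hβ : Continuous β)
    (hα_pos : ∀ᵐ x ∂(riemVolume n M), 0 < α x) {h : M → ℝ≥0∞} (hh : Measurable h) :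
    ∫⁻ x, h x ∂(volBeta n β) ≤ essSup (fun x => ‖β x / α x‖ₑ) (riemVolume n M)
      * (massVol n α / massSurf n β) * ∫⁻ x, h x ∂(volAlpha n α) := by
  have hA0 := massVol_ne_zero hα hα_pos
  have hA1 := massVol_ne_top (n := n) hα
  rw [← lintegral_const_mul _ hh, volBeta, volAlpha,
    lintegral_withDensity_eq_lintegral_mul _ (hβ.measurable.ennreal_ofReal.div_const _) hh,
    lintegral_withDensity_eq_lintegral_mul _ (hα.measurable.ennreal_ofReal.div_const _)
      (hh.const_mul _)]
  refine lintegral_mono_ae ?_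
  filter_upwards [hα_pos, ENNReal.ae_le_essSup (μ := riemVolume n M) fun x => ‖β x / α x‖ₑ]
    with x hx hK
  set K := essSup (fun x => ‖β x / α x‖ₑ) (riemVolume n M)
  simp only [Pi.mul_apply]
  have h1 : ENNReal.ofReal (β x) ≤ K * ENNReal.ofReal (α x) := by
    calc ENNReal.ofReal (β x) = ENNReal.ofReal (β x / α x) * ENNReal.ofReal (α x) := by
          rw [← ENNReal.ofReal_mul' hx.le, div_mul_cancel₀ _ hx.ne']
      _ ≤ K * ENNReal.ofReal (α x) := by
          gcongr
          refine le_trans ?_ hK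
          rw [Real.enorm_eq_ofReal_abs]
          exact ENNReal.ofReal_le_ofReal (le_abs_self _)
  -- The mass A cancels because it is neither 0 nor ∞; nothing of this kind is asked of B.
  have h2 : ENNReal.ofReal (α x) / massVol n α * (K * (massVol n α / massSurf n β) * h x)
      = K * ENNReal.ofReal (α x) / massSurf n β * h x := by
    simp only [div_eq_mul_inv]
    calc _ = (massVol n α * (massVol n α)⁻¹)
          * (K * ENNReal.ofReal (α x) * (massSurf n β)⁻¹ * h x) := by ring
      _ = _ := by rw [ENNReal.mul_inv_cancel hA0 hA1, one_mul]
  rw [h2]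
  gcongr

/-- Cauchy–Schwarz, with the factor in u written as a power of its norm of exponent 2(p - 1), the
shape in which the Sobolev–Poincaré constant enters. -/
theorem lintegral_mul_rpow_le {ν : Measure M} {p : ℝ} (hp : 1 < p) {u v : M → ℝ≥0∞}
    (hu : Measurable u) (hv : Measurable v) :
    ∫⁻ x, u x ^ (p - 1) * v x ∂ν
      ≤ ((∫⁻ x, u x ^ (2 * (p - 1)) ∂ν) ^ (1 / (2 * (p - 1)))) ^ (p - 1)
        * (∫⁻ x, v x ^ (2 : ℝ) ∂ν) ^ (1 / 2 : ℝ) := by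
  have h := ENNReal.lintegral_mul_le_Lp_mul_Lq ν (p := 2) (q := 2)
    (Real.holderConjugate_iff.2 ⟨by norm_num, by norm_num⟩)
    (hu.pow_const (p - 1)).aemeasurable hv.aemeasurable
  refine h.trans (le_of_eq ?_)
  congr 1
  rw [← ENNReal.rpow_mul]
  have e : 1 / (2 * (p - 1)) * (p - 1) = 1 / 2 := by
    have : p - 1 ≠ 0 := by linarith
    field_simp
  rw [e]
  simp only [← ENNReal.rpow_mul, mul_comm (p - 1)]

theorem weighted_lower_bound {D b l w : ℝ} (hb : 0 < b) (h : -(l + b⁻¹ * w) ≤ D) :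
    -(D * b) ≤ b * l + w := by
  have h1 := mul_le_mul_of_nonneg_left h hb.le
  have h2 : b * -(l + b⁻¹ * w) = -(b * l + w) := by field_simp
  rw [h2] at h1
  linarith

/-- As α > 0 almost everywhere, the gradient vanishes almost everywhere and by continuity
everywhere. Connectedness makes f constant, and its mean is 0. -/
theorem eq_zero_of_lintegral_grad_eq_zero [ConnectedSpace M] {α f : M → ℝ} (hα : Continuous α)
    (hα_pos : ∀ᵐ x ∂(riemVolume n M), 0 < α x) (hf : ContMDiff (𝓡∂ (n + 1)) 𝓘(ℝ, ℝ) 1 f)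
    (hm : ∫ x, f x ∂(volAlpha n α) = 0)
    (hE : ∫⁻ x, ‖grad (n := n) f x‖ₑ ^ (2 : ℝ) ∂(volAlpha n α) = 0) : f = 0 := by
  have := isProbabilityMeasure_volAlpha hα hα_pos
  rw [lintegral_eq_zero_iff ((measurable_enorm_grad hf).pow_const _)] at hE
  have h1 : ∀ᵐ x ∂(riemVolume n M), ‖grad (n := n) f x‖ = 0 := by
    filter_upwards [ae_riemVolume_of_ae_volAlpha hα hα_pos hE] with x hx
    simpa using hx
  have h2 := eq_zero_of_ae_riemVolume (continuous_norm_grad hf) h1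
  have h3 := isLocallyConstant_of_grad_eq_zero hf fun x => norm_eq_zero.1 (congrFun h2 x)
  funext x
  have h4 : ∀ y, f y = f x := fun y => h3.apply_eq_of_preconnectedSpace y x
  simp only [h4] at hm
  simpa using hm

/-- The weight β/B is nonzero almost everywhere because B is finite, so f vanishes almost everywhere
and by continuity everywhere. -/
theorem eq_zero_of_lintegral_volBeta_eq_zero {β f : M → ℝ} (hβ : Continuous β)
    (hβ_pos : ∀ᵐ x ∂(riemVolume n M), 0 < β x) (hf : Continuous f) {p : ℝ} (hp : 0 < p)
    (h : ∫⁻ x, ‖f x‖ₑ ^ p ∂(volBeta n β) = 0) : f = 0 := by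
  have hfm : Measurable fun x => ‖f x‖ₑ ^ p := hf.measurable.enorm.pow_const p
  rw [lintegral_eq_zero_iff hfm, volBeta] at h
  have h' := (ae_withDensity_iff (hβ.measurable.ennreal_ofReal.div_const _)).1 h
  refine eq_zero_of_ae_riemVolume (n := n) hf ?_
  filter_upwards [hβ_pos, h'] with x hx h1
  have h2 := h1 (ENNReal.div_ne_zero.2 ⟨by simpa using hx, massSurf_ne_top hβ⟩)
  simpa [hp, hp.le, hp.not_gt] using h2

end Final

end WeightedManifold

end

/-! ### The weighted trace inequality -/

open WeightedManifold

theorem mainTheorem12 (n : ℕ) (hn : 3 ≤ n + 1)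
    {M : Type*} [TopologicalSpace M] [T2Space M] [CompactSpace M] [ConnectedSpace M]
    [ChartedSpace (EuclideanHalfSpace (n + 1)) M] [IsManifold (𝓡∂ (n + 1)) ∞ M]
    [Bundle.RiemannianBundle (fun x : M => TangentSpace (𝓡∂ (n + 1)) x)]
    [IsContMDiffRiemannianBundle (𝓡∂ (n + 1)) ∞ (EuclideanSpace ℝ (Fin (n + 1)))
      (fun x : M => TangentSpace (𝓡∂ (n + 1)) x)]
    [MeasurableSpace M] [BorelSpace M]
    (hbd : IsConnected ((𝓡∂ (n + 1)).boundary M))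
    (α β : M → ℝ) (hα : Continuous α) (hβ : Continuous β)
    (hα_pos : ∀ᵐ x ∂(riemVolume n M), 0 < α x)
    (hβ_pos : ∀ᵐ x ∂(riemVolume n M), 0 < β x)
    (hβ_pos_bd : ∀ᵐ x ∂(riemSurface n M), 0 < β x)
    (hβ_diff : WeaklyDifferentiable n β)
    (ρ : M → ℝ) (hρ : ContMDiff (𝓡∂ (n + 1)) 𝓘(ℝ, ℝ) 1 ρ)
    (hρ_lip : IsLipschitzField (n := n) (grad ρ))
    (hρ_normal : ∀ x ∈ (𝓡∂ (n + 1)).boundary M, normalDeriv n ρ x = -1)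
    (f : M → ℝ) (hf : ContMDiff (𝓡∂ (n + 1)) 𝓘(ℝ, ℝ) 1 f)
    (hf_mean : ∫ x, f x ∂(volAlpha n α) = 0)
    (p : ℝ) (hp : p ∈ Set.Icc (2 : ℝ) ((2 * ((n : ℝ) + 1) - 2) / (((n : ℝ) + 1) - 2))) :
    (∫⁻ x, ‖f x‖ₑ ^ p ∂(surfBeta n β)) ^ (2 / p) ≤
      (((ENNReal.ofReal p * essSup (fun x => ‖grad (n := n) ρ x‖ₑ) (riemVolume n M)) ^ (2 : ℝ)
            * essSup (fun x => ‖β x / α x‖ₑ) (riemVolume n M)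
            * (massVol n α / massSurf n β)
            * sobolevPoincareConst n β α (2 * (p - 1)) 2 ^ (2 * (p - 1))) ^ (1 / p)
        + essSup (fun x => ENNReal.ofReal
              (max (-(laplacian n ρ x
                + ⟪grad (n := n) ρ x, (β x)⁻¹ • weakGrad (n := n) β x⟫_ℝ)) 0))
            (riemVolume n M) ^ (2 / p)
          * sobolevPoincareConst n β α p 2 ^ (2 : ℝ))
      * ∫⁻ x, ‖grad (n := n) f x‖ₑ ^ (2 : ℝ) ∂(volAlpha n α) := by
  have hp2 : 2 ≤ p := hp.1
  have hp0 : 0 < p := by linarith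
  have hp1 : 1 < p := by linarith
  have hα1 := isProbabilityMeasure_volAlpha hα hα_pos
  -- With zero energy the right side is 0 even when the constant is infinite, so the left side must
  -- be shown to vanish.
  by_cases hE : ∫⁻ x, ‖grad (n := n) f x‖ₑ ^ (2 : ℝ) ∂(volAlpha n α) = 0
  · have hf0 := eq_zero_of_lintegral_grad_eq_zero hα hα_pos hf hf_mean hE
    simp [hf0, hp0]
  by_cases hf0 : f = 0
  · simp [hf0, hp0]
  set D := essSup (fun x => ENNReal.ofReal
              (max (-(laplacian n ρ x
                + ⟪grad (n := n) ρ x, (β x)⁻¹ • weakGrad (n := n) β x⟫_ℝ)) 0))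
            (riemVolume n M) with hDdef
  have hN := fun q => sobolevPoincare_le (β := β) hf hf_mean hE q
  -- Here the right side should be ∞, but the convention 0·∞ = 0 requires excluding a zero
  -- Sobolev–Poincaré constant; such a constant would force f = 0.
  by_cases hD : D = ⊤
  · have hC : sobolevPoincareConst n β α p 2 ≠ 0 := by
      intro hC
      have h1 := hN p
      rw [hC, zero_mul, nonpos_iff_eq_zero, ENNReal.rpow_eq_zero_iff_of_pos (by positivity)] at h1
      exact hf0 (eq_zero_of_lintegral_volBeta_eq_zero hβ hβ_pos hf.continuous hp0 h1)
    have hC2 : sobolevPoincareConst n β α p 2 ^ (2 : ℝ) ≠ 0 := by simp [hC]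
    rw [hD, ENNReal.top_rpow_of_pos (by positivity), ENNReal.top_mul hC2, add_top,
      ENNReal.top_mul hE]
    exact le_top
  have hbound : ∀ᵐ x ∂(riemVolume n M), -(D.toReal * β x) ≤ β x * laplacian n ρ x
      + ⟪grad (n := n) ρ x, weakGrad (n := n) β x⟫_ℝ := by
    filter_upwards [hβ_pos, ENNReal.ae_le_essSup (μ := riemVolume n M) fun x => ENNReal.ofReal
      (max (-(laplacian n ρ x + ⟪grad (n := n) ρ x, (β x)⁻¹ • weakGrad (n := n) β x⟫_ℝ)) 0)]
      with x hx hDx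
    refine weighted_lower_bound hx ?_
    rw [← real_inner_smul_right]
    exact (le_max_left _ _).trans ((ENNReal.ofReal_le_iff_le_toReal hD).1 hDx)
  have hS := lintegral_surfBeta_le hD hρ hρ_lip hρ_normal hβ
    (nonneg_of_ae_riemVolume hβ hβ_pos) hβ_diff hbound hf hp1
  refine (rpow_two_div_le_mul hp2 (hN (2 * (p - 1))) (hN p) (D := D)
    (R := ENNReal.ofReal p * essSup (fun x => ‖grad (n := n) ρ x‖ₑ) (riemVolume n M))
    (c := essSup (fun x => ‖β x / α x‖ₑ) (riemVolume n M) * (massVol n α / massSurf n β))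
    (hS.trans ?_)).trans (le_of_eq ?_)
  -- Only the factor with |∇f| is transferred to λ_α; the factor with |f| stays with β dλ/B, the
  -- measure on the left of the Sobolev–Poincaré inequality.
  · refine add_le_add (mul_le_mul_right ((lintegral_mul_rpow_le hp1
      hf.continuous.measurable.enorm (measurable_enorm_grad hf)).trans ?_) _) (le_of_eq ?_)
    · gcongr
      exact lintegral_volBeta_le hα hβ hα_pos ((measurable_enorm_grad hf).pow_const _)
    · rw [← ENNReal.rpow_mul, one_div_mul_cancel hp0.ne', ENNReal.rpow_one]
  · simp only [mul_assoc]
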